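/- Conventions. Manifolds are smooth, finite-dimensional, without boundary, Hausdorff and $\sigma$-compact; sections and bundles are smooth, and $d\xi(X,Y)=X\cdot\xi(Y)-Y\cdot\xi(X)-\xi([X,Y])$ for 1-forms $\xi$. On $TM\oplus T^*M$ put $\langle X_1\oplus\xi_1,X_2\oplus\xi_2\rangle_\pm=\tfrac12(\xi_1(X_2)\pm\xi_2(X_1))$. A Dirac structure on $M$ is a subbundle $L\subset TM\oplus T^*M$ that is maximal isotropic for $\langle\cdot,\cdot\rangle_+$ and whose space of sections is closed under the Courant bracket $$[X_1\oplus\xi_1,X_2\oplus\xi_2]=[X_1,X_2]\oplus\big(\mathcal L_{X_1}\xi_2-\mathcal L_{X_2}\xi_1+\tfrac12d(\xi_1(X_2)-\xi_2(X_1))\big).$$ Then $L$ is a Lie algebroid with this bracket and with anchor $\rho$ the projection to $TM$; for a section $\beta$ of $L^*$, $(d_L\beta)(e_1,e_2)=\rho(e_1)\cdot\beta(e_2)-\rho(e_2)\cdot\beta(e_1)-\beta([e_1,e_2])$. Let $\Upsilon=\langle\cdot,\cdot\rangle_-|_L$. A Dirac–Jacobi structure on $M$ is a subbundle $\bar L$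 of $\mathcal E^1(M)=(TM\times\mathbb R)\oplus(T^*M\times\mathbb R)$ that is maximal isotropic for $\langle(X_1,f_1)\oplus(\xi_1,g_1),(X_2,f_2)\oplus(\xi_2,g_2)\rangle_+=\tfrac12(\xi_1(X_2)+\xi_2(X_1)+g_1f_2+g_2f_1)$ and whose space of sections is closed under the extended Courant bracket $$\begin{aligned}{}[(X_1,f_1)\oplus(\xi_1,g_1),(X_2,f_2)\oplus(\xi_2,g_2)]=\;&\big([X_1,X_2],\,X_1\cdot f_2-X_2\cdot f_1\big)\\&\oplus\big(\mathcal L_{X_1}\xi_2-\mathcal L_{X_2}\xi_1+\tfrac12d(\xi_1(X_2)-\xi_2(X_1))+f_1\xi_2-f_2\xi_1\\&\quad+\tfrac12(g_2df_1-g_1df_2-f_1dg_2+f_2dg_1),\\&\quad X_1\cdot g_2-X_2\cdot g_1+\tfrac12(\xi_1(X_2)-\xi_2(X_1)-f_2g_1+f_1g_2)\big).\end{aligned}$$ Theorem 4.1. Let $L$ be a Dirac structure on a manifold $P$, let $\Omega$ be a 2-form on $P$ and $\beta$ a section of $L^*$ such that $$\rho^*\Omega=\Upsilon+d_L\beta .$$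 Let $\pi:Q\to P$ be a principal $U(1)$-bundle, let $E$ be the infinitesimal generator of the action of $U(1)=\mathbb R/\mathbb Z$ on $Q$, and let $\sigma$ be a connection form on $Q$ (an invariant 1-form with $\sigma(E)=1$) with curvature $\Omega$, i.e. $d\sigma=\pi^*\Omega$ (so that $\Omega$ is closed and integral). Write $X^H$ for the horizontal lift of $X$ with respect to $\sigma$. Then: (1) There is a section $A\oplus\alpha$ of $TP\oplus T^*P$ which is isotropic, i.e. $\alpha(A)=0$, and satisfies $\beta=2\langle A\oplus\alpha,\cdot\rangle_+|_L$. (2) For each such section $A\oplus\alpha$, the sum $\bar L\subset\mathcal E^1(Q)$ of $$\{(X^H+\langle X\oplus\xi,\beta\rangle E,\,0)\oplus(\pi^*\xi,\,0): X\oplus\xi\in L\}$$ and of the line bundles generated by $(-E,0)\oplus(0,1)$ and by $(-A^H,1)\oplus(\sigma-\pi^*\alpha,0)$ is direct, and $\bar L$ is a Dirac–Jacobi structure on $Q$. (3) $\bar L$ does not depend on the choice of $A\oplus\alpha$. -/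

import Mathlib

open scoped Manifold ContDiff
open Bundle VectorField

namespace DiracGeometry

noncomputable section

/-! ### Vector fields and differential forms on a manifold `M` modelled on `E` -/

section Forms

variable (E : Type*) [NormedAddCommGroup E] [NormedSpace ℝ E]
  (M : Type*) [TopologicalSpace M] [ChartedSpace E M]

/-- (Not necessarily smooth) vector fields. -/
abbrev VField := (x : M) → TangentSpace 𝓘(ℝ, E) x

/-- (Not necessarily smooth) 1-forms. -/
abbrev OneForm := (x : M) → (TangentSpace 𝓘(ℝ, E) x →L[ℝ] ℝ)

/-- (Not necessarily smooth) fields of bilinear forms. -/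
abbrev BilinField :=
  (x : M) → (TangentSpace 𝓘(ℝ, E) x →L[ℝ] TangentSpace 𝓘(ℝ, E) x →L[ℝ] ℝ)

variable {E M}

/-- `X` is smooth on `U`, as a section of the tangent bundle. -/
def SmoothVFieldOn [IsManifold 𝓘(ℝ, E) ∞ M] (X : VField E M) (U : Set M) : Prop :=
  ContMDiffOn 𝓘(ℝ, E) (𝓘(ℝ, E).prod 𝓘(ℝ, E)) ∞
    (fun x => TotalSpace.mk' E (E := fun x : M => TangentSpace 𝓘(ℝ, E) x) x (X x)) U

/-- `ξ` is smooth on `U`, as a section of the cotangent bundle. -/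
def SmoothOneFormOn [IsManifold 𝓘(ℝ, E) ∞ M] (ξ : OneForm E M) (U : Set M) : Prop :=
  ContMDiffOn 𝓘(ℝ, E) (𝓘(ℝ, E).prod 𝓘(ℝ, E →L[ℝ] ℝ)) ∞
    (fun x => TotalSpace.mk' (E →L[ℝ] ℝ)
      (E := fun x : M => TangentSpace 𝓘(ℝ, E) x →L[ℝ] ℝ) x (ξ x)) U

/-- Smooth 2-forms: smooth fields of alternating bilinear forms. -/
structure IsTwoForm [IsManifold 𝓘(ℝ, E) ∞ M] (Ω : BilinField E M) : Prop where
  smooth : ContMDiff 𝓘(ℝ, E) (𝓘(ℝ, E).prod 𝓘(ℝ, E →L[ℝ] E →L[ℝ] ℝ)) ∞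
    (fun x => TotalSpace.mk' (E →L[ℝ] E →L[ℝ] ℝ)
      (E := fun x : M => TangentSpace 𝓘(ℝ, E) x →L[ℝ] TangentSpace 𝓘(ℝ, E) x →L[ℝ] ℝ) x (Ω x))
  alternating : ∀ x v, Ω x v v = 0

/-- The derivative `X · f` of a function along a vector field. -/
def dirDeriv (X : VField E M) (f : M → ℝ) : M → ℝ :=
  fun x => mvfderiv 𝓘(ℝ, E) f x (X x)

/-- The pullback of `ξ` to the model space `E` by the inverse of the preferred chart at `x₀`. -/
def chartForm (ξ : OneForm E M) (x₀ : M) (y : E) : E →L[ℝ] ℝ :=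
  (ξ ((extChartAt 𝓘(ℝ, E) x₀).symm y)).comp
    (mfderiv 𝓘(ℝ, E) 𝓘(ℝ, E) (extChartAt 𝓘(ℝ, E) x₀).symm y)

/-- The exterior derivative of a 1-form, computed in the preferred chart `φ` at each point:
`dξ = φ^* d((φ⁻¹)^* ξ)`, where `dη(v, w) = (D_v η)(w) - (D_w η)(v)` on `E`.
(Convention: `dξ(X, Y) = X·ξ(Y) - Y·ξ(X) - ξ([X, Y])`.) -/
def extDerivOne (ξ : OneForm E M) : BilinField E M := fun x =>
  let φ : TangentSpace 𝓘(ℝ, E) x →L[ℝ] E := mvfderiv 𝓘(ℝ, E) (extChartAt 𝓘(ℝ, E) x) x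
  let D : E →L[ℝ] E →L[ℝ] ℝ := fderiv ℝ (chartForm ξ x) (extChartAt 𝓘(ℝ, E) x x)
  ((ContinuousLinearMap.precomp ℝ φ).comp (D - D.flip)).comp φ

/-- The Lie derivative of a 1-form, `ℒ_X ξ = i_X dξ + d(i_X ξ)`. -/
def lieDerivOne (X : VField E M) (ξ : OneForm E M) : OneForm E M := fun x =>
  extDerivOne ξ x (X x) + mvfderiv 𝓘(ℝ, E) (fun y => ξ y (X y)) x

end Forms

/-! ### Smooth subbundles of a vector bundle -/

/-- Given a family of vector spaces `V x` and the notion `smoothOn` of a section of it being smooth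
on a set, a family of subspaces is a smooth subbundle if locally it has a smooth frame. -/
def IsSmoothSubbundle {M : Type*} [TopologicalSpace M] {V : M → Type*}
    [∀ x, AddCommGroup (V x)] [∀ x, Module ℝ (V x)]
    (smoothOn : ((x : M) → V x) → Set M → Prop) (L : (x : M) → Submodule ℝ (V x)) : Prop :=
  ∀ x₀ : M, ∃ U : Set M, IsOpen U ∧ x₀ ∈ U ∧ ∃ (k : ℕ) (e : Fin k → (x : M) → V x),
    (∀ i, smoothOn (e i) U) ∧
    ∀ x ∈ U, LinearIndependent ℝ (fun i => e i x) ∧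
      Submodule.span ℝ (Set.range fun i => e i x) = L x

/-! ### Dirac structures -/

section Dirac

variable (E : Type*) [NormedAddCommGroup E] [NormedSpace ℝ E]
  {M : Type*} [TopologicalSpace M] [ChartedSpace E M]

/-- The fibre of `TM ⊕ T^*M` at `x`. -/
abbrev GenTangent (x : M) :=
  TangentSpace 𝓘(ℝ, E) x × (TangentSpace 𝓘(ℝ, E) x →L[ℝ] ℝ)

variable {E}

/-- The symmetric pairing `⟨X₁ ⊕ ξ₁, X₂ ⊕ ξ₂⟩₊ = ½ (ξ₁(X₂) + ξ₂(X₁))`. -/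
def pairPlus {x : M} (u v : GenTangent E x) : ℝ := (1 / 2 : ℝ) * (u.2 v.1 + v.2 u.1)

/-- The antisymmetric pairing `⟨X₁ ⊕ ξ₁, X₂ ⊕ ξ₂⟩₋ = ½ (ξ₁(X₂) - ξ₂(X₁))`. -/
def pairMinus {x : M} (u v : GenTangent E x) : ℝ := (1 / 2 : ℝ) * (u.2 v.1 - v.2 u.1)

/-- A subspace on which the symmetric pairing vanishes. -/
def IsIsotropic {x : M} (S : Submodule ℝ (GenTangent E x)) : Prop :=
  ∀ u ∈ S, ∀ v ∈ S, pairPlus u v = 0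

/-- A section of `TM ⊕ T^*M` is smooth on `U`. -/
def SmoothGenOn [IsManifold 𝓘(ℝ, E) ∞ M] (e : (x : M) → GenTangent E x) (U : Set M) : Prop :=
  SmoothVFieldOn (fun x => (e x).1) U ∧ SmoothOneFormOn (fun x => (e x).2) U

/-- The Courant bracket. -/
def courantBracket (e₁ e₂ : (x : M) → GenTangent E x) : (x : M) → GenTangent E x :=
  let X₁ : VField E M := fun x => (e₁ x).1
  let X₂ : VField E M := fun x => (e₂ x).1
  let ξ₁ : OneForm E M := fun x => (e₁ x).2
  let ξ₂ : OneForm E M := fun x => (e₂ x).2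
  fun x =>
    (mlieBracket 𝓘(ℝ, E) X₁ X₂ x,
      lieDerivOne X₁ ξ₂ x - lieDerivOne X₂ ξ₁ x +
        (1 / 2 : ℝ) • mvfderiv 𝓘(ℝ, E) (fun y => ξ₁ y (X₂ y) - ξ₂ y (X₁ y)) x)

/-- Smooth global sections of a subbundle `L ⊆ TM ⊕ T^*M`. -/
def IsSectionOf [IsManifold 𝓘(ℝ, E) ∞ M] (L : (x : M) → Submodule ℝ (GenTangent E x))
    (e : (x : M) → GenTangent E x) : Prop :=
  SmoothGenOn e Set.univ ∧ ∀ x, e x ∈ L x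

/-- Dirac structures: maximal isotropic smooth subbundles of `TM ⊕ T^*M` whose space of sections
is closed under the Courant bracket. -/
structure IsDirac [IsManifold 𝓘(ℝ, E) ∞ M]
    (L : (x : M) → Submodule ℝ (GenTangent E x)) : Prop where
  subbundle : IsSmoothSubbundle SmoothGenOn L
  maximal_isotropic : ∀ x, Maximal IsIsotropic (L x)
  integrable : ∀ e₁ e₂, IsSectionOf L e₁ → IsSectionOf L e₂ →
    ∀ x, courantBracket e₁ e₂ x ∈ L x

/-- `β` is a smooth section of the dual bundle `L^*`: it is a fibrewise linear functional that maps
each local smooth section of `L` to a smooth function. -/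
def IsSmoothDualSection [IsManifold 𝓘(ℝ, E) ∞ M] (L : (x : M) → Submodule ℝ (GenTangent E x))
    (β : (x : M) → (L x →ₗ[ℝ] ℝ)) : Prop :=
  ∀ U : Set M, IsOpen U → ∀ e : (x : M) → L x, SmoothGenOn (fun x => (e x : GenTangent E x)) U →
    ContMDiffOn 𝓘(ℝ, E) 𝓘(ℝ, ℝ) ∞ (fun x => β x (e x)) U

/-- The Lie algebroid differential of a 1-cochain `β ∈ Γ(L^*)`, evaluated on `e₁, e₂ ∈ Γ(L)`:
`(d_L β)(e₁, e₂) = ρ(e₁)·β(e₂) - ρ(e₂)·β(e₁) - β([e₁, e₂])`,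
where the anchor `ρ` is the projection to `TM` and the bracket is the Courant bracket. -/
def algebroidDiff [IsManifold 𝓘(ℝ, E) ∞ M] {L : (x : M) → Submodule ℝ (GenTangent E x)}
    (hL : IsDirac L) (β : (x : M) → (L x →ₗ[ℝ] ℝ)) (e₁ e₂ : (x : M) → GenTangent E x)
    (h₁ : IsSectionOf L e₁) (h₂ : IsSectionOf L e₂) (x : M) : ℝ :=
  dirDeriv (fun y => (e₁ y).1) (fun y => β y ⟨e₂ y, h₂.2 y⟩) x
    - dirDeriv (fun y => (e₂ y).1) (fun y => β y ⟨e₁ y, h₁.2 y⟩) x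
    - β x ⟨courantBracket e₁ e₂ x, hL.integrable e₁ e₂ h₁ h₂ x⟩

/-- The prequantization condition `ρ^*Ω = Υ + d_L β` in `Γ(Λ² L^*)`, where `Υ = ⟨·,·⟩₋|_L`. -/
def PrequantCondition [IsManifold 𝓘(ℝ, E) ∞ M] {L : (x : M) → Submodule ℝ (GenTangent E x)}
    (hL : IsDirac L) (Ω : BilinField E M) (β : (x : M) → (L x →ₗ[ℝ] ℝ)) : Prop :=
  ∀ (e₁ e₂ : (x : M) → GenTangent E x) (h₁ : IsSectionOf L e₁) (h₂ : IsSectionOf L e₂) (x : M),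
    Ω x (e₁ x).1 (e₂ x).1 = pairMinus (e₁ x) (e₂ x) + algebroidDiff hL β e₁ e₂ h₁ h₂ x

/-- `a = A ⊕ α` is a smooth isotropic section of `TM ⊕ T^*M` with `β = 2⟨A ⊕ α, ·⟩₊|_L`. -/
structure IsIsotropicExtension [IsManifold 𝓘(ℝ, E) ∞ M]
    (L : (x : M) → Submodule ℝ (GenTangent E x)) (β : (x : M) → (L x →ₗ[ℝ] ℝ))
    (a : (x : M) → GenTangent E x) : Prop where
  smooth : SmoothGenOn a Set.univ
  isotropic : ∀ x, pairPlus (a x) (a x) = 0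
  represents : ∀ x (l : L x), β x l = 2 * pairPlus (a x) (l : GenTangent E x)

end Dirac

/-! ### Dirac-Jacobi structures -/

section DiracJacobi

variable (E : Type*) [NormedAddCommGroup E] [NormedSpace ℝ E]
  {M : Type*} [TopologicalSpace M] [ChartedSpace E M]

/-- The fibre of `ℰ¹(M) = (TM × ℝ) ⊕ (T^*M × ℝ)` at `x`, with elements `((X, f), (ξ, g))`. -/
abbrev ExtTangent (x : M) :=
  (TangentSpace 𝓘(ℝ, E) x × ℝ) × ((TangentSpace 𝓘(ℝ, E) x →L[ℝ] ℝ) × ℝ)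

variable {E}

/-- The symmetric pairing `½ (ξ₁(X₂) + ξ₂(X₁) + g₁ f₂ + g₂ f₁)` on `ℰ¹(M)`. -/
def extPairPlus {x : M} (u v : ExtTangent E x) : ℝ :=
  (1 / 2 : ℝ) * (u.2.1 v.1.1 + v.2.1 u.1.1 + u.2.2 * v.1.2 + v.2.2 * u.1.2)

/-- A subspace of a fibre of `ℰ¹(M)` on which the symmetric pairing vanishes. -/
def IsExtIsotropic {x : M} (S : Submodule ℝ (ExtTangent E x)) : Prop :=
  ∀ u ∈ S, ∀ v ∈ S, extPairPlus u v = 0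

/-- A section of `ℰ¹(M)` is smooth on `U`. -/
def SmoothExtOn [IsManifold 𝓘(ℝ, E) ∞ M] (e : (x : M) → ExtTangent E x) (U : Set M) : Prop :=
  SmoothVFieldOn (fun x => (e x).1.1) U ∧
  ContMDiffOn 𝓘(ℝ, E) 𝓘(ℝ, ℝ) ∞ (fun x => (e x).1.2) U ∧
  SmoothOneFormOn (fun x => (e x).2.1) U ∧
  ContMDiffOn 𝓘(ℝ, E) 𝓘(ℝ, ℝ) ∞ (fun x => (e x).2.2) U

/-- The extended Courant bracket on sections of `ℰ¹(M)`. -/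
def extCourantBracket (e₁ e₂ : (x : M) → ExtTangent E x) : (x : M) → ExtTangent E x :=
  let X₁ : VField E M := fun x => (e₁ x).1.1
  let X₂ : VField E M := fun x => (e₂ x).1.1
  let f₁ : M → ℝ := fun x => (e₁ x).1.2
  let f₂ : M → ℝ := fun x => (e₂ x).1.2
  let ξ₁ : OneForm E M := fun x => (e₁ x).2.1
  let ξ₂ : OneForm E M := fun x => (e₂ x).2.1
  let g₁ : M → ℝ := fun x => (e₁ x).2.2
  let g₂ : M → ℝ := fun x => (e₂ x).2.2
  let d : (M → ℝ) → OneForm E M := mvfderiv 𝓘(ℝ, E)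
  fun x =>
    ((mlieBracket 𝓘(ℝ, E) X₁ X₂ x, dirDeriv X₁ f₂ x - dirDeriv X₂ f₁ x),
      (lieDerivOne X₁ ξ₂ x - lieDerivOne X₂ ξ₁ x
          + (1 / 2 : ℝ) • d (fun y => ξ₁ y (X₂ y) - ξ₂ y (X₁ y)) x
          + f₁ x • ξ₂ x - f₂ x • ξ₁ x
          + (1 / 2 : ℝ) • (g₂ x • d f₁ x - g₁ x • d f₂ x - f₁ x • d g₂ x + f₂ x • d g₁ x),
        dirDeriv X₁ g₂ x - dirDeriv X₂ g₁ x
          + (1 / 2 : ℝ) * (ξ₁ x (X₂ x) - ξ₂ x (X₁ x) - f₂ x * g₁ x + f₁ x * g₂ x)))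

/-- Smooth global sections of a subbundle of `ℰ¹(M)`. -/
def IsExtSectionOf [IsManifold 𝓘(ℝ, E) ∞ M] (L : (x : M) → Submodule ℝ (ExtTangent E x))
    (e : (x : M) → ExtTangent E x) : Prop :=
  SmoothExtOn e Set.univ ∧ ∀ x, e x ∈ L x

/-- Dirac-Jacobi structures: maximal isotropic smooth subbundles of `ℰ¹(M)` whose space of sections
is closed under the extended Courant bracket. -/
structure IsDiracJacobi [IsManifold 𝓘(ℝ, E) ∞ M]
    (L : (x : M) → Submodule ℝ (ExtTangent E x)) : Prop where
  subbundle : IsSmoothSubbundle SmoothExtOn L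
  maximal_isotropic : ∀ x, Maximal IsExtIsotropic (L x)
  integrable : ∀ e₁ e₂, IsExtSectionOf L e₁ → IsExtSectionOf L e₂ →
    ∀ x, extCourantBracket e₁ e₂ x ∈ L x

end DiracJacobi

/-! ### Principal `U(1)`-bundles with connection -/

section Circle

variable {E : Type*} [NormedAddCommGroup E] [NormedSpace ℝ E]
  {P : Type*} [TopologicalSpace P] [ChartedSpace E P]
  {F : Type*} [NormedAddCommGroup F] [NormedSpace ℝ F]
  {Q : Type*} [TopologicalSpace Q] [ChartedSpace F Q] [MulAction Circle Q]

/-- `pr : Q → P` is a smooth principal `U(1)`-bundle: the action of `U(1)` on `Q` and the map `pr` are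
smooth, and `pr` has smooth equivariant local trivializations with fibre `U(1)`. -/
structure IsPrincipalCircleBundle (pr : Q → P) : Prop where
  smooth_smul : ContMDiff ((𝓡 1).prod 𝓘(ℝ, F)) 𝓘(ℝ, F) ∞ (fun p : Circle × Q => p.1 • p.2)
  smooth_proj : ContMDiff 𝓘(ℝ, F) 𝓘(ℝ, E) ∞ pr
  proj_smul : ∀ (z : Circle) (q : Q), pr (z • q) = pr q
  locally_trivial : ∀ p : P, ∃ t : Bundle.Trivialization Circle pr, p ∈ t.baseSet ∧
    ContMDiffOn 𝓘(ℝ, F) (𝓘(ℝ, E).prod (𝓡 1)) ∞ t t.source ∧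
    ContMDiffOn (𝓘(ℝ, E).prod (𝓡 1)) 𝓘(ℝ, F) ∞ t.toOpenPartialHomeomorph.symm t.target ∧
    ∀ (z : Circle), ∀ q ∈ t.source, (t (z • q)).2 = z * (t q).2

/-- The infinitesimal generator of the `U(1) = ℝ/ℤ`-action,
`E_q = d/dt|_{t=0} exp(2πit) • q`. (The derivative lies in the tangent space at
`exp(0) • q = q`.) -/
def generator (F : Type*) [NormedAddCommGroup F] [NormedSpace ℝ F]
    {Q : Type*} [TopologicalSpace Q] [ChartedSpace F Q] [MulAction Circle Q] : VField F Q :=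
  fun q => (mfderiv 𝓘(ℝ, ℝ) 𝓘(ℝ, F) (fun t : ℝ => Circle.exp (2 * Real.pi * t) • q) 0 :
    ℝ →L[ℝ] F) 1

/-- `σ` is a (real-valued) connection 1-form for the `U(1)`-action on `Q`:
smooth, invariant, and `σ(E) = 1`. -/
structure IsConnectionForm [IsManifold 𝓘(ℝ, F) ∞ Q] (σ : OneForm F Q) : Prop where
  smooth : SmoothOneFormOn σ Set.univ
  invariant : ∀ (z : Circle) (q : Q) (v : TangentSpace 𝓘(ℝ, F) q),
    σ (z • q) (mfderiv 𝓘(ℝ, F) 𝓘(ℝ, F) (fun q' : Q => z • q') q v) = σ q v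
  apply_generator : ∀ q, σ q (generator F q) = 1

/-- The differential of `pr` at `q`. -/
abbrev dproj (E F : Type*) [NormedAddCommGroup E] [NormedSpace ℝ E]
    [NormedAddCommGroup F] [NormedSpace ℝ F]
    {P : Type*} [TopologicalSpace P] [ChartedSpace E P]
    {Q : Type*} [TopologicalSpace Q] [ChartedSpace F Q] (pr : Q → P) (q : Q) :
    TangentSpace 𝓘(ℝ, F) q →L[ℝ] TangentSpace 𝓘(ℝ, E) (pr q) :=
  mfderiv 𝓘(ℝ, F) 𝓘(ℝ, E) pr q

/-- The 2-form `Ω` on `P` is the curvature of `σ`, i.e. `dσ = pr^*Ω`. -/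
def IsCurvature (pr : Q → P) (σ : OneForm F Q) (Ω : BilinField E P) : Prop :=
  ∀ q (v w : TangentSpace 𝓘(ℝ, F) q),
    extDerivOne σ q v w = Ω (pr q) (dproj E F pr q v) (dproj E F pr q w)

/-- The horizontal lift at `q` of tangent vectors at `pr q`: the inverse of the isomorphism
`ker σ_q → T_{pr q} P` induced by the differential of `pr`. -/
def horizontalLift (pr : Q → P) (σ : OneForm F Q) (q : Q) :
    TangentSpace 𝓘(ℝ, E) (pr q) →L[ℝ] TangentSpace 𝓘(ℝ, F) q :=
  (LinearMap.ker (σ q).toLinearMap).subtypeL.comp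
    ((dproj E F pr q).comp (LinearMap.ker (σ q).toLinearMap).subtypeL).inverse

/-- The subspace `{(X^H + ⟨X ⊕ ξ, β⟩ E, 0) ⊕ (pr^*ξ, 0) : X ⊕ ξ ∈ L}` of `ℰ¹(Q)_q`. -/
def liftPart (pr : Q → P) (σ : OneForm F Q) (L : (x : P) → Submodule ℝ (GenTangent E x))
    (β : (x : P) → (L x →ₗ[ℝ] ℝ)) (q : Q) : Submodule ℝ (ExtTangent F q) :=
  Submodule.span ℝ (Set.range fun l : L (pr q) =>
    (((horizontalLift pr σ q l.1.1 + β (pr q) l • generator F q, 0),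
      (l.1.2.comp (dproj E F pr q), 0)) : ExtTangent F q))

/-- The line spanned by `(-E, 0) ⊕ (0, 1)`. -/
def reebLine (q : Q) : Submodule ℝ (ExtTangent F q) :=
  Submodule.span ℝ {(((-generator F q, 0), (0, 1)) : ExtTangent F q)}

/-- The line spanned by `(-A^H, 1) ⊕ (σ - pr^*α, 0)`, where `a = A ⊕ α`. -/
def connLine (pr : Q → P) (σ : OneForm F Q) (a : (x : P) → GenTangent E x) (q : Q) :
    Submodule ℝ (ExtTangent F q) :=
  Submodule.span ℝ {(((-horizontalLift pr σ q (a (pr q)).1, 1),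
    (σ q - (a (pr q)).2.comp (dproj E F pr q), 0)) : ExtTangent F q)}

/-- The family of subspaces of `ℰ¹(Q)` built from the above three pieces. -/
def prequantSubbundle (pr : Q → P) (σ : OneForm F Q)
    (L : (x : P) → Submodule ℝ (GenTangent E x)) (β : (x : P) → (L x →ₗ[ℝ] ℝ))
    (a : (x : P) → GenTangent E x) (q : Q) : Submodule ℝ (ExtTangent F q) :=
  liftPart pr σ L β q ⊔ reebLine q ⊔ connLine pr σ a q

end Circle

end

end DiracGeometry

/-! Everything reduces to pointwise linear algebra, plus one function measuring the failure of
integrability.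

Linear algebra. The pairing on `TP ⊕ T^*P` has split signature, so a subspace that is maximal
isotropic with respect to inclusion equals its own orthogonal complement (`mem_of_orthogonal`). For
part (1), choose a Riemannian metric and let `G` be the induced positive definite form on `TP ⊕
T^*P`. Represent `β` as `G(l, ·)` with `l` in `L` and swap the two components of `l` by the musical
isomorphisms. The swap preserves the pairing and turns `G` into twice the pairing, so the swapped
section is null because `l` is, and it represents `β`. For parts (2) and (3), the linear map
`quantMap` from `L × ℝ × ℝ` parametrizes the candidate bundle. Its injectivity gives directness and
smooth frames. Maximality follows because orthogonality to the three pieces forces membership: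
orthogonality to the Reeb line gives the shape of the element, to the lift of `L` its component in
`L`, and to the connection line its vertical component. Two choices of `A ⊕ α` differ by a section
of `L` on which `β` vanishes, hence part (3).

Integrability. On isotropic sections, twice the pairing of `[e₁, e₂]` with `e₃` is a cyclic sum
`T(e₁, e₂, e₃)` of terms `jacobiTerm` (`two_mul_extPairPlus_bracket`). The pairing sees only the
value of `e₃` at the point, and `T` is cyclically invariant, so `T` depends only on the point values
of all three sections. Each may therefore be replaced by a section induced from `P` with constant
coefficients `f` and `g`. For those, `T` is a cyclic sum of expressions on `P` (`jacobiTerm_lift`);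
the curvature enters through `dσ` evaluated on projectable fields. The cyclic sum vanishes
coefficient by coefficient in the `f`s: the constant part is integrability of `L`, the linear part
is `ρ^*Ω = Υ + d_L β`, and the rest cancels by skewness of `Ω` and `α(A) = 0`
(`baseTerm_cyclic_sum`). -/

namespace DiracGeometry

noncomputable section

set_option linter.unusedSectionVars false

/-! ### Coordinate expressions and Cartan's formula -/

section Calculus

variable {E : Type*} [NormedAddCommGroup E] [NormedSpace ℝ E] [CompleteSpace E]
  {M : Type*} [TopologicalSpace M] [ChartedSpace E M] [IsManifold 𝓘(ℝ, E) ∞ M]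

open Filter Topology

/-- The coordinate expression of a vector field in the preferred chart at `x₀`. -/
def chartField (X : VField E M) (x₀ : M) (y : E) : E :=
  mpullbackWithin 𝓘(ℝ, E) 𝓘(ℝ, E) (extChartAt 𝓘(ℝ, E) x₀).symm X (Set.range 𝓘(ℝ, E)) y

lemma chartForm_chartField (ξ : OneForm E M) (X : VField E M) (x₀ : M) {y : E}
    (hy : y ∈ (extChartAt 𝓘(ℝ, E) x₀).target) :
    chartForm ξ x₀ y (chartField X x₀ y) =
      ξ ((extChartAt 𝓘(ℝ, E) x₀).symm y) (X ((extChartAt 𝓘(ℝ, E) x₀).symm y)) := by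
  have := isInvertible_mfderivWithin_extChartAt_symm (I := 𝓘(ℝ, E)) hy
  rw [ModelWithCorners.range_eq_univ, mfderivWithin_univ] at this
  simp only [chartForm, chartField, mpullbackWithin_apply, ModelWithCorners.range_eq_univ,
    mfderivWithin_univ]
  erw [ContinuousLinearMap.comp_apply, this.self_apply_inverse]

lemma chartField_self (X : VField E M) (x₀ : M) :
    chartField X x₀ (extChartAt 𝓘(ℝ, E) x₀ x₀) = X x₀ := by
  simp only [chartField, mpullbackWithin_apply]
  erw [extChartAt_to_inv (I := 𝓘(ℝ, E)) x₀]
  exact mfderivWithin_extChartAt_symm_inverse_apply (I := 𝓘(ℝ, E)) (X x₀)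

lemma differentiableAt_chartField {X : VField E M} {x : M}
    (hX : MDifferentiableAt 𝓘(ℝ, E) (𝓘(ℝ, E).prod 𝓘(ℝ, E))
      (fun x => TotalSpace.mk' E (E := fun x : M => TangentSpace 𝓘(ℝ, E) x) x (X x)) x) :
    DifferentiableAt ℝ (chartField X x) (extChartAt 𝓘(ℝ, E) x x) := by
  have := MDifferentiableWithinAt.differentiableWithinAt_mpullbackWithin_vectorField
    (I := 𝓘(ℝ, E)) (mdifferentiableWithinAt_univ.2 hX)
  have hs : (extChartAt 𝓘(ℝ, E) x).symm ⁻¹' Set.univ ∩ Set.range 𝓘(ℝ, E) = Set.univ := by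
    rw [Set.preimage_univ, Set.univ_inter, ModelWithCorners.range_eq_univ]
  rw [hs] at this
  exact differentiableWithinAt_univ.1 this

/-- The tangent space at `x` is identified with `E` through the preferred chart at `x`, whose
derivative there is the identity. No correction term survives at the centre of the chart. -/
lemma mlieBracket_eq_chart (X Y : VField E M) (x : M) :
    mlieBracket 𝓘(ℝ, E) X Y x =
      lieBracket ℝ (chartField X x) (chartField Y x) (extChartAt 𝓘(ℝ, E) x x) := by
  have hs : (extChartAt 𝓘(ℝ, E) x).symm ⁻¹' Set.univ ∩ Set.range 𝓘(ℝ, E) = Set.univ := by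
    rw [Set.preimage_univ, Set.univ_inter, ModelWithCorners.range_eq_univ]
  rw [← mlieBracketWithin_univ, mlieBracketWithin_apply, mfderiv_extChartAt_self, hs]
  change (ContinuousLinearMap.id ℝ E).inverse
    (lieBracketWithin ℝ (chartField X x) (chartField Y x) Set.univ (extChartAt 𝓘(ℝ, E) x x)) = _
  rw [ContinuousLinearMap.inverse_id, lieBracketWithin_univ]
  rfl

lemma mvfderiv_eq_chart {f : M → ℝ} {x : M} (hf : MDifferentiableAt 𝓘(ℝ, E) 𝓘(ℝ, ℝ) f x) :
    mvfderiv 𝓘(ℝ, E) f x = fderiv ℝ (f ∘ (extChartAt 𝓘(ℝ, E) x).symm) (extChartAt 𝓘(ℝ, E) x x) := by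
  rw [hf.mvfderiv, ModelWithCorners.range_eq_univ, fderivWithin_univ]
  rfl

lemma extDerivOne_eq_chart (ξ : OneForm E M) (x : M) (v w : TangentSpace 𝓘(ℝ, E) x) :
    extDerivOne ξ x v w =
      fderiv ℝ (chartForm ξ x) (extChartAt 𝓘(ℝ, E) x x) v w -
      fderiv ℝ (chartForm ξ x) (extChartAt 𝓘(ℝ, E) x x) w v := by
  have h (v : TangentSpace 𝓘(ℝ, E) x) : mvfderiv 𝓘(ℝ, E) (extChartAt 𝓘(ℝ, E) x) x v = v := by
    simp only [mvfderiv, mfderiv_extChartAt_self]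
    rfl
  calc extDerivOne ξ x v w = fderiv ℝ (chartForm ξ x) (extChartAt 𝓘(ℝ, E) x x)
          (mvfderiv 𝓘(ℝ, E) (extChartAt 𝓘(ℝ, E) x) x v) (mvfderiv 𝓘(ℝ, E) (extChartAt 𝓘(ℝ, E) x) x w) -
      fderiv ℝ (chartForm ξ x) (extChartAt 𝓘(ℝ, E) x x)
          (mvfderiv 𝓘(ℝ, E) (extChartAt 𝓘(ℝ, E) x) x w)
          (mvfderiv 𝓘(ℝ, E) (extChartAt 𝓘(ℝ, E) x) x v) := rfl
    _ = _ := by rw [h, h]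

/-- Cartan's formula for the exterior derivative of a 1-form whose coordinate expression is
differentiable. -/
lemma extDerivOne_apply_of_differentiableAt {ξ : OneForm E M} {X Y : VField E M} {x : M}
    (hξ : DifferentiableAt ℝ (chartForm ξ x) (extChartAt 𝓘(ℝ, E) x x))
    (hX : MDifferentiableAt 𝓘(ℝ, E) (𝓘(ℝ, E).prod 𝓘(ℝ, E))
      (fun x => TotalSpace.mk' E (E := fun x : M => TangentSpace 𝓘(ℝ, E) x) x (X x)) x)
    (hY : MDifferentiableAt 𝓘(ℝ, E) (𝓘(ℝ, E).prod 𝓘(ℝ, E))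
      (fun x => TotalSpace.mk' E (E := fun x : M => TangentSpace 𝓘(ℝ, E) x) x (Y x)) x)
    (hξX : MDifferentiableAt 𝓘(ℝ, E) 𝓘(ℝ, ℝ) (fun y => ξ y (X y)) x)
    (hξY : MDifferentiableAt 𝓘(ℝ, E) 𝓘(ℝ, ℝ) (fun y => ξ y (Y y)) x) :
    extDerivOne ξ x (X x) (Y x) =
      dirDeriv X (fun y => ξ y (Y y)) x - dirDeriv Y (fun y => ξ y (X y)) x
        - ξ x (mlieBracket 𝓘(ℝ, E) X Y x) := by
  have hX' := differentiableAt_chartField hX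
  have hY' := differentiableAt_chartField hY
  have htgt : (extChartAt 𝓘(ℝ, E) x).target ∈ 𝓝 (extChartAt 𝓘(ℝ, E) x x) :=
    extChartAt_target_mem_nhds x
  -- This is the product rule for `ξ(V)` in the chart. The terms with the derivative of `V` assemble
  -- into the Lie bracket, those with the derivative of `ξ` into `dξ`.
  have key (V : VField E M) (hV : DifferentiableAt ℝ (chartField V x) (extChartAt 𝓘(ℝ, E) x x))
      (h : MDifferentiableAt 𝓘(ℝ, E) 𝓘(ℝ, ℝ) (fun y => ξ y (V y)) x) (w : E) :
      mvfderiv 𝓘(ℝ, E) (fun y => ξ y (V y)) x w =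
        chartForm ξ x (extChartAt 𝓘(ℝ, E) x x)
          (fderiv ℝ (chartField V x) (extChartAt 𝓘(ℝ, E) x x) w) +
        fderiv ℝ (chartForm ξ x) (extChartAt 𝓘(ℝ, E) x x) w
          (chartField V x (extChartAt 𝓘(ℝ, E) x x)) := by
    rw [mvfderiv_eq_chart h]
    have : (fun y => ξ y (V y)) ∘ (extChartAt 𝓘(ℝ, E) x).symm =ᶠ[𝓝 (extChartAt 𝓘(ℝ, E) x x)]
        fun y => chartForm ξ x y (chartField V x y) := by
      filter_upwards [htgt] with y hy using (chartForm_chartField ξ V x hy).symm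
    rw [this.fderiv_eq]
    erw [fderiv_clm_apply hξ hV]
    rfl
  have h0 : chartForm ξ x (extChartAt 𝓘(ℝ, E) x x) (mlieBracket 𝓘(ℝ, E) X Y x) =
      ξ x (mlieBracket 𝓘(ℝ, E) X Y x) := by
    have := chartForm_chartField ξ (mlieBracket 𝓘(ℝ, E) X Y) x (mem_extChartAt_target x)
    erw [chartField_self, extChartAt_to_inv (I := 𝓘(ℝ, E)) x] at this
    exact this
  rw [← h0, extDerivOne_eq_chart, dirDeriv, dirDeriv, mlieBracket_eq_chart]
  erw [key Y hY' hξY (X x), key X hX' hξX (Y x)]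
  rw [lieBracket, chartField_self, chartField_self]
  rw [map_sub]
  abel

end Calculus

/-! ### Smooth sections, directional derivatives and related vector fields -/

section Calculus2

variable {E : Type*} [NormedAddCommGroup E] [NormedSpace ℝ E]
  {M : Type*} [TopologicalSpace M] [ChartedSpace E M] [IsManifold 𝓘(ℝ, E) ∞ M]

open Filter Topology

/-- `X` is smooth at `x`, as a section of the tangent bundle. -/
def SmoothVFieldAt (X : VField E M) (x : M) : Prop :=
  ContMDiffAt 𝓘(ℝ, E) (𝓘(ℝ, E).prod 𝓘(ℝ, E)) ∞
    (fun x => TotalSpace.mk' E (E := fun x : M => TangentSpace 𝓘(ℝ, E) x) x (X x)) x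

/-- `ξ` is smooth at `x`, as a section of the cotangent bundle. -/
def SmoothOneFormAt (ξ : OneForm E M) (x : M) : Prop :=
  ContMDiffAt 𝓘(ℝ, E) (𝓘(ℝ, E).prod 𝓘(ℝ, E →L[ℝ] ℝ)) ∞
    (fun x => TotalSpace.mk' (E →L[ℝ] ℝ)
      (E := fun x : M => TangentSpace 𝓘(ℝ, E) x →L[ℝ] ℝ) x (ξ x)) x

lemma SmoothVFieldOn.smoothAt {X : VField E M} {U : Set M} (h : SmoothVFieldOn X U) {x : M}
    (hx : U ∈ 𝓝 x) : SmoothVFieldAt X x := ContMDiffOn.contMDiffAt h hx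

lemma SmoothOneFormOn.smoothAt {ξ : OneForm E M} {U : Set M} (h : SmoothOneFormOn ξ U) {x : M}
    (hx : U ∈ 𝓝 x) : SmoothOneFormAt ξ x := ContMDiffOn.contMDiffAt h hx

lemma SmoothVFieldAt.mdifferentiableAt {X : VField E M} {x : M} (h : SmoothVFieldAt X x) :
    MDifferentiableAt 𝓘(ℝ, E) (𝓘(ℝ, E).prod 𝓘(ℝ, E))
      (fun x => TotalSpace.mk' E (E := fun x : M => TangentSpace 𝓘(ℝ, E) x) x (X x)) x :=
  ContMDiffAt.mdifferentiableAt h (by simp)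

lemma SmoothOneFormAt.apply {ξ : OneForm E M} {X : VField E M} {x : M}
    (hξ : SmoothOneFormAt ξ x) (hX : SmoothVFieldAt X x) :
    ContMDiffAt 𝓘(ℝ, E) 𝓘(ℝ, ℝ) ∞ (fun y => ξ y (X y)) x := by
  have := ContMDiffAt.clm_bundle_apply (F₂ := ℝ) (E₂ := fun _ : M => ℝ) hξ hX
  exact (Bundle.contMDiffAt_section _).1 this

/-- The trivialization of the tangent bundle at `x` is inverted near `x` by the derivative of the
inverse chart, so smoothness in the hom bundle is smoothness of the coordinate expression. -/
lemma chartForm_contDiffAt {ξ : OneForm E M} {x : M} (hξ : SmoothOneFormAt ξ x) :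
    ContDiffAt ℝ ∞ (chartForm ξ x) (extChartAt 𝓘(ℝ, E) x x) := by
  have h := ((contMDiffAt_hom_bundle _).1 hξ).2
  have h2 : ContMDiffAt 𝓘(ℝ, E) 𝓘(ℝ, E) ∞ (extChartAt 𝓘(ℝ, E) x).symm
      (extChartAt 𝓘(ℝ, E) x x) :=
    (contMDiffOn_extChartAt_symm x).contMDiffAt (extChartAt_target_mem_nhds x)
  have h3 := h.comp_of_eq h2 (extChartAt_to_inv x)
  rw [contMDiffAt_iff_contDiffAt] at h3
  refine h3.congr_of_eventuallyEq ?_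
  filter_upwards [extChartAt_target_mem_nhds (I := 𝓘(ℝ, E)) x] with y hy
  have hy' : (extChartAt 𝓘(ℝ, E) x).symm y ∈ (chartAt E x).source := by
    rw [← extChartAt_source 𝓘(ℝ, E)]; exact (extChartAt 𝓘(ℝ, E) x).map_target hy
  have hs := TangentBundle.symmL_trivializationAt (I := 𝓘(ℝ, E)) hy'
  rw [ModelWithCorners.range_eq_univ, mfderivWithin_univ, (extChartAt 𝓘(ℝ, E) x).right_inv hy] at hs
  ext v
  simp only [chartForm, Function.comp, ContinuousLinearMap.inCoordinates]
  rw [← hs]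
  simp

/-- The image of a smooth vector field under the differential of a smooth map is a smooth vector
field along the map. -/
lemma SmoothVFieldAt.mfderiv {E' : Type*} [NormedAddCommGroup E'] [NormedSpace ℝ E']
    {M' : Type*} [TopologicalSpace M'] [ChartedSpace E' M'] [IsManifold 𝓘(ℝ, E') ∞ M']
    {X : VField E M} {f : M → M'} {x : M}
    (hX : SmoothVFieldAt X x) (hf : ContMDiffAt 𝓘(ℝ, E) 𝓘(ℝ, E') ∞ f x) :
    ContMDiffAt 𝓘(ℝ, E) (𝓘(ℝ, E').prod 𝓘(ℝ, E')) ∞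
      (fun y => TotalSpace.mk' E' (E := fun z : M' => TangentSpace 𝓘(ℝ, E') z) (f y)
        (mfderiv 𝓘(ℝ, E) 𝓘(ℝ, E') f y (X y))) x := by
  have h := hf.mfderiv_const (m := ∞) (by simp)
  exact ContMDiffAt.clm_apply_of_inCoordinates (b₁ := id) (b₂ := f) h hX hf

lemma dirDeriv_contMDiffAt {X : VField E M} {f : M → ℝ} {x : M}
    (hX : SmoothVFieldAt X x) (hf : ContMDiffAt 𝓘(ℝ, E) 𝓘(ℝ, ℝ) ∞ f x) :
    ContMDiffAt 𝓘(ℝ, E) 𝓘(ℝ, ℝ) ∞ (dirDeriv X f) x := by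
  have h := hX.mfderiv hf
  exact (contMDiff_snd_tangentBundle_modelSpace ℝ 𝓘(ℝ, ℝ)).contMDiffAt.comp x h

lemma dirDeriv_congr (X : VField E M) {f g : M → ℝ} {x : M} (h : f =ᶠ[𝓝 x] g) :
    dirDeriv X f x = dirDeriv X g x := by
  simp only [dirDeriv, mvfderiv, ContinuousLinearMap.comp_apply]
  rw [h.mfderiv_eq]
  rfl

lemma eventually_mdifferentiableAt {E' : Type*} [NormedAddCommGroup E'] [NormedSpace ℝ E']
    {M' : Type*} [TopologicalSpace M'] [ChartedSpace E' M'] [IsManifold 𝓘(ℝ, E') ∞ M']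
    {f : M → M'} {x : M} (hf : ContMDiffAt 𝓘(ℝ, E) 𝓘(ℝ, E') ∞ f x) :
    ∀ᶠ y in 𝓝 x, MDifferentiableAt 𝓘(ℝ, E) 𝓘(ℝ, E') f y := by
  have : ContMDiffAt 𝓘(ℝ, E) 𝓘(ℝ, E') 1 f x := hf.of_le (by simp)
  filter_upwards [(contMDiffAt_iff_contMDiffAt_nhds (by simp)).1 this] with y hy
    using hy.mdifferentiableAt (by simp)

/-- Equality is needed on a whole neighbourhood so that both sides can be differentiated once more
in `d(df) = 0`. -/
lemma chartForm_mvfderiv {f : M → ℝ} {x : M} (hf : ContMDiffAt 𝓘(ℝ, E) 𝓘(ℝ, ℝ) ∞ f x) :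
    chartForm (mvfderiv 𝓘(ℝ, E) f) x =ᶠ[𝓝 (extChartAt 𝓘(ℝ, E) x x)]
      fderiv ℝ (f ∘ (extChartAt 𝓘(ℝ, E) x).symm) := by
  have h2 : ContMDiffAt 𝓘(ℝ, E) 𝓘(ℝ, E) ∞ (extChartAt 𝓘(ℝ, E) x).symm
      (extChartAt 𝓘(ℝ, E) x x) :=
    (contMDiffOn_extChartAt_symm x).contMDiffAt (extChartAt_target_mem_nhds x)
  have hf' := eventually_mdifferentiableAt hf
  rw [← extChartAt_to_inv (I := 𝓘(ℝ, E)) x] at hf'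
  have h3 := (continuousAt_extChartAt_symm (I := 𝓘(ℝ, E)) x).eventually hf'
  filter_upwards [h3, eventually_mdifferentiableAt h2] with y hy hy2
  have := mvfderiv_comp (I := 𝓘(ℝ, E)) y hy hy2
  have e : mvfderiv 𝓘(ℝ, E) (f ∘ (extChartAt 𝓘(ℝ, E) x).symm) y =
      fderiv ℝ (f ∘ (extChartAt 𝓘(ℝ, E) x).symm) y := by
    rw [← mfderiv_eq_fderiv]; rfl
  exact this.symm.trans e

variable [CompleteSpace E]

/-- Cartan's formula for the exterior derivative of a 1-form. -/
lemma extDerivOne_apply {ξ : OneForm E M} {X Y : VField E M} {x : M}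
    (hξ : SmoothOneFormAt ξ x) (hX : SmoothVFieldAt X x) (hY : SmoothVFieldAt Y x) :
    extDerivOne ξ x (X x) (Y x) =
      dirDeriv X (fun y => ξ y (Y y)) x - dirDeriv Y (fun y => ξ y (X y)) x
        - ξ x (mlieBracket 𝓘(ℝ, E) X Y x) :=
  extDerivOne_apply_of_differentiableAt ((chartForm_contDiffAt hξ).differentiableAt (by simp))
    hX.mdifferentiableAt hY.mdifferentiableAt ((hξ.apply hX).mdifferentiableAt (by simp))
    ((hξ.apply hY).mdifferentiableAt (by simp))

/-- The Lie bracket acts on functions as the commutator of the directional derivatives. -/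
lemma dirDeriv_mlieBracket {X Y : VField E M} {f : M → ℝ} {x : M}
    (hX : SmoothVFieldAt X x) (hY : SmoothVFieldAt Y x)
    (hf : ContMDiffAt 𝓘(ℝ, E) 𝓘(ℝ, ℝ) ∞ f x) :
    dirDeriv (mlieBracket 𝓘(ℝ, E) X Y) f x =
      dirDeriv X (dirDeriv Y f) x - dirDeriv Y (dirDeriv X f) x := by
  have hc := chartForm_mvfderiv hf
  have h2 : ContMDiffAt 𝓘(ℝ, E) 𝓘(ℝ, E) ∞ (extChartAt 𝓘(ℝ, E) x).symm
      (extChartAt 𝓘(ℝ, E) x x) :=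
    (contMDiffOn_extChartAt_symm x).contMDiffAt (extChartAt_target_mem_nhds x)
  have h3 : ContDiffAt ℝ ∞ (f ∘ (extChartAt 𝓘(ℝ, E) x).symm) (extChartAt 𝓘(ℝ, E) x x) :=
    contMDiffAt_iff_contDiffAt.1 (hf.comp_of_eq h2 (extChartAt_to_inv x))
  have h4 : ContDiffAt ℝ ∞ (chartForm (mvfderiv 𝓘(ℝ, E) f) x) (extChartAt 𝓘(ℝ, E) x x) :=
    (h3.fderiv_right (by simp)).congr_of_eventuallyEq hc
  have := extDerivOne_apply_of_differentiableAt (h4.differentiableAt (by simp))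
    hX.mdifferentiableAt hY.mdifferentiableAt
    ((dirDeriv_contMDiffAt hX hf).mdifferentiableAt (by simp))
    ((dirDeriv_contMDiffAt hY hf).mdifferentiableAt (by simp))
  rw [extDerivOne_eq_chart, hc.fderiv_eq] at this
  -- Cartan's formula has been applied to `df`. Its left side vanishes because the second derivative
  -- of `f` in the chart is symmetric.
  have hs := (h3.isSymmSndFDerivAt (by simp; norm_cast)).eq (X x) (Y x)
  rw [hs, sub_self] at this
  rw [eq_comm, sub_eq_zero] at this
  exact this.symm

/-- Brackets of `f`-related vector fields are `f`-related. -/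
lemma mfderiv_mlieBracket_of_related {E' : Type*} [NormedAddCommGroup E'] [NormedSpace ℝ E']
    [CompleteSpace E']
    {M' : Type*} [TopologicalSpace M'] [ChartedSpace E' M'] [IsManifold 𝓘(ℝ, E') ∞ M']
    {X Y : VField E M} {X' Y' : VField E' M'} {f : M → M'} {x : M}
    (hX : SmoothVFieldAt X x) (hY : SmoothVFieldAt Y x)
    (hX' : SmoothVFieldAt X' (f x)) (hY' : SmoothVFieldAt Y' (f x))
    (hf : ContMDiffAt 𝓘(ℝ, E) 𝓘(ℝ, E') ∞ f x)
    (hXX' : ∀ᶠ y in 𝓝 x, mfderiv 𝓘(ℝ, E) 𝓘(ℝ, E') f y (X y) = X' (f y))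
    (hYY' : ∀ᶠ y in 𝓝 x, mfderiv 𝓘(ℝ, E) 𝓘(ℝ, E') f y (Y y) = Y' (f y)) :
    mfderiv 𝓘(ℝ, E) 𝓘(ℝ, E') f x (mlieBracket 𝓘(ℝ, E) X Y x) =
      mlieBracket 𝓘(ℝ, E') X' Y' (f x) := by
  have hfd : MDifferentiableAt 𝓘(ℝ, E) 𝓘(ℝ, E') f x := hf.mdifferentiableAt (by simp)
  have key (V : VField E M) (V' : VField E' M') (h : M' → ℝ)
      (hV : ∀ᶠ y in 𝓝 x, mfderiv 𝓘(ℝ, E) 𝓘(ℝ, E') f y (V y) = V' (f y))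
      (hh : ContMDiffAt 𝓘(ℝ, E') 𝓘(ℝ, ℝ) ∞ h (f x)) :
      dirDeriv V (h ∘ f) =ᶠ[𝓝 x] dirDeriv V' h ∘ f := by
    have e1 := hf.continuousAt.eventually (eventually_mdifferentiableAt hh)
    filter_upwards [hV, e1, eventually_mdifferentiableAt hf] with y hy h1 h2
    rw [dirDeriv, mvfderiv_comp_apply y h1 h2, hy]
    rfl
  have main (h : M' → ℝ) (hh : ContMDiffAt 𝓘(ℝ, E') 𝓘(ℝ, ℝ) ∞ h (f x)) :
      mvfderiv 𝓘(ℝ, E') h (f x) (mfderiv 𝓘(ℝ, E) 𝓘(ℝ, E') f x (mlieBracket 𝓘(ℝ, E) X Y x)) =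
      mvfderiv 𝓘(ℝ, E') h (f x) (mlieBracket 𝓘(ℝ, E') X' Y' (f x)) := by
    have h1 := dirDeriv_mlieBracket hX hY (hh.comp x hf)
    have h2 := dirDeriv_mlieBracket hX' hY' hh
    have h3 (V : VField E M) (V' : VField E' M') (W : VField E M) (W' : VField E' M')
        (hV : ∀ᶠ y in 𝓝 x, mfderiv 𝓘(ℝ, E) 𝓘(ℝ, E') f y (V y) = V' (f y))
        (hW : ∀ᶠ y in 𝓝 x, mfderiv 𝓘(ℝ, E) 𝓘(ℝ, E') f y (W y) = W' (f y))
        (hW' : SmoothVFieldAt W' (f x)) :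
        dirDeriv V (dirDeriv W (h ∘ f)) x = dirDeriv V' (dirDeriv W' h) (f x) := by
      have e := key W W' h hW hh
      have e2 := (key V V' (dirDeriv W' h) hV (dirDeriv_contMDiffAt hW' hh)).eq_of_nhds
      rw [← Function.comp_apply (f := dirDeriv V' (dirDeriv W' h)), ← e2]
      exact dirDeriv_congr V e
    rw [h3 X X' Y Y' hXX' hYY' hY', h3 Y Y' X X' hYY' hXX' hX', ← h2] at h1
    rw [dirDeriv, mvfderiv_comp_apply x (hh.mdifferentiableAt (by simp)) hfd] at h1
    exact h1
  -- Vectors are separated by linear functionals, and each functional `ℓ` is the differential at `f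
  -- x` of the function `ℓ ∘ chart`. It therefore suffices to compare both sides as derivations,
  -- where they are commutators of related derivations.
  refine (SeparatingDual.eq_iff_forall_dual_eq (V := E') (R := ℝ)).2 fun ℓ => ?_
  have hφ : ContMDiffAt 𝓘(ℝ, E') 𝓘(ℝ, E') ∞ (extChartAt 𝓘(ℝ, E') (f x)) (f x) :=
    contMDiffAt_extChartAt
  have hd : ∀ v : TangentSpace 𝓘(ℝ, E') (f x),
      mvfderiv 𝓘(ℝ, E') (ℓ ∘ extChartAt 𝓘(ℝ, E') (f x)) (f x) v = ℓ v := by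
    intro v
    have := mfderiv_comp_apply (f x) (ℓ.mdifferentiableAt)
      (hφ.mdifferentiableAt (by simp)) v
    rw [mfderiv_extChartAt_self, ContinuousLinearMap.mfderiv_eq] at this
    exact this
  have := main (ℓ ∘ extChartAt 𝓘(ℝ, E') (f x)) (ℓ.contMDiff.contMDiffAt.comp (f x) hφ)
  rw [hd, hd] at this
  exact this

end Calculus2

/-! ### Smoothness tested by evaluation -/

section SmoothnessCriteria

open Filter Topology

variable {E : Type*} [NormedAddCommGroup E] [NormedSpace ℝ E]
  {M : Type*} [TopologicalSpace M] [ChartedSpace E M]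

/-- A map into a space of continuous linear maps on a finite-dimensional space is smooth as soon as
its evaluations are. -/
lemma contMDiffAt_clm_of_apply {V W : Type*} [NormedAddCommGroup V] [NormedSpace ℝ V]
    [FiniteDimensional ℝ V] [NormedAddCommGroup W] [NormedSpace ℝ W]
    {f : M → V →L[ℝ] W} {x : M}
    (h : ∀ v, ContMDiffAt 𝓘(ℝ, E) 𝓘(ℝ, W) ∞ (fun y => f y v) x) :
    ContMDiffAt 𝓘(ℝ, E) 𝓘(ℝ, V →L[ℝ] W) ∞ f x := by
  let b := Module.finBasis ℝ V
  let c : Fin (Module.finrank ℝ V) → (V →L[ℝ] ℝ) := fun j => (b.coord j).toContinuousLinearMap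
  have : f = fun y => ∑ j, ContinuousLinearMap.smulRightL ℝ V W (c j) (f y (b j)) := by
    funext y
    ext v
    conv_lhs => rw [← b.sum_repr v, map_sum]
    simp [c]
  rw [this]
  refine ContMDiffAt.sum fun j _ => ?_
  exact (ContinuousLinearMap.contMDiff _).contMDiffAt.comp x (h (b j))

/-- The coefficients of a smooth map with respect to a family of smooth maps that is linearly
independent at a point are smooth at that point. -/
lemma contMDiffAt_coeff {K : Type*} [NormedAddCommGroup K] [NormedSpace ℝ K]
    [FiniteDimensional ℝ K]
    {ι : Type*} [Fintype ι] {w : ι → M → K} {k : M → K} {c : M → ι → ℝ} {x : M}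
    (hw : ∀ j, ContMDiffAt 𝓘(ℝ, E) 𝓘(ℝ, K) ∞ (w j) x)
    (hk : ContMDiffAt 𝓘(ℝ, E) 𝓘(ℝ, K) ∞ k x)
    (hli : LinearIndependent ℝ (fun j => w j x))
    (hc : ∀ᶠ y in 𝓝 x, ∑ j, c y j • w j y = k y) (j : ι) :
    ContMDiffAt 𝓘(ℝ, E) 𝓘(ℝ, ℝ) ∞ (fun y => c y j) x := by
  classical
  let W : M → (ι → ℝ) →L[ℝ] K := fun y =>
    ∑ j, ContinuousLinearMap.smulRightL ℝ (ι → ℝ) K (ContinuousLinearMap.proj j) (w j y)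
  have hWapp : ∀ y a, W y a = ∑ j, a j • w j y := fun y a => by simp [W]
  have hW : ContMDiffAt 𝓘(ℝ, E) 𝓘(ℝ, (ι → ℝ) →L[ℝ] K) ∞ W x :=
    ContMDiffAt.sum fun j _ => (ContinuousLinearMap.contMDiff _).contMDiffAt.comp x (hw j)
  have hinj : LinearMap.ker (W x).toLinearMap = ⊥ := by
    refine LinearMap.ker_eq_bot'.2 fun a ha => ?_
    have h0 : ∑ j, a j • w j x = 0 := by rw [← hWapp]; exact ha
    funext j
    exact Fintype.linearIndependent_iff.1 hli a h0 j
  obtain ⟨T, hT⟩ := (W x).toLinearMap.exists_leftInverse_of_injective hinj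
  let T' : K →L[ℝ] (ι → ℝ) := T.toContinuousLinearMap
  -- A left inverse `T'` of `W x`, kept constant in `y`, makes `T' ∘ W y` the identity at `x` and so
  -- invertible nearby. The coefficients are then `(T' ∘ W y)⁻¹ (T' (k y))`, smooth because
  -- inversion is.
  let S : M → (ι → ℝ) →L[ℝ] (ι → ℝ) := fun y => T' ∘L W y
  have hS : ContMDiffAt 𝓘(ℝ, E) 𝓘(ℝ, (ι → ℝ) →L[ℝ] (ι → ℝ)) ∞ S x :=
    (ContinuousLinearMap.contMDiff (ContinuousLinearMap.compL ℝ (ι → ℝ) K (ι → ℝ) T')).contMDiffAt.comp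
      x hW
  have hSx : S x = (ContinuousLinearEquiv.refl ℝ (ι → ℝ) : (ι → ℝ) →L[ℝ] (ι → ℝ)) := by
    ext1 a
    exact congrArg (fun g => g a) hT
  have hinv : ContMDiffAt 𝓘(ℝ, E) 𝓘(ℝ, (ι → ℝ) →L[ℝ] (ι → ℝ)) ∞
      (fun y => (S y).inverse) x := by
    refine ContMDiffAt.comp x (g := ContinuousLinearMap.inverse) (ContDiffAt.contMDiffAt ?_) hS
    rw [hSx]
    exact contDiffAt_map_inverse _
  have hev : ∀ᶠ y in 𝓝 x, (S y).IsInvertible := by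
    have := (ContinuousLinearEquiv.refl ℝ (ι → ℝ)).nhds
    rw [← hSx] at this
    filter_upwards [hS.continuousAt.eventually this] with y ⟨e, he⟩ using ⟨e, he⟩
  have hfin : ContMDiffAt 𝓘(ℝ, E) 𝓘(ℝ, ι → ℝ) ∞ (fun y => (S y).inverse (T' (k y))) x :=
    hinv.clm_apply (T'.contMDiff.contMDiffAt.comp x hk)
  refine ((ContinuousLinearMap.contMDiff
    (ContinuousLinearMap.proj (R := ℝ) (φ := fun _ : ι => ℝ) j)).contMDiffAt.comp x
    hfin).congr_of_eventuallyEq ?_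
  filter_upwards [hev, hc] with y hy hcy
  have : T' (k y) = S y (c y) := by
    rw [← hcy, ← hWapp]; rfl
  simp only [Function.comp, this]
  rw [hy.inverse_apply_self]
  rfl

variable [FiniteDimensional ℝ E] [IsManifold 𝓘(ℝ, E) ∞ M]

/-- A bundle map from the tangent bundle is smooth as soon as it maps smooth vector fields to smooth
sections. -/
lemma contMDiffAt_hom_of_apply {G : Type*} [NormedAddCommGroup G] [NormedSpace ℝ G]
    {V : M → Type*} [TopologicalSpace (TotalSpace G V)] [∀ x, AddCommGroup (V x)]
    [∀ x, Module ℝ (V x)] [∀ x, TopologicalSpace (V x)] [∀ x, IsTopologicalAddGroup (V x)]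
    [∀ x, ContinuousSMul ℝ (V x)] [FiberBundle G V] [VectorBundle ℝ G V]
    {φ : (x : M) → TangentSpace 𝓘(ℝ, E) x →L[ℝ] V x} {x : M}
    (h : ∀ X : VField E M, SmoothVFieldAt X x →
      ContMDiffAt 𝓘(ℝ, E) (𝓘(ℝ, E).prod 𝓘(ℝ, G)) ∞ (fun y => TotalSpace.mk' G y (φ y (X y))) x) :
    ContMDiffAt 𝓘(ℝ, E) (𝓘(ℝ, E).prod 𝓘(ℝ, E →L[ℝ] G)) ∞
      (fun y => TotalSpace.mk' (E →L[ℝ] G)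
        (E := fun y : M => TangentSpace 𝓘(ℝ, E) y →L[ℝ] V y) y (φ y)) x := by
  refine (contMDiffAt_hom_bundle _).2 ⟨contMDiffAt_id, ?_⟩
  refine contMDiffAt_clm_of_apply fun v => ?_
  -- The test fields are those that are constant, equal to `v`, in the trivialization at `x`.
  let t := trivializationAt E (TangentSpace 𝓘(ℝ, E) : M → Type _) x
  have h1 := (Bundle.contMDiffAt_section _).1
    (h (fun y => t.symm y v) ?_)
  · have hx : x ∈ t.baseSet := FiberBundle.mem_baseSet_trivializationAt' x
    refine h1.congr_of_eventuallyEq ?_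
    filter_upwards [t.open_baseSet.mem_nhds hx, (trivializationAt G V x).open_baseSet.mem_nhds
      (FiberBundle.mem_baseSet_trivializationAt' x)] with y hy' hy
    simp only [ContinuousLinearMap.inCoordinates, ContinuousLinearMap.comp_apply]
    rw [Trivialization.continuousLinearMapAt_apply, Trivialization.linearMapAt_apply, if_pos hy,
      Trivialization.symmL_apply _ hy']
  · have hx : x ∈ t.baseSet := FiberBundle.mem_baseSet_trivializationAt' x
    refine (t.contMDiffAt_section_iff hx).2 ?_
    refine (contMDiffAt_const (c := v)).congr_of_eventuallyEq ?_
    filter_upwards [t.open_baseSet.mem_nhds hx] with y hy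
    rw [t.apply_mk_symm hy]

lemma smoothOneFormAt_of_apply {ξ : OneForm E M} {x : M}
    (h : ∀ X : VField E M, SmoothVFieldAt X x →
      ContMDiffAt 𝓘(ℝ, E) 𝓘(ℝ, ℝ) ∞ (fun y => ξ y (X y)) x) : SmoothOneFormAt ξ x :=
  contMDiffAt_hom_of_apply (V := fun _ : M => ℝ) fun X hX =>
    (Bundle.contMDiffAt_section _).2 (h X hX)

/-- A vector field is smooth as soon as its image under a smooth injective bundle map is. -/
lemma smoothVFieldAt_of_apply {K : Type*} [NormedAddCommGroup K] [NormedSpace ℝ K]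
    [FiniteDimensional ℝ K]
    {Λ : (x : M) → TangentSpace 𝓘(ℝ, E) x →ₗ[ℝ] K} {Y : VField E M} {x : M}
    (hΛ : ∀ X : VField E M, SmoothVFieldAt X x →
      ContMDiffAt 𝓘(ℝ, E) 𝓘(ℝ, K) ∞ (fun y => Λ y (X y)) x)
    (hinj : Function.Injective (Λ x))
    (hY : ContMDiffAt 𝓘(ℝ, E) 𝓘(ℝ, K) ∞ (fun y => Λ y (Y y)) x) :
    SmoothVFieldAt Y x := by
  let t := trivializationAt E (TangentSpace 𝓘(ℝ, E) : M → Type _) x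
  have hx : x ∈ t.baseSet := FiberBundle.mem_baseSet_trivializationAt' x
  let b := Module.finBasis ℝ E
  have hf : IsLocalFrameOn 𝓘(ℝ, E) E ∞ (t.localFrame b) t.baseSet :=
    t.isLocalFrameOn_localFrame_baseSet 𝓘(ℝ, E) ∞ b
  refine hf.contMDiffAt_of_coeff (fun i => ?_) (t.open_baseSet.mem_nhds hx)
  refine contMDiffAt_coeff (w := fun i y => Λ y (t.localFrame b i y))
    (c := fun y i => hf.coeff i y (Y y))
    (fun j => hΛ _ (hf.contMDiffAt t.open_baseSet hx j)) hY ?_ ?_ i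
  · exact (hf.linearIndependent hx).map' _ (LinearMap.ker_eq_bot.2 hinj)
  · filter_upwards [t.open_baseSet.mem_nhds hx] with y hy
    conv_rhs => rw [hf.coeff_sum_eq Y hy]
    simp

end SmoothnessCriteria

/-! ### Principal circle bundles: vertical vectors and horizontal lifts -/

section CircleBundle

open Filter Topology

variable {E : Type*} [NormedAddCommGroup E] [NormedSpace ℝ E]
  {P : Type*} [TopologicalSpace P] [ChartedSpace E P]
  {F : Type*} [NormedAddCommGroup F] [NormedSpace ℝ F]
  {Q : Type*} [TopologicalSpace Q] [ChartedSpace F Q] [MulAction Circle Q]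
  {pr : Q → P} {σ : OneForm F Q}

/-- An orbit stays in one fibre, so the chain rule applies to a constant map. Non-vanishing of the
generator ensures that the orbit curve is differentiable, since otherwise its `mfderiv` would take
the default value `0`. -/
lemma IsPrincipalCircleBundle.dproj_generator [IsManifold 𝓘(ℝ, F) ∞ Q]
    (hpr : IsPrincipalCircleBundle (E := E) (F := F) pr) (q : Q)
    (hne : generator F q ≠ 0) : dproj E F pr q (generator F q) = 0 := by
  set γ : ℝ → Q := fun t => Circle.exp (2 * Real.pi * t) • q with hγ
  have hγ0 : γ 0 = q := by simp [hγ]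
  have hd : MDifferentiableAt 𝓘(ℝ, ℝ) 𝓘(ℝ, F) γ 0 := by
    by_contra h
    refine hne ?_
    simp only [generator]
    rw [mfderiv_zero_of_not_mdifferentiableAt h]
    rfl
  have hc : pr ∘ γ = fun _ => pr q := by
    funext t; simp [hγ, hpr.proj_smul]
  have h1 := mfderiv_comp_apply_of_eq (I'' := 𝓘(ℝ, E)) (g := pr) (x := (0 : ℝ)) (y := q)
    (hpr.smooth_proj.mdifferentiable (by simp) q) hd hγ0 (1 : ℝ)
  rw [hc, mfderiv_const] at h1
  exact h1.symm

/-- A smooth local trivialization identifies tangent spaces. -/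
lemma IsPrincipalCircleBundle.exists_tangent_equiv [IsManifold 𝓘(ℝ, E) ∞ P]
    [IsManifold 𝓘(ℝ, F) ∞ Q]
    (hpr : IsPrincipalCircleBundle (E := E) (F := F) pr) (q : Q) :
    ∃ T : TangentSpace 𝓘(ℝ, F) q ≃ₗ[ℝ] TangentSpace 𝓘(ℝ, E) (pr q) × EuclideanSpace ℝ (Fin 1),
      ∀ v, (T v).1 = dproj E F pr q v := by
  obtain ⟨t, hp, h1, h2, -⟩ := hpr.locally_trivial (pr q)
  have hq : q ∈ t.source := t.mem_source.2 hp
  have d1 : MDifferentiableAt 𝓘(ℝ, F) (𝓘(ℝ, E).prod (𝓡 1)) t q :=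
    (h1.contMDiffAt (t.open_source.mem_nhds hq)).mdifferentiableAt (by simp)
  have htq : t q ∈ t.target := t.toPartialEquiv.map_source hq
  have d2 : MDifferentiableAt (𝓘(ℝ, E).prod (𝓡 1)) 𝓘(ℝ, F) t.toOpenPartialHomeomorph.symm (t q) :=
    (h2.contMDiffAt (t.open_target.mem_nhds htq)).mdifferentiableAt (by simp)
  have hinv : t.toOpenPartialHomeomorph.symm (t q) = q := t.toOpenPartialHomeomorph.left_inv hq
  have c1 : ∀ v, mfderiv (𝓘(ℝ, E).prod (𝓡 1)) 𝓘(ℝ, F) t.toOpenPartialHomeomorph.symm (t q)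
      (mfderiv 𝓘(ℝ, F) (𝓘(ℝ, E).prod (𝓡 1)) t q v) = v := by
    intro v
    rw [← mfderiv_comp_apply q d2 d1 v]
    have : t.toOpenPartialHomeomorph.symm ∘ t =ᶠ[𝓝 q] id := by
      filter_upwards [t.open_source.mem_nhds hq] with y hy
      exact t.toOpenPartialHomeomorph.left_inv hy
    rw [this.mfderiv_eq, mfderiv_id]
    rfl
  have c2 : ∀ w, mfderiv 𝓘(ℝ, F) (𝓘(ℝ, E).prod (𝓡 1)) t q
      (mfderiv (𝓘(ℝ, E).prod (𝓡 1)) 𝓘(ℝ, F) t.toOpenPartialHomeomorph.symm (t q) w) = w := by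
    intro w
    rw [← mfderiv_comp_apply_of_eq (t q) d1 d2 hinv w]
    have : t ∘ t.toOpenPartialHomeomorph.symm =ᶠ[𝓝 (t q)] id := by
      filter_upwards [t.open_target.mem_nhds htq] with y hy
      exact t.toOpenPartialHomeomorph.right_inv hy
    rw [this.mfderiv_eq, mfderiv_id]
    rfl
  have c3 : ∀ v : F, (mfderiv 𝓘(ℝ, F) (𝓘(ℝ, E).prod (𝓡 1)) t q v :
      E × EuclideanSpace ℝ (Fin 1)).1 = dproj E F pr q v := by
    intro v
    have : pr =ᶠ[𝓝 q] Prod.fst ∘ t := by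
      filter_upwards [t.open_source.mem_nhds hq] with y hy
      exact (t.coe_fst hy).symm
    rw [dproj, this.mfderiv_eq]
    have h := mfderiv_comp_apply (I'' := 𝓘(ℝ, E)) (g := Prod.fst) q mdifferentiableAt_fst d1 v
    rw [mfderiv_fst] at h
    exact h.symm
  let T₁ : F →L[ℝ] E × EuclideanSpace ℝ (Fin 1) := mfderiv 𝓘(ℝ, F) (𝓘(ℝ, E).prod (𝓡 1)) t q
  let T₂ : E × EuclideanSpace ℝ (Fin 1) →L[ℝ] F :=
    mfderiv (𝓘(ℝ, E).prod (𝓡 1)) 𝓘(ℝ, F) t.toOpenPartialHomeomorph.symm (t q)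
  exact ⟨LinearEquiv.ofLinearMap T₁.toLinearMap T₂.toLinearMap (LinearMap.ext c2)
    (LinearMap.ext c1), c3⟩

section Connection

variable [IsManifold 𝓘(ℝ, E) ∞ P] [IsManifold 𝓘(ℝ, F) ∞ Q]

lemma IsConnectionForm.generator_ne_zero (hσ : IsConnectionForm σ) (q : Q) :
    generator F q ≠ 0 := by
  intro h
  have := hσ.apply_generator q
  rw [h, map_zero] at this
  exact zero_ne_one this

lemma dproj_generator (hpr : IsPrincipalCircleBundle (E := E) (F := F) pr)
    (hσ : IsConnectionForm σ) (q : Q) : dproj E F pr q (generator F q) = 0 :=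
  hpr.dproj_generator q (hσ.generator_ne_zero q)

lemma dproj_surjective (hpr : IsPrincipalCircleBundle (E := E) (F := F) pr) (q : Q) :
    Function.Surjective (dproj E F pr q) := by
  obtain ⟨T, hT⟩ := hpr.exists_tangent_equiv q
  intro Z
  exact ⟨T.symm (Z, 0), by rw [← hT, T.apply_symm_apply]⟩

/-- The kernel of the projection is one-dimensional and contains the generator, which is non-zero
because `σ(E) = 1`. A vertical vector is thus `c E`, and `σ` reads off `c`. -/
lemma eq_zero_of_dproj_of_connection (hpr : IsPrincipalCircleBundle (E := E) (F := F) pr)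
    (hσ : IsConnectionForm σ) {q : Q} {v : TangentSpace 𝓘(ℝ, F) q}
    (h1 : dproj E F pr q v = 0) (h2 : σ q v = 0) : v = 0 := by
  obtain ⟨T, hT⟩ := hpr.exists_tangent_equiv q
  have hne : (T (generator F q)).2 ≠ 0 := by
    intro h
    refine hσ.generator_ne_zero q (T.injective ?_)
    rw [map_zero]
    exact Prod.ext ((hT _).trans (dproj_generator hpr hσ q)) h
  obtain ⟨c, hc⟩ := exists_smul_eq_of_finrank_eq_one (K := ℝ)
    (by simp : Module.finrank ℝ (EuclideanSpace ℝ (Fin 1)) = 1) hne (T v).2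
  have hv : v = c • generator F q := by
    refine T.injective (Prod.ext ?_ ?_)
    · rw [hT, hT, map_smul, dproj_generator hpr hσ q, h1, smul_zero]
    · rw [map_smul, Prod.smul_snd, hc]
  rw [hv, map_smul, hσ.apply_generator, smul_eq_mul, mul_one] at h2
  rw [hv, h2, zero_smul]

lemma horizontal_ext (hpr : IsPrincipalCircleBundle (E := E) (F := F) pr)
    (hσ : IsConnectionForm σ) {q : Q} {v w : TangentSpace 𝓘(ℝ, F) q}
    (h1 : dproj E F pr q v = dproj E F pr q w) (h2 : σ q v = σ q w) : v = w :=
  sub_eq_zero.1 (eq_zero_of_dproj_of_connection hpr hσ (by rw [map_sub, h1, sub_self])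
    (by rw [map_sub, h2, sub_self]))

variable [FiniteDimensional ℝ F]

/-- This makes the `inverse` in `horizontalLift` a genuine inverse and not the default `0`. For
surjectivity, any lift `v` is made horizontal by subtracting `σ(v) E`. -/
lemma dproj_restrict_isInvertible (hpr : IsPrincipalCircleBundle (E := E) (F := F) pr)
    (hσ : IsConnectionForm σ) (q : Q) :
    ((dproj E F pr q).comp (LinearMap.ker (σ q).toLinearMap).subtypeL).IsInvertible := by
  set f := (dproj E F pr q).comp (LinearMap.ker (σ q).toLinearMap).subtypeL with hf
  have hinj : Function.Injective f := by
    intro v w h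
    refine Subtype.ext (horizontal_ext hpr hσ h ?_)
    exact v.2.trans w.2.symm
  have hsurj : Function.Surjective f := by
    intro Z
    obtain ⟨v, hv⟩ := dproj_surjective hpr q Z
    refine ⟨⟨v - σ q v • generator F q, ?_⟩, ?_⟩
    · change σ q (v - σ q v • generator F q) = 0
      rw [map_sub, map_smul, hσ.apply_generator, smul_eq_mul, mul_one, sub_self]
    · change dproj E F pr q (v - σ q v • generator F q) = Z
      rw [map_sub, map_smul, dproj_generator hpr hσ, smul_zero, sub_zero, hv]
  have : FiniteDimensional ℝ (TangentSpace 𝓘(ℝ, F) q) := inferInstanceAs (FiniteDimensional ℝ F)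
  have : T2Space (TangentSpace 𝓘(ℝ, F) q) := inferInstanceAs (T2Space F)
  have : T2Space (TangentSpace 𝓘(ℝ, E) (pr q)) := inferInstanceAs (T2Space E)
  exact ⟨(LinearEquiv.ofBijective f.toLinearMap ⟨hinj, hsurj⟩).toContinuousLinearEquiv, rfl⟩

lemma dproj_horizontalLift (hpr : IsPrincipalCircleBundle (E := E) (F := F) pr)
    (hσ : IsConnectionForm σ) (q : Q) (Z : TangentSpace 𝓘(ℝ, E) (pr q)) :
    dproj E F pr q (horizontalLift pr σ q Z) = Z :=
  (dproj_restrict_isInvertible hpr hσ q).self_apply_inverse Z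

lemma connection_horizontalLift (q : Q) (Z : TangentSpace 𝓘(ℝ, E) (pr q)) :
    σ q (horizontalLift pr σ q Z) = 0 :=
  (((dproj E F pr q).comp (LinearMap.ker (σ q).toLinearMap).subtypeL).inverse Z).2

lemma horizontal_decomposition (hpr : IsPrincipalCircleBundle (E := E) (F := F) pr)
    (hσ : IsConnectionForm σ) (q : Q) (v : TangentSpace 𝓘(ℝ, F) q) :
    v = horizontalLift pr σ q (dproj E F pr q v) + σ q v • generator F q := by
  refine horizontal_ext hpr hσ ?_ ?_
  · rw [map_add, map_smul, dproj_generator hpr hσ, dproj_horizontalLift hpr hσ, smul_zero, add_zero]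
  · rw [map_add, map_smul, connection_horizontalLift, hσ.apply_generator, zero_add, smul_eq_mul,
      mul_one]

/-- A vector field on the total space is smooth as soon as its projection to the base and its
vertical component are. -/
lemma smoothVFieldAt_of_dproj (hpr : IsPrincipalCircleBundle (E := E) (F := F) pr)
    (hσ : IsConnectionForm σ) {Y : VField F Q} {q : Q}
    [FiniteDimensional ℝ E]
    (h1 : ContMDiffAt 𝓘(ℝ, F) (𝓘(ℝ, E).prod 𝓘(ℝ, E)) ∞
      (fun y => TotalSpace.mk' E (E := fun z : P => TangentSpace 𝓘(ℝ, E) z) (pr y)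
        (dproj E F pr y (Y y))) q)
    (h2 : ContMDiffAt 𝓘(ℝ, F) 𝓘(ℝ, ℝ) ∞ (fun y => σ y (Y y)) q) :
    SmoothVFieldAt Y q := by
  let t := trivializationAt E (TangentSpace 𝓘(ℝ, E) : P → Type _) (pr q)
  have ht : t.baseSet ∈ 𝓝 (pr q) :=
    t.open_baseSet.mem_nhds (FiberBundle.mem_baseSet_trivializationAt' (pr q))
  have ht' := hpr.smooth_proj.continuous.continuousAt.preimage_mem_nhds ht
  -- The map `v ↦ (dpr v, σ v)`, with `dpr v` read in a trivialization, is an injective smooth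
  -- bundle map into `E × ℝ`. The criterion `smoothVFieldAt_of_apply` applies to it.
  have key (X : VField F Q)
      (h1 : ContMDiffAt 𝓘(ℝ, F) (𝓘(ℝ, E).prod 𝓘(ℝ, E)) ∞
        (fun y => TotalSpace.mk' E (E := fun z : P => TangentSpace 𝓘(ℝ, E) z) (pr y)
          (dproj E F pr y (X y))) q)
      (h2 : ContMDiffAt 𝓘(ℝ, F) 𝓘(ℝ, ℝ) ∞ (fun y => σ y (X y)) q) :
      ContMDiffAt 𝓘(ℝ, F) 𝓘(ℝ, E × ℝ) ∞
        (fun y => ((t.linearMapAt ℝ (pr y)).comp (dproj E F pr y).toLinearMap).prod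
          (σ y).toLinearMap (X y)) q := by
    have h3 := (contMDiffAt_totalSpace.1 h1).2
    refine (h3.prodMk_space h2).congr_of_eventuallyEq ?_
    filter_upwards [ht'] with y hy
    refine Prod.ext ?_ rfl
    exact (t.linearMapAt_apply (R := ℝ) _).trans (if_pos hy)
  refine smoothVFieldAt_of_apply (fun X hX => key X (hX.mfderiv (hpr.smooth_proj q))
    ((hσ.smooth.smoothAt Filter.univ_mem).apply hX)) ?_ (key Y h1 h2)
  intro v w hvw
  refine horizontal_ext hpr hσ ?_ (congrArg Prod.snd hvw)
  have := congrArg Prod.fst hvw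
  rw [← t.symmₗ_linearMapAt (R := ℝ) (mem_of_mem_nhds ht) (dproj E F pr q v),
    ← t.symmₗ_linearMapAt (R := ℝ) (mem_of_mem_nhds ht) (dproj E F pr q w)]
  exact congrArg _ this

variable [FiniteDimensional ℝ E]

/-- The projection of the generator is `0` and its `σ`-component is `1`, both smooth. -/
lemma smoothVFieldAt_generator (hpr : IsPrincipalCircleBundle (E := E) (F := F) pr)
    (hσ : IsConnectionForm σ) (q : Q) : SmoothVFieldAt (generator F : VField F Q) q := by
  refine smoothVFieldAt_of_dproj hpr hσ ?_ ?_
  · have := (contMDiff_zeroSection (n := ∞) (IB := 𝓘(ℝ, E)) (F := E) ℝ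
      (TangentSpace 𝓘(ℝ, E) : P → Type _)).contMDiffAt.comp q (hpr.smooth_proj q)
    refine this.congr_of_eventuallyEq (Filter.Eventually.of_forall fun y => ?_)
    simp only [dproj_generator hpr hσ]
    rfl
  · simp only [hσ.apply_generator]
    exact contMDiffAt_const

lemma smoothVFieldAt_horizontalLift (hpr : IsPrincipalCircleBundle (E := E) (F := F) pr)
    (hσ : IsConnectionForm σ) {Z : VField E P} {q : Q} (hZ : SmoothVFieldAt Z (pr q)) :
    SmoothVFieldAt (fun y => horizontalLift pr σ y (Z (pr y))) q := by
  refine smoothVFieldAt_of_dproj hpr hσ ?_ ?_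
  · simp only [dproj_horizontalLift hpr hσ]
    exact ContMDiffAt.comp q hZ (hpr.smooth_proj q)
  · simp only [connection_horizontalLift]
    exact contMDiffAt_const

lemma smoothOneFormAt_pullback (hpr : IsPrincipalCircleBundle (E := E) (F := F) pr)
    {ξ : OneForm E P} {q : Q} (hξ : SmoothOneFormAt ξ (pr q)) :
    SmoothOneFormAt (fun y => (ξ (pr y)).comp (dproj E F pr y)) q := by
  refine smoothOneFormAt_of_apply fun X hX => ?_
  have h1 := hX.mfderiv (hpr.smooth_proj q)
  have h2 := ContMDiffAt.comp q hξ (hpr.smooth_proj q)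
  have h3 := ContMDiffAt.clm_bundle_apply (F₂ := ℝ) (E₂ := fun _ : P => ℝ) (b := pr) h2 h1
  exact (contMDiffAt_totalSpace.1 h3).2

end Connection

end CircleBundle

/-! ### Maximal isotropic subspaces are self-orthogonal -/

section LinearAlgebra

/-- A positive definite bilinear form on a finite-dimensional space. -/
lemma exists_posDef_dual (V : Type*) [NormedAddCommGroup V] [NormedSpace ℝ V]
    [FiniteDimensional ℝ V] : ∃ J : V →L[ℝ] (V →L[ℝ] ℝ), (∀ v w, J v w = J w v) ∧
      ∀ v, v ≠ 0 → 0 < J v v := by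
  let b := Module.finBasis ℝ V
  let c : Fin (Module.finrank ℝ V) → (V →L[ℝ] ℝ) := fun j => (b.coord j).toContinuousLinearMap
  refine ⟨∑ j, (c j).smulRight (c j), fun v w => ?_, fun v hv => ?_⟩
  · simp [mul_comm]
  · have h1 : (∑ j, (c j).smulRight (c j)) v v = ∑ j, c j v * c j v := by simp
    rw [h1]
    obtain ⟨j, hj⟩ : ∃ j, c j v ≠ 0 := by
      by_contra! h
      exact hv (b.ext_elem fun i => by simpa [c] using h i)
    exact Finset.sum_pos' (fun i _ => mul_self_nonneg _) ⟨j, Finset.mem_univ _, mul_self_pos.2 hj⟩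

variable {E : Type*} [NormedAddCommGroup E] [NormedSpace ℝ E]
  {M : Type*} [TopologicalSpace M] [ChartedSpace E M] {x : M}

lemma pairPlus_comm (u v : GenTangent E x) : pairPlus u v = pairPlus v u := by
  simp only [pairPlus]; ring

lemma pairPlus_add_left (u u' v : GenTangent E x) :
    pairPlus (u + u') v = pairPlus u v + pairPlus u' v := by
  simp [pairPlus]; ring

lemma pairPlus_smul_left (c : ℝ) (u v : GenTangent E x) :
    pairPlus (c • u) v = c * pairPlus u v := by
  simp [pairPlus]; ring

lemma pairPlus_add_right (u v v' : GenTangent E x) :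
    pairPlus u (v + v') = pairPlus u v + pairPlus u v' := by
  simp [pairPlus]; ring

lemma pairPlus_smul_right (c : ℝ) (u v : GenTangent E x) :
    pairPlus u (c • v) = c * pairPlus u v := by
  simp [pairPlus]; ring

/-- Adjoining such a vector keeps the subspace isotropic, so maximality absorbs it. -/
lemma mem_of_orthogonal_of_null {S : Submodule ℝ (GenTangent E x)} (hS : Maximal IsIsotropic S)
    {u : GenTangent E x} (hu : ∀ v ∈ S, pairPlus u v = 0) (huu : pairPlus u u = 0) : u ∈ S := by
  have hiso : IsIsotropic (S ⊔ Submodule.span ℝ {u}) := by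
    intro a ha b hb
    obtain ⟨s, hs, t, ht, rfl⟩ := Submodule.mem_sup.1 ha
    obtain ⟨s', hs', t', ht', rfl⟩ := Submodule.mem_sup.1 hb
    obtain ⟨c, rfl⟩ := Submodule.mem_span_singleton.1 ht
    obtain ⟨c', rfl⟩ := Submodule.mem_span_singleton.1 ht'
    rw [pairPlus_add_left, pairPlus_add_right, pairPlus_add_right, hS.prop s hs s' hs',
      pairPlus_smul_left, pairPlus_smul_left, pairPlus_smul_right, pairPlus_smul_right, huu,
      pairPlus_comm s u, hu s hs, hu s' hs']
    simp
  exact hS.le_of_ge hiso le_sup_left (Submodule.mem_sup_right (Submodule.mem_span_singleton_self u))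

/-- The symmetric pairing as a bilinear form. -/
def pairPlusForm (x : M) : GenTangent E x →ₗ[ℝ] GenTangent E x →ₗ[ℝ] ℝ :=
  LinearMap.mk₂ ℝ pairPlus pairPlus_add_left pairPlus_smul_left pairPlus_add_right
    pairPlus_smul_right

lemma finrank_genTangent [FiniteDimensional ℝ E] (x : M) :
    Module.finrank ℝ (GenTangent E x) = Module.finrank ℝ E + Module.finrank ℝ E := by
  have h1 : Module.finrank ℝ (E →L[ℝ] ℝ) = Module.finrank ℝ E := by
    rw [← (LinearMap.toContinuousLinearMap (𝕜 := ℝ) (E := E) (F' := ℝ)).finrank_eq]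
    exact Subspace.dual_finrank_eq
  exact (Module.finrank_prod (R := ℝ) (M := E) (M' := E →L[ℝ] ℝ)).trans (by rw [h1])

/-- A maximal isotropic subspace of `TM ⊕ T^*M` is its own orthogonal complement. -/
lemma mem_of_orthogonal [FiniteDimensional ℝ E] {S : Submodule ℝ (GenTangent E x)}
    (hS : Maximal IsIsotropic S) {u : GenTangent E x} (hu : ∀ v ∈ S, pairPlus u v = 0) : u ∈ S := by
  by_contra hnot
  have : FiniteDimensional ℝ (GenTangent E x) :=
    inferInstanceAs (FiniteDimensional ℝ (E × (E →L[ℝ] ℝ)))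
  have hq : pairPlus u u ≠ 0 := fun h => hnot (mem_of_orthogonal_of_null hS hu h)
  let W : Submodule ℝ (GenTangent E x) :=
    LinearMap.ker ((pairPlusForm x).compl₂ S.subtype)
  have hW : ∀ w, w ∈ W ↔ ∀ v ∈ S, pairPlus w v = 0 := by
    intro w
    refine ⟨fun h v hv => congrArg (fun φ => φ ⟨v, hv⟩) h, fun h => LinearMap.ext fun v => h v v.2⟩
  have hSW : S ≤ W := fun s hs => (hW s).2 fun v hv => hS.prop s hs v hv
  have hnull : ∀ w ∈ W, pairPlus w w = 0 → w ∈ S := fun w hw h =>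
    mem_of_orthogonal_of_null hS ((hW w).1 hw) h
  -- The form is semidefinite on `W`, the orthogonal complement of `S`, with the sign of `⟨u, u⟩`.
  -- Were some `⟨w, w⟩` of opposite sign, the quadratic `⟨u + t w, u + t w⟩` would have a real root.
  -- The null vector `u + t w` would lie in `S`, hence be orthogonal to `u` and `w`, giving `⟨u, u⟩
  -- = t² ⟨w, w⟩`.
  have hsign : ∀ w ∈ W, 0 ≤ pairPlus u u * pairPlus w w := by
    intro w hw
    by_contra! hneg
    have hw0 : pairPlus w w ≠ 0 := by rintro h; rw [h, mul_zero] at hneg; exact lt_irrefl _ hneg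
    have hdisc : 0 ≤ discrim (pairPlus w w) (2 * pairPlus u w) (pairPlus u u) := by
      rw [discrim]; nlinarith [sq_nonneg (pairPlus u w)]
    obtain ⟨t, ht⟩ := exists_quadratic_eq_zero hw0 ⟨_, (Real.mul_self_sqrt hdisc).symm⟩
    have hmem : u + t • w ∈ S := by
      refine hnull _ (W.add_mem ((hW u).2 hu) (W.smul_mem t hw)) ?_
      rw [pairPlus_add_left, pairPlus_add_right, pairPlus_add_right, pairPlus_smul_left,
        pairPlus_smul_left, pairPlus_smul_right, pairPlus_smul_right, pairPlus_comm w u]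
      linarith
    have h1 := hu _ hmem
    have h2 := (hW w).1 hw _ hmem
    rw [pairPlus_add_right, pairPlus_smul_right] at h1 h2
    rw [pairPlus_comm w u] at h2
    have : pairPlus u u = t ^ 2 * pairPlus w w := by
      linear_combination h1 - t * h2
    rw [this] at hneg
    nlinarith [sq_nonneg (t * pairPlus w w)]
  obtain ⟨J, -, hJpos⟩ := exists_posDef_dual E
  -- The graph of `-⟨u, u⟩ J` is a subspace of dimension `dim E` on which the form is definite of
  -- the sign opposite to `⟨u, u⟩`. It meets `W` trivially, so `dim W ≤ dim E`.
  let N : E →ₗ[ℝ] GenTangent E x :=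
    LinearMap.prod LinearMap.id ((-(pairPlus u u)) • J.toLinearMap)
  have hNinj : Function.Injective N := fun v w h => congrArg Prod.fst h
  have hdisj : Disjoint W (LinearMap.range N) := by
    rw [Submodule.disjoint_def]
    rintro _ hw ⟨v, rfl⟩
    by_contra hne
    have hv : v ≠ 0 := by rintro rfl; exact hne (map_zero N)
    have h1 := hsign _ hw
    have h2 : pairPlus (N v) (N v) = -(pairPlus u u) * J v v := by
      change (1 / 2 : ℝ) * ((-(pairPlus u u)) * J v v + (-(pairPlus u u)) * J v v) = _
      ring
    rw [h2] at h1
    nlinarith [mul_pos (hJpos v hv) (mul_self_pos.2 hq)]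
  have d1 : Module.finrank ℝ W + Module.finrank ℝ E ≤
      Module.finrank ℝ E + Module.finrank ℝ E := by
    rw [← finrank_genTangent (E := E) x, ← LinearMap.finrank_range_of_inj hNinj,
      ← Submodule.finrank_sup_add_finrank_inf_eq W (LinearMap.range N), hdisj.eq_bot, finrank_bot,
      add_zero]
    exact Submodule.finrank_le _
  -- `W` is cut out by `dim S` linear conditions. With the previous bound, `dim S ≥ dim E ≥ dim W`,
  -- so `S = W`, which contains `u`.
  have d2 : Module.finrank ℝ E + Module.finrank ℝ E ≤
      Module.finrank ℝ S + Module.finrank ℝ W := by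
    rw [← finrank_genTangent (E := E) x,
      ← LinearMap.finrank_range_add_finrank_ker ((pairPlusForm x).compl₂ S.subtype)]
    refine Nat.add_le_add_right ((Submodule.finrank_le _).trans ?_) _
    exact (Subspace.dual_finrank_eq (K := ℝ) (V := S)).le
  have : S = W := Submodule.eq_of_le_of_finrank_le hSW (by omega)
  exact hnot (this ▸ (hW u).2 hu)

end LinearAlgebra

/-! ### Pairings of brackets as cyclic sums -/

section Brackets

open Filter Topology

variable {E : Type*} [NormedAddCommGroup E] [NormedSpace ℝ E]
  {M : Type*} [TopologicalSpace M] [ChartedSpace E M]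

section Deriv

variable {X Y : VField E M} {f g : M → ℝ} {x : M}

lemma dirDeriv_add (hf : ContMDiffAt 𝓘(ℝ, E) 𝓘(ℝ, ℝ) ∞ f x)
    (hg : ContMDiffAt 𝓘(ℝ, E) 𝓘(ℝ, ℝ) ∞ g x) :
    dirDeriv X (fun y => f y + g y) x = dirDeriv X f x + dirDeriv X g x := by
  simp only [dirDeriv]
  rw [mvfderiv_fun_add (hf.mdifferentiableAt (by simp)) (hg.mdifferentiableAt (by simp))]
  rfl

lemma dirDeriv_sub (hf : ContMDiffAt 𝓘(ℝ, E) 𝓘(ℝ, ℝ) ∞ f x)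
    (hg : ContMDiffAt 𝓘(ℝ, E) 𝓘(ℝ, ℝ) ∞ g x) :
    dirDeriv X (fun y => f y - g y) x = dirDeriv X f x - dirDeriv X g x := by
  simp only [dirDeriv]
  rw [mvfderiv_fun_sub (hf.mdifferentiableAt (by simp)) (hg.mdifferentiableAt (by simp))]
  rfl

lemma dirDeriv_neg : dirDeriv X (fun y => - f y) x = - dirDeriv X f x := by
  simp only [dirDeriv]
  rw [mvfderiv_fun_neg]
  rfl

lemma dirDeriv_const (c : ℝ) : dirDeriv X (fun _ => c) x = 0 := by
  simp only [dirDeriv]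
  rw [mvfderiv_const]
  rfl

lemma dirDeriv_mul (hf : ContMDiffAt 𝓘(ℝ, E) 𝓘(ℝ, ℝ) ∞ f x)
    (hg : ContMDiffAt 𝓘(ℝ, E) 𝓘(ℝ, ℝ) ∞ g x) :
    dirDeriv X (fun y => f y * g y) x = f x * dirDeriv X g x + g x * dirDeriv X f x := by
  simp only [dirDeriv]
  rw [mvfderiv_fun_mul (hf.mdifferentiableAt (by simp)) (hg.mdifferentiableAt (by simp))]
  rfl

lemma dirDeriv_const_mul (c : ℝ) (hf : ContMDiffAt 𝓘(ℝ, E) 𝓘(ℝ, ℝ) ∞ f x) :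
    dirDeriv X (fun y => c * f y) x = c * dirDeriv X f x := by
  rw [dirDeriv_mul contMDiffAt_const hf, dirDeriv_const, mul_zero, add_zero]

lemma dirDeriv_add_mul {u : M → ℝ} (hu : ContMDiffAt 𝓘(ℝ, E) 𝓘(ℝ, ℝ) ∞ u x)
    (hf : ContMDiffAt 𝓘(ℝ, E) 𝓘(ℝ, ℝ) ∞ f x) (hg : ContMDiffAt 𝓘(ℝ, E) 𝓘(ℝ, ℝ) ∞ g x) :
    dirDeriv X (fun y => u y + f y * g y) x =
      dirDeriv X u x + (f x * dirDeriv X g x + g x * dirDeriv X f x) := by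
  have h : ContMDiffAt 𝓘(ℝ, E) 𝓘(ℝ, ℝ) ∞ (fun y => f y * g y) x := hf.mul hg
  rw [dirDeriv_add hu h, dirDeriv_mul hf hg]

end Deriv

variable [CompleteSpace E] [IsManifold 𝓘(ℝ, E) ∞ M]

lemma lieDerivOne_apply {X Y : VField E M} {ξ : OneForm E M} {x : M}
    (hX : SmoothVFieldAt X x) (hY : SmoothVFieldAt Y x) (hξ : SmoothOneFormAt ξ x) :
    lieDerivOne X ξ x (Y x) =
      dirDeriv X (fun y => ξ y (Y y)) x - ξ x (mlieBracket 𝓘(ℝ, E) X Y x) := by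
  change extDerivOne ξ x (X x) (Y x) + dirDeriv Y (fun y => ξ y (X y)) x = _
  rw [extDerivOne_apply hξ hX hY]
  ring

/-- The pairing of a Courant bracket with a section, in terms of the Lie bracket and directional
derivatives. -/
lemma courantBracket_snd_apply {e₁ e₂ : (x : M) → GenTangent E x} {Y : VField E M} {x : M}
    (h₁ : SmoothVFieldAt (fun y => (e₁ y).1) x) (h₁' : SmoothOneFormAt (fun y => (e₁ y).2) x)
    (h₂ : SmoothVFieldAt (fun y => (e₂ y).1) x) (h₂' : SmoothOneFormAt (fun y => (e₂ y).2) x)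
    (hY : SmoothVFieldAt Y x) :
    (courantBracket e₁ e₂ x).2 (Y x) =
      dirDeriv (fun y => (e₁ y).1) (fun y => (e₂ y).2 (Y y)) x
      - (e₂ x).2 (mlieBracket 𝓘(ℝ, E) (fun y => (e₁ y).1) Y x)
      - dirDeriv (fun y => (e₂ y).1) (fun y => (e₁ y).2 (Y y)) x
      + (e₁ x).2 (mlieBracket 𝓘(ℝ, E) (fun y => (e₂ y).1) Y x)
      + (1 / 2 : ℝ) * (dirDeriv Y (fun y => (e₁ y).2 (e₂ y).1) x
        - dirDeriv Y (fun y => (e₂ y).2 (e₁ y).1) x) := by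
  rw [← dirDeriv_sub (h₁'.apply h₂) (h₂'.apply h₁)]
  change lieDerivOne (fun y => (e₁ y).1) (fun y => (e₂ y).2) x (Y x)
    - lieDerivOne (fun y => (e₂ y).1) (fun y => (e₁ y).2) x (Y x) + (1 / 2 : ℝ) *
      dirDeriv Y (fun y => (e₁ y).2 (e₂ y).1 - (e₂ y).2 (e₁ y).1) x = _
  rw [lieDerivOne_apply h₁ hY h₂', lieDerivOne_apply h₂ hY h₁']
  ring

/-- The non-symmetric half of the symmetric pairing on `ℰ¹(M)`. -/
def extHalfPair {x : M} (u v : ExtTangent E x) : ℝ := u.2.1 v.1.1 + u.2.2 * v.1.2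

lemma extPairPlus_eq {x : M} (u v : ExtTangent E x) :
    extPairPlus u v = (1 / 2 : ℝ) * (extHalfPair u v + extHalfPair v u) := by
  simp only [extPairPlus, extHalfPair]; ring

/-- The summand whose cyclic sum is the pairing of an extended Courant bracket of isotropic sections
with a third section. -/
def jacobiTerm (e₁ e₂ e₃ : (x : M) → ExtTangent E x) (x : M) : ℝ :=
  (e₃ x).2.1 (mlieBracket 𝓘(ℝ, E) (fun y => (e₁ y).1.1) (fun y => (e₂ y).1.1) x)
    + dirDeriv (fun y => (e₁ y).1.1) (fun y => extHalfPair (e₂ y) (e₃ y)) x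
    + (e₁ x).1.2 * extHalfPair (e₂ x) (e₃ x)
    + (e₃ x).2.2 * (dirDeriv (fun y => (e₁ y).1.1) (fun y => (e₂ y).1.2) x
      - dirDeriv (fun y => (e₂ y).1.1) (fun y => (e₁ y).1.2) x)

/-- A section of `ℰ¹(M)` is smooth at a point. -/
structure SmoothExtAt (e : (x : M) → ExtTangent E x) (x : M) : Prop where
  field : SmoothVFieldAt (fun y => (e y).1.1) x
  fn : ContMDiffAt 𝓘(ℝ, E) 𝓘(ℝ, ℝ) ∞ (fun y => (e y).1.2) x
  form : SmoothOneFormAt (fun y => (e y).2.1) x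
  fn' : ContMDiffAt 𝓘(ℝ, E) 𝓘(ℝ, ℝ) ∞ (fun y => (e y).2.2) x

lemma SmoothExtOn.smoothAt {e : (x : M) → ExtTangent E x} {U : Set M} (h : SmoothExtOn e U) {x : M}
    (hx : U ∈ 𝓝 x) : SmoothExtAt e x :=
  ⟨h.1.smoothAt hx, h.2.1.contMDiffAt hx, h.2.2.1.smoothAt hx, h.2.2.2.contMDiffAt hx⟩

/-- For isotropic sections, the pairing of an extended Courant bracket with a third section is a
cyclic sum. -/
lemma two_mul_extPairPlus_bracket {e₁ e₂ e₃ : (x : M) → ExtTangent E x} {x : M}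
    (h₁ : SmoothExtAt e₁ x) (h₂ : SmoothExtAt e₂ x) (h₃ : SmoothExtAt e₃ x)
    (h₁₂ : ∀ y, extPairPlus (e₁ y) (e₂ y) = 0) (h₁₃ : ∀ y, extPairPlus (e₁ y) (e₃ y) = 0) :
    2 * extPairPlus (extCourantBracket e₁ e₂ x) (e₃ x) =
      jacobiTerm e₁ e₂ e₃ x + jacobiTerm e₂ e₃ e₁ x + jacobiTerm e₃ e₁ e₂ x := by
  set X₁ : VField E M := fun x => (e₁ x).1.1 with hX₁
  set X₂ : VField E M := fun x => (e₂ x).1.1 with hX₂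
  set X₃ : VField E M := fun x => (e₃ x).1.1 with hX₃
  set f₁ : M → ℝ := fun x => (e₁ x).1.2 with hf₁
  set f₂ : M → ℝ := fun x => (e₂ x).1.2 with hf₂
  set f₃ : M → ℝ := fun x => (e₃ x).1.2 with hf₃
  set ξ₁ : OneForm E M := fun x => (e₁ x).2.1 with hξ₁
  set ξ₂ : OneForm E M := fun x => (e₂ x).2.1 with hξ₂
  set ξ₃ : OneForm E M := fun x => (e₃ x).2.1 with hξ₃
  set g₁ : M → ℝ := fun x => (e₁ x).2.2 with hg₁
  set g₂ : M → ℝ := fun x => (e₂ x).2.2 with hg₂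
  set g₃ : M → ℝ := fun x => (e₃ x).2.2 with hg₃
  have hb : 2 * extPairPlus (extCourantBracket e₁ e₂ x) (e₃ x) =
      lieDerivOne X₁ ξ₂ x (X₃ x) - lieDerivOne X₂ ξ₁ x (X₃ x)
        + (1 / 2 : ℝ) * dirDeriv X₃ (fun y => ξ₁ y (X₂ y) - ξ₂ y (X₁ y)) x
        + f₁ x * ξ₂ x (X₃ x) - f₂ x * ξ₁ x (X₃ x)
        + (1 / 2 : ℝ) * (g₂ x * dirDeriv X₃ f₁ x - g₁ x * dirDeriv X₃ f₂ x
          - f₁ x * dirDeriv X₃ g₂ x + f₂ x * dirDeriv X₃ g₁ x)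
      + ξ₃ x (mlieBracket 𝓘(ℝ, E) X₁ X₂ x)
      + (dirDeriv X₁ g₂ x - dirDeriv X₂ g₁ x
          + (1 / 2 : ℝ) * (ξ₁ x (X₂ x) - ξ₂ x (X₁ x) - f₂ x * g₁ x + f₁ x * g₂ x)) * f₃ x
      + g₃ x * (dirDeriv X₁ f₂ x - dirDeriv X₂ f₁ x) := by
    simp only [extPairPlus]
    rw [← mul_assoc]
    norm_num
    rfl
  have i₁₂ : ∀ y, ξ₁ y (X₂ y) + ξ₂ y (X₁ y) + g₁ y * f₂ y + g₂ y * f₁ y = 0 := fun y => by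
    have := h₁₂ y
    simp only [extPairPlus] at this
    linarith
  have i₁₃ : ∀ y, ξ₁ y (X₃ y) + ξ₃ y (X₁ y) + g₁ y * f₃ y + g₃ y * f₁ y = 0 := fun y => by
    have := h₁₃ y
    simp only [extPairPlus] at this
    linarith
  have s₁₂ : ContMDiffAt 𝓘(ℝ, E) 𝓘(ℝ, ℝ) ∞ (fun y => ξ₁ y (X₂ y)) x := h₁.form.apply h₂.field
  have s₂₁ : ContMDiffAt 𝓘(ℝ, E) 𝓘(ℝ, ℝ) ∞ (fun y => ξ₂ y (X₁ y)) x := h₂.form.apply h₁.field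
  have s₃₁ : ContMDiffAt 𝓘(ℝ, E) 𝓘(ℝ, ℝ) ∞ (fun y => ξ₃ y (X₁ y)) x := h₃.form.apply h₁.field
  have s₂₃ : ContMDiffAt 𝓘(ℝ, E) 𝓘(ℝ, ℝ) ∞ (fun y => ξ₂ y (X₃ y)) x := h₂.form.apply h₃.field
  have F₁ : ContMDiffAt 𝓘(ℝ, E) 𝓘(ℝ, ℝ) ∞ f₁ x := h₁.fn
  have F₂ : ContMDiffAt 𝓘(ℝ, E) 𝓘(ℝ, ℝ) ∞ f₂ x := h₂.fn
  have F₃ : ContMDiffAt 𝓘(ℝ, E) 𝓘(ℝ, ℝ) ∞ f₃ x := h₃.fn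
  have G₁ : ContMDiffAt 𝓘(ℝ, E) 𝓘(ℝ, ℝ) ∞ g₁ x := h₁.fn'
  have G₂ : ContMDiffAt 𝓘(ℝ, E) 𝓘(ℝ, ℝ) ∞ g₂ x := h₂.fn'
  have G₃ : ContMDiffAt 𝓘(ℝ, E) 𝓘(ℝ, ℝ) ∞ g₃ x := h₃.fn'
  -- Differentiating an isotropy relation expresses the derivative of one mixed pairing through the
  -- others. This turns the antisymmetrized terms of the bracket into cyclic ones.
  have swap (X : VField E M) {u v f g f' g' : M → ℝ}
      (hu : ContMDiffAt 𝓘(ℝ, E) 𝓘(ℝ, ℝ) ∞ u x)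
      (hf : ContMDiffAt 𝓘(ℝ, E) 𝓘(ℝ, ℝ) ∞ f x) (hg : ContMDiffAt 𝓘(ℝ, E) 𝓘(ℝ, ℝ) ∞ g x)
      (hf' : ContMDiffAt 𝓘(ℝ, E) 𝓘(ℝ, ℝ) ∞ f' x) (hg' : ContMDiffAt 𝓘(ℝ, E) 𝓘(ℝ, ℝ) ∞ g' x)
      (h : ∀ y, u y + v y + g y * f' y + g' y * f y = 0) :
      dirDeriv X v x = -(dirDeriv X u x + (g x * dirDeriv X f' x + f' x * dirDeriv X g x)
        + (g' x * dirDeriv X f x + f x * dirDeriv X g' x)) := by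
    have e : v = fun y => -((u y + g y * f' y) + g' y * f y) := by
      funext y; linarith [h y]
    have h1 : ContMDiffAt 𝓘(ℝ, E) 𝓘(ℝ, ℝ) ∞ (fun y => u y + g y * f' y) x := hu.add (hg.mul hf')
    rw [e, dirDeriv_neg, dirDeriv_add_mul h1 hg' hf, dirDeriv_add_mul hu hg hf']
  have e1 := swap X₃ s₁₂ F₁ G₁ F₂ G₂ i₁₂
  have e2 := swap X₂ s₃₁ F₃ G₃ F₁ G₁ (v := fun y => ξ₁ y (X₃ y)) fun y => by linarith [i₁₃ y]
  have t₁ : jacobiTerm e₁ e₂ e₃ x = ξ₃ x (mlieBracket 𝓘(ℝ, E) X₁ X₂ x)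
      + dirDeriv X₁ (fun y => ξ₂ y (X₃ y) + g₂ y * f₃ y) x
      + f₁ x * (ξ₂ x (X₃ x) + g₂ x * f₃ x)
      + g₃ x * (dirDeriv X₁ f₂ x - dirDeriv X₂ f₁ x) := rfl
  have t₂ : jacobiTerm e₂ e₃ e₁ x = ξ₁ x (mlieBracket 𝓘(ℝ, E) X₂ X₃ x)
      + dirDeriv X₂ (fun y => ξ₃ y (X₁ y) + g₃ y * f₁ y) x
      + f₂ x * (ξ₃ x (X₁ x) + g₃ x * f₁ x)
      + g₁ x * (dirDeriv X₂ f₃ x - dirDeriv X₃ f₂ x) := rfl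
  have t₃ : jacobiTerm e₃ e₁ e₂ x = ξ₂ x (mlieBracket 𝓘(ℝ, E) X₃ X₁ x)
      + dirDeriv X₃ (fun y => ξ₁ y (X₂ y) + g₁ y * f₂ y) x
      + f₃ x * (ξ₁ x (X₂ x) + g₁ x * f₂ x)
      + g₂ x * (dirDeriv X₃ f₁ x - dirDeriv X₁ f₃ x) := rfl
  have b₁ : lieDerivOne X₁ ξ₂ x (X₃ x) = _ := lieDerivOne_apply h₁.field h₃.field h₂.form
  have b₂ : lieDerivOne X₂ ξ₁ x (X₃ x) = _ := lieDerivOne_apply h₂.field h₃.field h₁.form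
  rw [hb, dirDeriv_sub s₁₂ s₂₁, b₁, b₂, t₁, t₂, t₃, dirDeriv_add_mul s₂₃ G₂ F₃,
    dirDeriv_add_mul s₃₁ G₃ F₁, dirDeriv_add_mul s₁₂ G₁ F₂,
    mlieBracket_swap_apply (V := X₃) (W := X₁), map_neg]
  linear_combination (-1/2 : ℝ) * e1 - e2 - (1/2 : ℝ) * f₃ x * i₁₂ x - f₂ x * i₁₃ x

end Brackets

/-! ### The integrability identity on the base -/

section Base

open Filter Topology

variable {E : Type*} [NormedAddCommGroup E] [NormedSpace ℝ E] [FiniteDimensional ℝ E]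
  {P : Type*} [TopologicalSpace P] [ChartedSpace E P] [IsManifold 𝓘(ℝ, E) ∞ P]
  {L : (x : P) → Submodule ℝ (GenTangent E x)}

/-- Every element of a smooth subbundle extends to a global smooth section. -/
lemma exists_isSectionOf [T2Space P] (hL : IsSmoothSubbundle SmoothGenOn L) {p : P}
    {u : GenTangent E p} (hu : u ∈ L p) : ∃ e, IsSectionOf L e ∧ e p = u := by
  obtain ⟨U, hU, hpU, k, e, he, hspan⟩ := hL p
  rw [← (hspan p hpU).2, Submodule.mem_span_range_iff_exists_fun] at hu
  obtain ⟨c, hc⟩ := hu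
  obtain ⟨φ, hφ⟩ : ∃ φ : SmoothBumpFunction 𝓘(ℝ, E) p, tsupport φ ⊆ U := by
    have := (SmoothBumpFunction.nhds_basis_tsupport (I := 𝓘(ℝ, E)) p).mem_iff.1 (hU.mem_nhds hpU)
    obtain ⟨φ, -, h⟩ := this
    exact ⟨φ, h⟩
  have hφs : ContMDiffOn 𝓘(ℝ, E) 𝓘(ℝ, ℝ) ∞ φ U := φ.contMDiff.contMDiffOn
  refine ⟨fun y => φ y • ∑ i, c i • e i y, ⟨⟨?_, ?_⟩, fun y => ?_⟩, ?_⟩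
  · have h1 := ContMDiffOn.smul_section_of_tsupport hφs hU hφ
      (ContMDiffOn.sum_section (s := Finset.univ) (t := fun i y => c i • (e i y).1)
        fun i _ => ContMDiffOn.const_smul_section (a := c i) (he i).1)
    refine h1.contMDiffOn.congr fun y _ => ?_
    simp [Prod.fst_sum]
  · have h1 := ContMDiffOn.smul_section_of_tsupport hφs hU hφ
      (ContMDiffOn.sum_section (s := Finset.univ) (t := fun i y => c i • (e i y).2)
        fun i _ => ContMDiffOn.const_smul_section (a := c i) (he i).2)
    refine h1.contMDiffOn.congr fun y _ => ?_
    simp [Prod.snd_sum]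
  · by_cases hy : y ∈ U
    · rw [← (hspan y hy).2]
      exact Submodule.smul_mem _ _ (Submodule.sum_mem _ fun i _ =>
        Submodule.smul_mem _ _ (Submodule.subset_span ⟨i, rfl⟩))
    · change φ y • _ ∈ L y
      rw [image_eq_zero_of_notMem_tsupport (fun h => hy (hφ h)), zero_smul]
      exact Submodule.zero_mem _
  · simp only [φ.eq_one, one_smul]
    exact hc

/-- The data of a section of `ℰ¹(Q)` induced from the base: a vector field, a 1-form, a function and
two constants. -/
structure BasicDatum (E : Type*) [NormedAddCommGroup E] [NormedSpace ℝ E]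
    (P : Type*) [TopologicalSpace P] [ChartedSpace E P] where
  /-- the vector field -/
  field : VField E P
  /-- the 1-form -/
  form : OneForm E P
  /-- the vertical component -/
  vert : P → ℝ
  /-- the function component -/
  f : ℝ
  /-- the dual function component -/
  g : ℝ

/-- The expression on the base of `jacobiTerm` for sections induced from the base. -/
def baseTerm (Ω : BilinField E P) (d₁ d₂ d₃ : BasicDatum E P) (p : P) : ℝ :=
  d₃.form p (mlieBracket 𝓘(ℝ, E) d₁.field d₂.field p)
    + d₃.f * (dirDeriv d₁.field d₂.vert p - dirDeriv d₂.field d₁.vert p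
      - Ω p (d₁.field p) (d₂.field p))
    + dirDeriv d₁.field (fun y => d₂.form y (d₃.field y) + d₂.f * d₃.vert y + d₂.g * d₃.f) p
    + d₁.f * (d₂.form p (d₃.field p) + d₂.f * d₃.vert p + d₂.g * d₃.f)

/-- The datum of the section `lift(l) + g ((-E, 0) ⊕ (0, 1)) + f ((-A^H, 1) ⊕ (σ - pr^*α, 0))`. -/
def prequantDatum (β : (x : P) → (L x →ₗ[ℝ] ℝ)) (a : (x : P) → GenTangent E x)
    (l : (x : P) → L x) (f g : ℝ) : BasicDatum E P where
  field x := (l x).1.1 - f • (a x).1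
  form x := (l x).1.2 - f • (a x).2
  vert x := β x (l x) - g
  f := f
  g := g

lemma dirDeriv_field_sub_smul (X A : VField E P) (f : ℝ) (h : P → ℝ) (p : P) :
    dirDeriv (fun x => X x - f • A x) h p = dirDeriv X h p - f * dirDeriv A h p := by
  simp only [dirDeriv, map_sub, map_smul, smul_eq_mul]

lemma mlieBracket_sub_smul {X Y A : VField E P} {p : P} (hX : SmoothVFieldAt X p)
    (hY : SmoothVFieldAt Y p) (hA : SmoothVFieldAt A p) (f g : ℝ) :
    mlieBracket 𝓘(ℝ, E) (fun x => X x - f • A x) (fun x => Y x - g • A x) p =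
      mlieBracket 𝓘(ℝ, E) X Y p - g • mlieBracket 𝓘(ℝ, E) X A p
        + f • mlieBracket 𝓘(ℝ, E) Y A p := by
  have e (X : VField E P) (f : ℝ) : (fun x => X x - f • A x) = X + (-f) • A := by
    funext x; simp [sub_eq_add_neg]
  have hc (c : ℝ) : MDifferentiableAt 𝓘(ℝ, E) (𝓘(ℝ, E).prod 𝓘(ℝ, E))
      (fun x => TotalSpace.mk' E (E := fun x : P => TangentSpace 𝓘(ℝ, E) x) x ((c • A) x)) p :=
    (ContMDiffAt.const_smul_section (a := c) hA).mdifferentiableAt (by simp)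
  have hYA (c : ℝ) : MDifferentiableAt 𝓘(ℝ, E) (𝓘(ℝ, E).prod 𝓘(ℝ, E))
      (fun x => TotalSpace.mk' E (E := fun x : P => TangentSpace 𝓘(ℝ, E) x) x
        ((Y + c • A) x)) p :=
    (ContMDiffAt.add_section hY (ContMDiffAt.const_smul_section (a := c) hA)).mdifferentiableAt
      (by simp)
  rw [e, e, mlieBracket_add_left hX.mdifferentiableAt (hc _),
    mlieBracket_add_right hY.mdifferentiableAt (hc _),
    mlieBracket_const_smul_left hA.mdifferentiableAt,
    mlieBracket_add_right hY.mdifferentiableAt (hc _),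
    mlieBracket_const_smul_right hA.mdifferentiableAt,
    mlieBracket_const_smul_right hA.mdifferentiableAt,
    mlieBracket_swap_apply (V := A) (W := Y), mlieBracket_self]
  simp
  abel

variable {l : (x : P) → GenTangent E x}

lemma IsSectionOf.field (hl : IsSectionOf L l) (p : P) : SmoothVFieldAt (fun x => (l x).1) p :=
  hl.1.1.smoothAt Filter.univ_mem

lemma IsSectionOf.form (hl : IsSectionOf L l) (p : P) : SmoothOneFormAt (fun x => (l x).2) p :=
  hl.1.2.smoothAt Filter.univ_mem

lemma IsSectionOf.pairing (hL : IsDirac L) {l₁ l₂ : (x : P) → GenTangent E x}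
    (h₁ : IsSectionOf L l₁) (h₂ : IsSectionOf L l₂) (x : P) :
    (l₁ x).2 (l₂ x).1 = - (l₂ x).2 (l₁ x).1 := by
  have := (hL.maximal_isotropic x).1 _ (h₁.2 x) _ (h₂.2 x)
  simp only [pairPlus] at this
  linarith

/-- Integrability of a Dirac structure, in terms of the Lie bracket and directional derivatives. -/
lemma dirac_cyclic_sum (hL : IsDirac L) {l₁ l₂ l₃ : (x : P) → GenTangent E x}
    (h₁ : IsSectionOf L l₁) (h₂ : IsSectionOf L l₂) (h₃ : IsSectionOf L l₃) (p : P) :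
    (l₃ p).2 (mlieBracket 𝓘(ℝ, E) (fun x => (l₁ x).1) (fun x => (l₂ x).1) p)
      + (l₁ p).2 (mlieBracket 𝓘(ℝ, E) (fun x => (l₂ x).1) (fun x => (l₃ x).1) p)
      - (l₂ p).2 (mlieBracket 𝓘(ℝ, E) (fun x => (l₁ x).1) (fun x => (l₃ x).1) p)
      + dirDeriv (fun x => (l₁ x).1) (fun y => (l₂ y).2 (l₃ y).1) p
      + dirDeriv (fun x => (l₂ x).1) (fun y => (l₃ y).2 (l₁ y).1) p
      + dirDeriv (fun x => (l₃ x).1) (fun y => (l₁ y).2 (l₂ y).1) p = 0 := by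
  have h := (hL.maximal_isotropic p).1 _ (hL.integrable l₁ l₂ h₁ h₂ p) _ (h₃.2 p)
  simp only [pairPlus] at h
  rw [courantBracket_snd_apply (h₁.field p) (h₁.form p) (h₂.field p) (h₂.form p) (h₃.field p)] at h
  have e1 : (fun y => (l₁ y).2 (l₃ y).1) = fun y => - (l₃ y).2 (l₁ y).1 :=
    funext fun y => h₁.pairing hL h₃ y
  have e2 : (fun y => (l₂ y).2 (l₁ y).1) = fun y => - (l₁ y).2 (l₂ y).1 :=
    funext fun y => h₂.pairing hL h₁ y
  rw [e1, e2, dirDeriv_neg, dirDeriv_neg] at h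
  change (1 / 2 : ℝ) * (_ + (l₃ p).2 (mlieBracket 𝓘(ℝ, E) (fun x => (l₁ x).1)
    (fun x => (l₂ x).1) p)) = 0 at h
  linear_combination 2 * h

/-- The prequantization condition in terms of an isotropic extension of the 1-cochain. -/
lemma prequant_apply {hL : IsDirac L} {Ω : BilinField E P} {β : (x : P) → (L x →ₗ[ℝ] ℝ)}
    (hpreq : PrequantCondition hL Ω β) {a : (x : P) → GenTangent E x}
    (ha : IsIsotropicExtension L β a) {l₁ l₂ : (x : P) → GenTangent E x}
    (h₁ : IsSectionOf L l₁) (h₂ : IsSectionOf L l₂) (p : P) :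
    Ω p (l₁ p).1 (l₂ p).1 = (l₁ p).2 (l₂ p).1
      + dirDeriv (fun x => (l₁ x).1) (fun y => (a y).2 (l₂ y).1) p
      - dirDeriv (fun x => (l₂ x).1) (fun y => (a y).2 (l₁ y).1) p
      - (a p).2 (mlieBracket 𝓘(ℝ, E) (fun x => (l₁ x).1) (fun x => (l₂ x).1) p)
      + (l₂ p).2 (mlieBracket 𝓘(ℝ, E) (fun x => (l₁ x).1) (fun x => (a x).1) p)
      - (l₁ p).2 (mlieBracket 𝓘(ℝ, E) (fun x => (l₂ x).1) (fun x => (a x).1) p)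
      - dirDeriv (fun x => (a x).1) (fun y => (l₁ y).2 (l₂ y).1) p := by
  have hA : SmoothVFieldAt (fun x => (a x).1) p := ha.smooth.1.smoothAt Filter.univ_mem
  have hα : SmoothOneFormAt (fun x => (a x).2) p := ha.smooth.2.smoothAt Filter.univ_mem
  have h := hpreq l₁ l₂ h₁ h₂ p
  have b {l : (x : P) → GenTangent E x} (hl : IsSectionOf L l) :
      (fun y => β y ⟨l y, hl.2 y⟩) = fun y => (a y).2 (l y).1 + (l y).2 (a y).1 := by
    funext y
    rw [ha.represents]
    simp only [pairPlus]
    ring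
  simp only [algebroidDiff] at h
  -- The term `β([l₁, l₂])` becomes `α([X₁, X₂])` plus the form component of the Courant bracket
  -- evaluated on `A`; the latter is then expanded.
  rw [b h₁, b h₂, ha.represents, dirDeriv_add (hα.apply (h₁.field p)) ((h₁.form p).apply hA),
    dirDeriv_add (hα.apply (h₂.field p)) ((h₂.form p).apply hA)] at h
  simp only [pairPlus, pairMinus] at h
  rw [courantBracket_snd_apply (h₁.field p) (h₁.form p) (h₂.field p) (h₂.form p) hA] at h
  change _ = _ + (_ - _ - 2 * ((1 / 2 : ℝ) * ((a p).2 (mlieBracket 𝓘(ℝ, E) (fun x => (l₁ x).1)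
    (fun x => (l₂ x).1) p) + _))) at h
  have e2 : (fun y => (l₂ y).2 (l₁ y).1) = fun y => - (l₁ y).2 (l₂ y).1 :=
    funext fun y => h₂.pairing hL h₁ y
  rw [e2, dirDeriv_neg] at h
  rw [h]
  linear_combination (-1/2 : ℝ) * h₂.pairing hL h₁ p

/-- The cyclic sum of `baseTerm` vanishes on data coming from a prequantized Dirac structure. -/
lemma baseTerm_cyclic_sum {hL : IsDirac L} {Ω : BilinField E P} (hΩ : ∀ x v, Ω x v v = 0)
    {β : (x : P) → (L x →ₗ[ℝ] ℝ)}
    (hpreq : PrequantCondition hL Ω β) {a : (x : P) → GenTangent E x}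
    (ha : IsIsotropicExtension L β a) {l₁ l₂ l₃ : (x : P) → GenTangent E x}
    (h₁ : IsSectionOf L l₁) (h₂ : IsSectionOf L l₂) (h₃ : IsSectionOf L l₃)
    (f₁ g₁ f₂ g₂ f₃ g₃ : ℝ) (p : P) :
    let d₁ := prequantDatum β a (fun x => ⟨l₁ x, h₁.2 x⟩) f₁ g₁
    let d₂ := prequantDatum β a (fun x => ⟨l₂ x, h₂.2 x⟩) f₂ g₂
    let d₃ := prequantDatum β a (fun x => ⟨l₃ x, h₃.2 x⟩) f₃ g₃
    baseTerm Ω d₁ d₂ d₃ p + baseTerm Ω d₂ d₃ d₁ p + baseTerm Ω d₃ d₁ d₂ p = 0 := by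
  intro d₁ d₂ d₃
  have hA : SmoothVFieldAt (fun x => (a x).1) p := ha.smooth.1.smoothAt Filter.univ_mem
  have hα : SmoothOneFormAt (fun x => (a x).2) p := ha.smooth.2.smoothAt Filter.univ_mem
  have hαA (x : P) : (a x).2 (a x).1 = 0 := by
    have := ha.isotropic x
    simp only [pairPlus] at this
    linarith
  have hskew (v w : TangentSpace 𝓘(ℝ, E) p) : Ω p v w = - Ω p w v := by
    have := hΩ p (v + w)
    simp only [map_add, add_apply, hΩ] at this
    linarith
  have b {l : (x : P) → GenTangent E x} (hl : IsSectionOf L l) (y : P) :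
      β y ⟨l y, hl.2 y⟩ = (a y).2 (l y).1 + (l y).2 (a y).1 := by
    rw [ha.represents]
    simp only [pairPlus]
    ring
  -- Expansion of one summand as a polynomial in the constants `f` and `g`, so that the cyclic sum
  -- can be compared coefficient by coefficient.
  have term {l₁ l₂ l₃ : (x : P) → GenTangent E x}
      (h₁ : IsSectionOf L l₁) (h₂ : IsSectionOf L l₂) (h₃ : IsSectionOf L l₃)
      (f₁ g₁ f₂ g₂ f₃ g₃ : ℝ) :
      baseTerm Ω (prequantDatum β a (fun x => ⟨l₁ x, h₁.2 x⟩) f₁ g₁)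
        (prequantDatum β a (fun x => ⟨l₂ x, h₂.2 x⟩) f₂ g₂)
        (prequantDatum β a (fun x => ⟨l₃ x, h₃.2 x⟩) f₃ g₃) p =
      (l₃ p).2 (mlieBracket 𝓘(ℝ, E) (fun x => (l₁ x).1) (fun x => (l₂ x).1) p)
      - f₂ * (l₃ p).2 (mlieBracket 𝓘(ℝ, E) (fun x => (l₁ x).1) (fun x => (a x).1) p)
      + f₁ * (l₃ p).2 (mlieBracket 𝓘(ℝ, E) (fun x => (l₂ x).1) (fun x => (a x).1) p)
      - f₃ * ((a p).2 (mlieBracket 𝓘(ℝ, E) (fun x => (l₁ x).1) (fun x => (l₂ x).1) p)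
      - f₂ * (a p).2 (mlieBracket 𝓘(ℝ, E) (fun x => (l₁ x).1) (fun x => (a x).1) p)
      + f₁ * (a p).2 (mlieBracket 𝓘(ℝ, E) (fun x => (l₂ x).1) (fun x => (a x).1) p))
      + f₃ * ((dirDeriv (fun x => (l₁ x).1) (fun y => (a y).2 (l₂ y).1) p
            + dirDeriv (fun x => (l₁ x).1) (fun y => (l₂ y).2 (a y).1) p)
          - f₁ * (dirDeriv (fun x => (a x).1) (fun y => (a y).2 (l₂ y).1) p
            + dirDeriv (fun x => (a x).1) (fun y => (l₂ y).2 (a y).1) p)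
          - ((dirDeriv (fun x => (l₂ x).1) (fun y => (a y).2 (l₁ y).1) p
            + dirDeriv (fun x => (l₂ x).1) (fun y => (l₁ y).2 (a y).1) p)
          - f₂ * (dirDeriv (fun x => (a x).1) (fun y => (a y).2 (l₁ y).1) p
            + dirDeriv (fun x => (a x).1) (fun y => (l₁ y).2 (a y).1) p))
          - (Ω p (l₁ p).1 (l₂ p).1 - f₂ * Ω p (l₁ p).1 (a p).1 - f₁ * Ω p (a p).1 (l₂ p).1))
      + (dirDeriv (fun x => (l₁ x).1) (fun y => (l₂ y).2 (l₃ y).1) p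
          - f₃ * dirDeriv (fun x => (l₁ x).1) (fun y => (l₂ y).2 (a y).1) p
          + f₂ * dirDeriv (fun x => (l₁ x).1) (fun y => (l₃ y).2 (a y).1) p)
      - f₁ * (dirDeriv (fun x => (a x).1) (fun y => (l₂ y).2 (l₃ y).1) p
          - f₃ * dirDeriv (fun x => (a x).1) (fun y => (l₂ y).2 (a y).1) p
          + f₂ * dirDeriv (fun x => (a x).1) (fun y => (l₃ y).2 (a y).1) p)
      + f₁ * ((l₂ p).2 (l₃ p).1 - f₃ * (l₂ p).2 (a p).1 + f₂ * (l₃ p).2 (a p).1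
          + (g₂ * f₃ - f₂ * g₃)) := by
    -- Since `β(l₃) = α(X₃) + ξ₃(A)`, the vertical component cancels `-f₂ α(X₃)`. The term `f₂ f₃
    -- α(A)` is zero by isotropy.
    have e : (fun y => ((l₂ y).2 - f₂ • (a y).2) ((l₃ y).1 - f₃ • (a y).1)
        + f₂ * (β y ⟨l₃ y, h₃.2 y⟩ - g₃) + g₂ * f₃) =
        fun y => (l₂ y).2 (l₃ y).1 - f₃ * (l₂ y).2 (a y).1 + f₂ * (l₃ y).2 (a y).1
          + (g₂ * f₃ - f₂ * g₃) := by
      funext y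
      rw [b h₃]
      simp only [map_sub, map_smul, sub_apply, smul_apply,
        smul_eq_mul, hαA]
      ring
    have s₂₃ := (h₂.form p).apply (h₃.field p)
    have s₂ := (h₂.form p).apply hA
    have s₃ := (h₃.form p).apply hA
    have D (X : VField E P) : dirDeriv X (fun y => (l₂ y).2 (l₃ y).1 - f₃ * (l₂ y).2 (a y).1
        + f₂ * (l₃ y).2 (a y).1 + (g₂ * f₃ - f₂ * g₃)) p =
        dirDeriv X (fun y => (l₂ y).2 (l₃ y).1) p - f₃ * dirDeriv X (fun y => (l₂ y).2 (a y).1) p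
          + f₂ * dirDeriv X (fun y => (l₃ y).2 (a y).1) p := by
      have c₂ : ContMDiffAt 𝓘(ℝ, E) 𝓘(ℝ, ℝ) ∞ (fun y => f₃ * (l₂ y).2 (a y).1) p :=
        contMDiffAt_const.mul s₂
      have c₃ : ContMDiffAt 𝓘(ℝ, E) 𝓘(ℝ, ℝ) ∞ (fun y => f₂ * (l₃ y).2 (a y).1) p :=
        contMDiffAt_const.mul s₃
      have c₄ : ContMDiffAt 𝓘(ℝ, E) 𝓘(ℝ, ℝ) ∞
          (fun y => (l₂ y).2 (l₃ y).1 - f₃ * (l₂ y).2 (a y).1) p := s₂₃.sub c₂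
      have c₅ : ContMDiffAt 𝓘(ℝ, E) 𝓘(ℝ, ℝ) ∞
          (fun y => (l₂ y).2 (l₃ y).1 - f₃ * (l₂ y).2 (a y).1 + f₂ * (l₃ y).2 (a y).1) p :=
        c₄.add c₃
      rw [dirDeriv_add c₅ contMDiffAt_const, dirDeriv_add c₄ c₃,
        dirDeriv_sub s₂₃ c₂, dirDeriv_const_mul _ s₂, dirDeriv_const_mul _ s₃, dirDeriv_const,
        add_zero]
    have V (X : VField E P) {l : (x : P) → GenTangent E x} (hl : IsSectionOf L l) (g : ℝ) :
        dirDeriv X (fun y => β y ⟨l y, hl.2 y⟩ - g) p =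
          dirDeriv X (fun y => (a y).2 (l y).1) p + dirDeriv X (fun y => (l y).2 (a y).1) p := by
      simp only [b hl]
      have c₁ := hα.apply (hl.field p)
      have c₂ := (hl.form p).apply hA
      have c₃ : ContMDiffAt 𝓘(ℝ, E) 𝓘(ℝ, ℝ) ∞
          (fun y => (a y).2 (l y).1 + (l y).2 (a y).1) p := c₁.add c₂
      rw [dirDeriv_sub c₃ contMDiffAt_const, dirDeriv_add c₁ c₂, dirDeriv_const, sub_zero]
    have hp := congrFun e p
    simp only [baseTerm, prequantDatum]
    rw [e, hp, mlieBracket_sub_smul (h₁.field p) (h₂.field p) hA, dirDeriv_field_sub_smul,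
      dirDeriv_field_sub_smul, dirDeriv_field_sub_smul, V _ h₁, V _ h₂, V _ h₁, V _ h₂, D, D]
    simp only [map_sub, map_add, map_smul, sub_apply,
      smul_apply, smul_eq_mul, hΩ]
    ring
  have O₁₂ := prequant_apply hpreq ha h₁ h₂ p
  have O₂₃ := prequant_apply hpreq ha h₂ h₃ p
  have O₃₁ := prequant_apply hpreq ha h₃ h₁ p
  have H := dirac_cyclic_sum hL h₁ h₂ h₃ p
  have sw : mlieBracket 𝓘(ℝ, E) (fun x => (l₃ x).1) (fun x => (l₁ x).1) p =
    - mlieBracket 𝓘(ℝ, E) (fun x => (l₁ x).1) (fun x => (l₃ x).1) p := mlieBracket_swap_apply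
  simp only [d₁, d₂, d₃]
  -- The prequantization identity for each pair removes the terms linear in an `f`. Skewness of `Ω`
  -- pairs off its mixed terms with `A`, leaving the identity for `L` alone.
  rw [term h₁ h₂ h₃, term h₂ h₃ h₁, term h₃ h₁ h₂, O₁₂, O₂₃, O₃₁, sw,
    hskew (a p).1 (l₁ p).1, hskew (a p).1 (l₂ p).1, hskew (a p).1 (l₃ p).1]
  simp only [map_neg]
  linear_combination H

end Base

/-! ### Sections of `ℰ¹(Q)` induced from the base -/

section Lift

open Filter Topology

variable {E : Type*} [NormedAddCommGroup E] [NormedSpace ℝ E]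
  {P : Type*} [TopologicalSpace P] [ChartedSpace E P]
  {F : Type*} [NormedAddCommGroup F] [NormedSpace ℝ F]
  {Q : Type*} [TopologicalSpace Q] [ChartedSpace F Q] [MulAction Circle Q]
  {pr : Q → P} {σ : OneForm F Q}

lemma dirDeriv_comp {X : VField F Q} {h : P → ℝ} {q : Q}
    (hpr : MDifferentiableAt 𝓘(ℝ, F) 𝓘(ℝ, E) pr q)
    (hh : MDifferentiableAt 𝓘(ℝ, E) 𝓘(ℝ, ℝ) h (pr q)) :
    dirDeriv X (fun y => h (pr y)) q = mvfderiv 𝓘(ℝ, E) h (pr q) (dproj E F pr q (X q)) :=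
  mfderiv_comp_apply q hh hpr (X q)

/-- The element `(Z^H + c E, f) ⊕ (pr^*ζ + f σ, g)` of `ℰ¹(Q)`. -/
def extLift (pr : Q → P) (σ : OneForm F Q) (q : Q) (Z : TangentSpace 𝓘(ℝ, E) (pr q))
    (ζ : TangentSpace 𝓘(ℝ, E) (pr q) →L[ℝ] ℝ) (c f g : ℝ) : ExtTangent F q :=
  ((horizontalLift pr σ q Z + c • generator F q, f), (ζ.comp (dproj E F pr q) + f • σ q, g))

/-- The section of `ℰ¹(Q)` induced by data on the base. -/
def BasicDatum.lift (pr : Q → P) (σ : OneForm F Q) (d : BasicDatum E P) (q : Q) : ExtTangent F q :=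
  extLift pr σ q (d.field (pr q)) (d.form (pr q)) (d.vert (pr q)) d.f d.g

variable [IsManifold 𝓘(ℝ, E) ∞ P] [IsManifold 𝓘(ℝ, F) ∞ Q] [FiniteDimensional ℝ F]
  [FiniteDimensional ℝ E]

lemma extHalfPair_extLift (hpr : IsPrincipalCircleBundle (E := E) (F := F) pr)
    (hσ : IsConnectionForm σ) {q : Q} (Z Z' : TangentSpace 𝓘(ℝ, E) (pr q))
    (ζ ζ' : TangentSpace 𝓘(ℝ, E) (pr q) →L[ℝ] ℝ) (c c' f f' g g' : ℝ) :
    extHalfPair (extLift pr σ q Z ζ c f g) (extLift pr σ q Z' ζ' c' f' g') =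
      ζ Z' + f * c' + g * f' := by
  change ζ (dproj E F pr q (horizontalLift pr σ q Z' + c' • generator F q))
    + f * σ q (horizontalLift pr σ q Z' + c' • generator F q) + g * f' = _
  rw [map_add (dproj E F pr q), map_smul (dproj E F pr q), dproj_horizontalLift hpr hσ,
    dproj_generator hpr hσ, map_add (σ q), map_smul (σ q), connection_horizontalLift,
    hσ.apply_generator, smul_zero, add_zero, zero_add, smul_eq_mul, mul_one]

/-- Data on the base is smooth at a point. -/
structure BasicDatum.SmoothAt (d : BasicDatum E P) (p : P) : Prop where
  field : SmoothVFieldAt d.field p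
  form : SmoothOneFormAt d.form p
  vert : ContMDiffAt 𝓘(ℝ, E) 𝓘(ℝ, ℝ) ∞ d.vert p

lemma BasicDatum.SmoothAt.lift (hpr : IsPrincipalCircleBundle (E := E) (F := F) pr)
    (hσ : IsConnectionForm σ) {d : BasicDatum E P} {q : Q} (hd : d.SmoothAt (pr q)) :
    SmoothExtAt (d.lift pr σ) q where
  field := by
    have h1 : ContMDiffAt 𝓘(ℝ, F) 𝓘(ℝ, ℝ) ∞ (fun y => d.vert (pr y)) q :=
      ContMDiffAt.comp q hd.vert (hpr.smooth_proj q)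
    exact ContMDiffAt.add_section (smoothVFieldAt_horizontalLift hpr hσ hd.field)
      (ContMDiffAt.smul_section h1 (smoothVFieldAt_generator hpr hσ q))
  fn := contMDiffAt_const
  form := ContMDiffAt.add_section (smoothOneFormAt_pullback hpr hd.form)
      (ContMDiffAt.const_smul_section (a := d.f) (hσ.smooth.smoothAt Filter.univ_mem))
  fn' := contMDiffAt_const

lemma dproj_lift_field (hpr : IsPrincipalCircleBundle (E := E) (F := F) pr)
    (hσ : IsConnectionForm σ) (d : BasicDatum E P) (q : Q) :
    dproj E F pr q (d.lift pr σ q).1.1 = d.field (pr q) := by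
  change dproj E F pr q (horizontalLift pr σ q _ + _ • generator F q) = _
  rw [map_add, map_smul, dproj_horizontalLift hpr hσ, dproj_generator hpr hσ, smul_zero, add_zero]

lemma connection_lift_field (hσ : IsConnectionForm σ) (d : BasicDatum E P) (q : Q) :
    σ q (d.lift pr σ q).1.1 = d.vert (pr q) := by
  change σ q (horizontalLift pr σ q _ + _ • generator F q) = _
  rw [map_add, map_smul, connection_horizontalLift, hσ.apply_generator, zero_add, smul_eq_mul,
    mul_one]

/-- The lifted fields are `pr`-related to the base fields, so their bracket projects to the bracket
on `P`. Its vertical part comes from Cartan's formula for `dσ = pr^*Ω`: `σ([Y₁, Y₂]) = X₁·c₂ - X₂·c₁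
- Ω(X₁, X₂)`, where `cᵢ = σ(Yᵢ)`. -/
lemma jacobiTerm_lift (hpr : IsPrincipalCircleBundle (E := E) (F := F) pr)
    (hσ : IsConnectionForm σ) {Ω : BilinField E P} (hcurv : IsCurvature pr σ Ω)
    {d₁ d₂ d₃ : BasicDatum E P} {q : Q} (h₁ : d₁.SmoothAt (pr q)) (h₂ : d₂.SmoothAt (pr q))
    (h₃ : d₃.SmoothAt (pr q)) :
    jacobiTerm (d₁.lift pr σ) (d₂.lift pr σ) (d₃.lift pr σ) q = baseTerm Ω d₁ d₂ d₃ (pr q) := by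
  have s₁ := (h₁.lift hpr hσ).field
  have s₂ := (h₂.lift hpr hσ).field
  have chain (d : BasicDatum E P) {h : P → ℝ} (hh : ContMDiffAt 𝓘(ℝ, E) 𝓘(ℝ, ℝ) ∞ h (pr q)) :
      dirDeriv (fun y => (d.lift pr σ y).1.1) (fun y => h (pr y)) q =
        dirDeriv d.field h (pr q) := by
    rw [dirDeriv_comp (hpr.smooth_proj.mdifferentiable (by simp) q)
      (hh.mdifferentiableAt (by simp)), dproj_lift_field hpr hσ]
    rfl
  have hbr := mfderiv_mlieBracket_of_related s₁ s₂ h₁.field h₂.field (hpr.smooth_proj q)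
    (Eventually.of_forall fun y => dproj_lift_field hpr hσ d₁ y)
    (Eventually.of_forall fun y => dproj_lift_field hpr hσ d₂ y)
  have hσb := extDerivOne_apply (hσ.smooth.smoothAt (x := q) Filter.univ_mem) s₁ s₂
  rw [hcurv] at hσb
  simp only [connection_lift_field hσ, dproj_lift_field hpr hσ] at hσb
  rw [chain d₁ h₂.vert, chain d₂ h₁.vert] at hσb
  have hpair : (fun y => extHalfPair (d₂.lift pr σ y) (d₃.lift pr σ y)) =
      fun y => (fun p => d₂.form p (d₃.field p) + d₂.f * d₃.vert p + d₂.g * d₃.f) (pr y) :=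
    funext fun y => extHalfPair_extLift hpr hσ _ _ _ _ _ _ _ _ _ _
  have hsm : ContMDiffAt 𝓘(ℝ, E) 𝓘(ℝ, ℝ) ∞
      (fun p => d₂.form p (d₃.field p) + d₂.f * d₃.vert p + d₂.g * d₃.f) (pr q) := by
    have e1 := h₂.form.apply h₃.field
    have e2 : ContMDiffAt 𝓘(ℝ, E) 𝓘(ℝ, ℝ) ∞ (fun p => d₂.f * d₃.vert p) (pr q) :=
      contMDiffAt_const.mul h₃.vert
    exact (e1.add e2).add contMDiffAt_const
  simp only [jacobiTerm]
  rw [hpair, chain d₁ hsm]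
  have hq := congrFun hpair q
  simp only at hq
  rw [hq]
  have c (d d' : BasicDatum E P) :
    dirDeriv (fun y => (d.lift pr σ y).1.1) (fun y => (d'.lift pr σ y).1.2) q = 0 :=
    dirDeriv_const _
  rw [c, c]
  change d₃.form (pr q) (dproj E F pr q (mlieBracket 𝓘(ℝ, F) _ _ q))
    + d₃.f * σ q (mlieBracket 𝓘(ℝ, F) _ _ q) + _ + d₁.f * _ + _ = _
  rw [dproj, hbr]
  simp only [baseTerm]
  linear_combination d₃.f * hσb

end Lift

/-! ### Fibrewise linear algebra of the prequantization subbundle -/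

section Quant

open Filter Topology

set_option synthInstance.maxHeartbeats 200000

variable {E : Type*} [NormedAddCommGroup E] [NormedSpace ℝ E]
  {P : Type*} [TopologicalSpace P] [ChartedSpace E P]
  {F : Type*} [NormedAddCommGroup F] [NormedSpace ℝ F]
  {Q : Type*} [TopologicalSpace Q] [ChartedSpace F Q] [MulAction Circle Q]
  {pr : Q → P} {σ : OneForm F Q} {L : (x : P) → Submodule ℝ (GenTangent E x)}
  {β : (x : P) → (L x →ₗ[ℝ] ℝ)} {a : (x : P) → GenTangent E x}

/-- The map `(l, f, g) ↦ lift(l) + f ((-A^H, 1) ⊕ (σ - pr^*α, 0)) + g ((-E, 0) ⊕ (0, 1))`. -/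
def quantMap (pr : Q → P) (σ : OneForm F Q) (β : (x : P) → (L x →ₗ[ℝ] ℝ))
    (a : (x : P) → GenTangent E x) (q : Q) : (L (pr q) × ℝ × ℝ) →ₗ[ℝ] ExtTangent F q where
  toFun x := extLift pr σ q (x.1.1.1 - x.2.1 • (a (pr q)).1) (x.1.1.2 - x.2.1 • (a (pr q)).2)
    (β (pr q) x.1 - x.2.2) x.2.1 x.2.2
  map_add' x y := by
    refine Prod.ext (Prod.ext ?_ rfl) (Prod.ext ?_ rfl)
    · simp only [extLift, Prod.fst_add, Prod.snd_add, Submodule.coe_add, map_add, map_sub, map_smul,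
        add_smul, sub_smul]
      abel
    · ext v
      simp [extLift]
      ring
  map_smul' c x := by
    refine Prod.ext (Prod.ext ?_ rfl) (Prod.ext ?_ rfl)
    · simp only [extLift, Prod.smul_fst, Prod.smul_snd, Submodule.coe_smul, map_sub, map_smul,
        smul_add, smul_sub, sub_smul, smul_eq_mul, mul_smul, RingHom.id_apply]
    · ext v
      simp [extLift]
      ring

lemma quantMap_apply (q : Q) (l : L (pr q)) (f g : ℝ) :
    quantMap pr σ β a q (l, f, g) = extLift pr σ q (l.1.1 - f • (a (pr q)).1)
      (l.1.2 - f • (a (pr q)).2) (β (pr q) l - g) f g := rfl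

lemma quantMap_inl (q : Q) (l : L (pr q)) :
    quantMap pr σ β a q (l, 0, 0) = (((horizontalLift pr σ q l.1.1 + β (pr q) l • generator F q, 0),
      (l.1.2.comp (dproj E F pr q), 0)) : ExtTangent F q) := by
  rw [quantMap_apply]
  simp [extLift]

lemma quantMap_reeb (q : Q) :
    quantMap pr σ β a q (0, 0, 1) = (((-generator F q, 0), (0, 1)) : ExtTangent F q) := by
  rw [quantMap_apply]
  simp [extLift]

lemma quantMap_conn (q : Q) :
    quantMap pr σ β a q (0, 1, 0) = (((-horizontalLift pr σ q (a (pr q)).1, 1),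
      (σ q - (a (pr q)).2.comp (dproj E F pr q), 0)) : ExtTangent F q) := by
  rw [quantMap_apply]
  simp [extLift]
  ext v
  simp
  ring

/-- The generating set is already the range of a linear map, so taking its span adds nothing. -/
lemma liftPart_eq (q : Q) : liftPart pr σ L β q =
    LinearMap.range ((quantMap pr σ β a q).comp (LinearMap.inl ℝ (L (pr q)) (ℝ × ℝ))) := by
  rw [← Submodule.span_eq (LinearMap.range _)]
  simp only [liftPart, ← quantMap_inl (a := a)]
  rfl

/-- The three factors of `L × ℝ × ℝ` map onto the three pieces, so statements about the bundle can
be checked on the parameters `(l, f, g)`. -/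
lemma range_quantMap (q : Q) :
    LinearMap.range (quantMap pr σ β a q) = prequantSubbundle pr σ L β a q := by
  rw [prequantSubbundle, liftPart_eq (a := a), reebLine, connLine, ← quantMap_reeb (β := β) (a := a),
    ← quantMap_conn (β := β)]
  apply le_antisymm
  · rintro _ ⟨⟨l, f, g⟩, rfl⟩
    have : ((l, f, g) : L (pr q) × ℝ × ℝ) = (l, 0, 0) + g • (0, 0, 1) + f • (0, 1, 0) := by simp
    rw [this, map_add, map_add, map_smul, map_smul]
    exact Submodule.add_mem_sup (Submodule.add_mem_sup ⟨l, rfl⟩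
      (Submodule.smul_mem _ _ (Submodule.mem_span_singleton_self _)))
      (Submodule.smul_mem _ _ (Submodule.mem_span_singleton_self _))
  · refine sup_le (sup_le ?_ ?_) ?_
    · rintro _ ⟨l, rfl⟩
      exact ⟨_, rfl⟩
    · rw [Submodule.span_singleton_le_iff_mem]
      exact ⟨_, rfl⟩
    · rw [Submodule.span_singleton_le_iff_mem]
      exact ⟨_, rfl⟩

variable [IsManifold 𝓘(ℝ, E) ∞ P] [IsManifold 𝓘(ℝ, F) ∞ Q] [FiniteDimensional ℝ F]
  [FiniteDimensional ℝ E]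

/-- The scalars `f` and `g` are components of the image. Once they agree, the projection recovers
`X`, and surjectivity of `dpr` recovers `ξ` from its pullback. -/
lemma quantMap_injective (hpr : IsPrincipalCircleBundle (E := E) (F := F) pr)
    (hσ : IsConnectionForm σ) (q : Q) : Function.Injective (quantMap pr σ β a q) := by
  rintro ⟨l, f, g⟩ ⟨l', f', g'⟩ h
  obtain rfl : f = f' := congrArg (fun u : ExtTangent F q => u.1.2) h
  obtain rfl : g = g' := congrArg (fun u : ExtTangent F q => u.2.2) h
  rw [quantMap_apply, quantMap_apply] at h
  have h1 := congrArg (fun u : ExtTangent F q => dproj E F pr q u.1.1) h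
  have h2 := congrArg (fun u : ExtTangent F q => u.2.1) h
  simp only [extLift, map_add, map_smul, dproj_horizontalLift hpr hσ, dproj_generator hpr hσ,
    smul_zero, add_zero, sub_left_inj, add_left_inj] at h1 h2
  have hl : l = l' := by
    refine Subtype.ext (Prod.ext h1 ?_)
    ext Z
    obtain ⟨v, rfl⟩ := dproj_surjective hpr q Z
    have := congrArg (fun ξ : TangentSpace 𝓘(ℝ, F) q →L[ℝ] ℝ => ξ v) h2
    simpa using this
  rw [hl]

lemma two_mul_extPairPlus_extLift (hpr : IsPrincipalCircleBundle (E := E) (F := F) pr)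
    (hσ : IsConnectionForm σ) {q : Q} (Z Z' : TangentSpace 𝓘(ℝ, E) (pr q))
    (ζ ζ' : TangentSpace 𝓘(ℝ, E) (pr q) →L[ℝ] ℝ) (c c' f f' g g' : ℝ) :
    2 * extPairPlus (extLift pr σ q Z ζ c f g) (extLift pr σ q Z' ζ' c' f' g') =
      ζ Z' + ζ' Z + f * c' + f' * c + g * f' + g' * f := by
  rw [extPairPlus_eq, extHalfPair_extLift hpr hσ, extHalfPair_extLift hpr hσ]
  ring

lemma IsIsotropicExtension.apply (ha : IsIsotropicExtension L β a) (p : P) (l : L p) :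
    β p l = (a p).2 l.1.1 + l.1.2 (a p).1 := by
  rw [ha.represents]
  simp only [pairPlus]
  ring

lemma IsIsotropicExtension.apply_self (ha : IsIsotropicExtension L β a) (p : P) :
    (a p).2 (a p).1 = 0 := by
  have := ha.isotropic p
  simp only [pairPlus] at this
  linarith

/-- The vertical coefficient `β(l)` cancels the cross terms of `A ⊕ α` with `L`, and `-g` cancels
the product of the two scalar components. What remains is the pairing on `L` and a multiple of
`α(A)`. -/
lemma prequantSubbundle_isotropic (hpr : IsPrincipalCircleBundle (E := E) (F := F) pr)
    (hσ : IsConnectionForm σ) (hL : ∀ x, IsIsotropic (L x)) (ha : IsIsotropicExtension L β a)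
    (q : Q) : IsExtIsotropic (prequantSubbundle pr σ L β a q) := by
  rw [← range_quantMap]
  rintro _ ⟨⟨l, f, g⟩, rfl⟩ _ ⟨⟨l', f', g'⟩, rfl⟩
  have h := two_mul_extPairPlus_extLift hpr hσ (l.1.1 - f • (a (pr q)).1)
    (l'.1.1 - f' • (a (pr q)).1) (l.1.2 - f • (a (pr q)).2) (l'.1.2 - f' • (a (pr q)).2)
    (β (pr q) l - g) (β (pr q) l' - g') f f' g g'
  have hl := hL _ _ l.2 _ l'.2
  have hA := ha.apply_self (pr q)
  simp only [pairPlus] at hl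
  simp only [ha.apply, map_sub, map_smul, sub_apply, smul_apply, smul_eq_mul] at h
  rw [quantMap_apply, quantMap_apply, ha.apply, ha.apply]
  linear_combination (1 / 2 : ℝ) * h + hl + f * f' * hA

/-- The condition on `u` is orthogonality to the Reeb generator `(-E, 0) ⊕ (0, 1)`: the value of the
form component on `E` must be the coefficient `f` of `σ`. -/
lemma eq_extLift (hpr : IsPrincipalCircleBundle (E := E) (F := F) pr)
    (hσ : IsConnectionForm σ) {q : Q} (u : ExtTangent F q) (hu : u.2.1 (generator F q) = u.1.2) :
    u = extLift pr σ q (dproj E F pr q u.1.1) (u.2.1.comp (horizontalLift pr σ q)) (σ q u.1.1)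
      u.1.2 u.2.2 := by
  refine Prod.ext (Prod.ext (horizontal_decomposition hpr hσ q _) rfl) (Prod.ext ?_ rfl)
  ext v
  have := congrArg u.2.1 (horizontal_decomposition hpr hσ q v)
  rw [map_add, map_smul, hu, smul_eq_mul] at this
  rw [this, mul_comm]
  rfl

/-- Orthogonality to the Reeb line puts `u` in the form `extLift Z ζ c f g`. Orthogonality to the
lift of `L` says that `(Z, ζ) + f (A ⊕ α)` is orthogonal to `L`, hence lies in `L`. Orthogonality to
the connection line fixes `c = ζ(A) + α(Z) - g`, the value required by `quantMap`. -/
lemma mem_prequantSubbundle_of_orthogonal (hpr : IsPrincipalCircleBundle (E := E) (F := F) pr)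
    (hσ : IsConnectionForm σ) (hL : ∀ x, Maximal IsIsotropic (L x))
    (ha : IsIsotropicExtension L β a) {q : Q} {u : ExtTangent F q}
    (hu : ∀ v ∈ prequantSubbundle pr σ L β a q, extPairPlus u v = 0) :
    u ∈ prequantSubbundle pr σ L β a q := by
  rw [← range_quantMap] at hu ⊢
  have hR := hu _ ⟨(0, 0, 1), rfl⟩
  rw [quantMap_reeb] at hR
  simp only [extPairPlus, map_neg, zero_apply, mul_zero, one_mul] at hR
  have hA := ha.apply_self (pr q)
  obtain ⟨Z, ζ, c, f, g, rfl⟩ : ∃ Z ζ c f g, u = extLift pr σ q Z ζ c f g :=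
    ⟨_, _, _, _, _, eq_extLift hpr hσ u (by linarith)⟩
  have key (l : L (pr q)) (f' g' : ℝ) := two_mul_extPairPlus_extLift hpr hσ Z
    (l.1.1 - f' • (a (pr q)).1) ζ (l.1.2 - f' • (a (pr q)).2) c (β (pr q) l - g') f f' g g'
  have hl : ((Z, ζ) + f • a (pr q) : GenTangent E (pr q)) ∈ L (pr q) := by
    refine mem_of_orthogonal (hL _) fun v hv => ?_
    have h := key ⟨v, hv⟩ 0 0
    rw [← quantMap_apply, hu _ ⟨_, rfl⟩, ha.apply] at h
    simp only [zero_smul, sub_zero, mul_zero, zero_mul, add_zero] at h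
    simp only [pairPlus, Prod.fst_add, Prod.snd_add, Prod.smul_fst, Prod.smul_snd, map_add,
      map_smul, add_apply, smul_apply, smul_eq_mul]
    linear_combination (-1 / 2 : ℝ) * h
  have hc := key 0 1 0
  rw [← quantMap_apply, hu _ ⟨_, rfl⟩] at hc
  simp only [map_sub, map_smul, sub_apply, smul_apply, smul_eq_mul, map_zero, Submodule.coe_zero,
    Prod.fst_zero, Prod.snd_zero, zero_apply] at hc
  refine ⟨(⟨_, hl⟩, f, g), ?_⟩
  rw [quantMap_apply, ha.apply]
  simp only [Prod.fst_add, Prod.snd_add, Prod.smul_fst, Prod.smul_snd, map_add,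
      map_smul, add_apply, smul_apply, smul_eq_mul, add_sub_cancel_right, hA]
  congr 1
  linear_combination hc

lemma prequantSubbundle_maximal (hpr : IsPrincipalCircleBundle (E := E) (F := F) pr)
    (hσ : IsConnectionForm σ) (hL : ∀ x, Maximal IsIsotropic (L x))
    (ha : IsIsotropicExtension L β a) (q : Q) :
    Maximal IsExtIsotropic (prequantSubbundle pr σ L β a q) :=
  ⟨prequantSubbundle_isotropic hpr hσ (fun x => (hL x).1) ha q, fun _ hT hle u hu =>
    mem_prequantSubbundle_of_orthogonal hpr hσ hL ha fun v hv => hT u hu v (hle hv)⟩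

/-- Both extensions restrict to `β`, so `a' - a` is orthogonal to `L` and lies in it. Nullity of
`a`, `a'` and `a' - a` gives `⟨a, a'⟩₊ = 0`, hence `β(a' - a) = 0`. Replacing `l` by `l + f (a' -
a)` then passes from one parametrization to the other. -/
lemma prequantSubbundle_le (hL : ∀ x, Maximal IsIsotropic (L x)) {a' : (x : P) → GenTangent E x}
    (ha : IsIsotropicExtension L β a) (ha' : IsIsotropicExtension L β a') (q : Q) :
    prequantSubbundle pr σ L β a q ≤ prequantSubbundle pr σ L β a' q := by
  set p := pr q with hp
  have hd : a' p - a p ∈ L p := by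
    refine mem_of_orthogonal (hL p) fun v hv => ?_
    have h := (ha'.apply p ⟨v, hv⟩).symm.trans (ha.apply p ⟨v, hv⟩)
    simp only [pairPlus, Prod.fst_sub, Prod.snd_sub, sub_apply, map_sub]
    linear_combination (1 / 2 : ℝ) * h
  have hβ : β p ⟨_, hd⟩ = 0 := by
    have h := (hL p).1 _ hd _ hd
    have h1 := ha.apply_self p
    have h2 := ha'.apply_self p
    rw [ha.apply]
    simp only [pairPlus, Prod.fst_sub, Prod.snd_sub, sub_apply, map_sub] at h ⊢
    linear_combination -h - h1 + h2
  rw [← range_quantMap, ← range_quantMap]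
  rintro _ ⟨⟨l, f, g⟩, rfl⟩
  refine ⟨(l + f • ⟨_, hd⟩, f, g), ?_⟩
  rw [quantMap_apply, quantMap_apply, map_add, map_smul, hβ]
  simp only [Submodule.coe_add, Submodule.coe_smul, Prod.fst_add, Prod.snd_add, Prod.smul_fst,
    Prod.smul_snd, Prod.fst_sub, Prod.snd_sub, smul_zero, add_zero, smul_sub]
  congr 1 <;> abel

end Quant

/-! ### Directness, smooth frames and integrability -/

section Jacobi

open Filter Topology

set_option synthInstance.maxHeartbeats 200000

lemma linearIndependent_and_span_of_injective {ι V W : Type*} [AddCommMonoid V] [Module ℝ V]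
    [AddCommMonoid W] [Module ℝ W] {T : V →ₗ[ℝ] W} (hT : Function.Injective T)
    (b : Module.Basis ι ℝ V) :
    LinearIndependent ℝ (fun i => T (b i)) ∧
      Submodule.span ℝ (Set.range fun i => T (b i)) = LinearMap.range T := by
  refine ⟨b.linearIndependent.map_injOn T hT.injOn, ?_⟩
  rw [LinearMap.range_eq_map, ← b.span_eq, Submodule.map_span, ← Set.range_comp]
  rfl

variable {E : Type*} [NormedAddCommGroup E] [NormedSpace ℝ E]
  {P : Type*} [TopologicalSpace P] [ChartedSpace E P]
  {F : Type*} [NormedAddCommGroup F] [NormedSpace ℝ F]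
  {Q : Type*} [TopologicalSpace Q] [ChartedSpace F Q] [MulAction Circle Q]
  {pr : Q → P} {σ : OneForm F Q} {L : (x : P) → Submodule ℝ (GenTangent E x)}
  {β : (x : P) → (L x →ₗ[ℝ] ℝ)} {a : (x : P) → GenTangent E x}
  [IsManifold 𝓘(ℝ, E) ∞ P] [IsManifold 𝓘(ℝ, F) ∞ Q] [FiniteDimensional ℝ F]
  [FiniteDimensional ℝ E]

/-- The pieces are images under an injective map of the coordinate summands of `L × ℝ × ℝ`, which
are visibly independent. -/
lemma iSupIndep_parts (hpr : IsPrincipalCircleBundle (E := E) (F := F) pr)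
    (hσ : IsConnectionForm σ) (q : Q) :
    iSupIndep ![liftPart pr σ L β q, reebLine q, connLine pr σ a q] := by
  have hinj := quantMap_injective (β := β) (a := a) hpr hσ q
  have h1 : liftPart pr σ L β q = ((⊤ : Submodule ℝ (L (pr q))).prod ⊥).map
      (quantMap pr σ β a q) := by
    rw [liftPart_eq (a := a)]
    ext u
    constructor
    · rintro ⟨l, rfl⟩
      exact ⟨(l, 0, 0), by simp, rfl⟩
    · rintro ⟨⟨l, f⟩, ⟨-, hf⟩, rfl⟩
      have : f = 0 := hf
      exact ⟨l, by rw [this]; rfl⟩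
  have h2 : reebLine q = (Submodule.span ℝ {((0, 0, 1) : L (pr q) × ℝ × ℝ)}).map
      (quantMap pr σ β a q) := by
    rw [Submodule.map_span, Set.image_singleton, quantMap_reeb, reebLine]
  have h3 : connLine pr σ a q = (Submodule.span ℝ {((0, 1, 0) : L (pr q) × ℝ × ℝ)}).map
      (quantMap pr σ β a q) := by
    rw [Submodule.map_span, Set.image_singleton, quantMap_conn, connLine]
  rw [iSupIndep_fin_three]
  change Disjoint (liftPart pr σ L β q) (reebLine q ⊔ connLine pr σ a q) ∧
    Disjoint (reebLine q) (connLine pr σ a q ⊔ liftPart pr σ L β q) ∧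
    Disjoint (connLine pr σ a q) (liftPart pr σ L β q ⊔ reebLine q)
  rw [h1, h2, h3, ← Submodule.map_sup, ← Submodule.map_sup, ← Submodule.map_sup]
  have hd {A B : Submodule ℝ (L (pr q) × ℝ × ℝ)} (h : Disjoint A B) :
      Disjoint (A.map (quantMap pr σ β a q)) (B.map (quantMap pr σ β a q)) :=
    Submodule.disjoint_map hinj h
  refine ⟨hd ?_, hd ?_, hd ?_⟩ <;> rw [Submodule.disjoint_def]
  · rintro ⟨l, f⟩ ⟨-, hf⟩ h
    have hf : f = 0 := hf
    obtain ⟨_, hy, _, hz, h⟩ := Submodule.mem_sup.1 h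
    obtain ⟨r, rfl⟩ := Submodule.mem_span_singleton.1 hy
    obtain ⟨s, rfl⟩ := Submodule.mem_span_singleton.1 hz
    have hl : l = 0 := by
      have := congrArg Prod.fst h
      simpa using this.symm
    rw [hl, hf]
    rfl
  · rintro _ hx h
    obtain ⟨r, rfl⟩ := Submodule.mem_span_singleton.1 hx
    obtain ⟨_, hy, ⟨l, f⟩, ⟨-, hf⟩, h⟩ := Submodule.mem_sup.1 h
    have hf : f = 0 := hf
    subst hf
    obtain ⟨s, rfl⟩ := Submodule.mem_span_singleton.1 hy
    have : r = 0 := by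
      have := congrArg (fun u : L (pr q) × ℝ × ℝ => u.2.2) h
      simpa using this.symm
    rw [this, zero_smul]
  · rintro _ hx h
    obtain ⟨r, rfl⟩ := Submodule.mem_span_singleton.1 hx
    obtain ⟨⟨l, f⟩, ⟨-, hf⟩, _, hy, h⟩ := Submodule.mem_sup.1 h
    have hf : f = 0 := hf
    subst hf
    obtain ⟨s, rfl⟩ := Submodule.mem_span_singleton.1 hy
    have : r = 0 := by
      have := congrArg (fun u : L (pr q) × ℝ × ℝ => u.2.1) h
      simpa using this.symm
    rw [this, zero_smul]

lemma SmoothExtOn.of_smoothAt {e : (x : Q) → ExtTangent F x} {U : Set Q}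
    (h : ∀ x ∈ U, SmoothExtAt e x) : SmoothExtOn e U :=
  ⟨fun x hx => (h x hx).field.contMDiffWithinAt, fun x hx => (h x hx).fn.contMDiffWithinAt,
    fun x hx => (h x hx).form.contMDiffWithinAt, fun x hx => (h x hx).fn'.contMDiffWithinAt⟩

lemma prequantSubbundle_isSmoothSubbundle (hpr : IsPrincipalCircleBundle (E := E) (F := F) pr)
    (hσ : IsConnectionForm σ) (hL : IsSmoothSubbundle SmoothGenOn L)
    (ha : IsIsotropicExtension L β a) :
    IsSmoothSubbundle SmoothExtOn (prequantSubbundle pr σ L β a) := by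
  intro q₀
  obtain ⟨U, hU, hqU, k, e, he, hspan⟩ := hL (pr q₀)
  have hA (p : P) : SmoothVFieldAt (fun x => (a x).1) p := ha.smooth.1.smoothAt Filter.univ_mem
  have hα (p : P) : SmoothOneFormAt (fun x => (a x).2) p := ha.smooth.2.smoothAt Filter.univ_mem
  -- A frame of `L` over `U` together with the connection and Reeb generators, in this order.
  -- Writing `β(eᵢ)` through `A ⊕ α` makes the vertical components visibly smooth.
  let d : Fin k ⊕ Fin 2 → BasicDatum E P := Sum.elim
    (fun i => ⟨fun x => (e i x).1, fun x => (e i x).2,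
      fun x => (a x).2 (e i x).1 + (e i x).2 (a x).1, 0, 0⟩)
    ![⟨fun x => -(a x).1, fun x => -(a x).2, fun _ => 0, 1, 0⟩, ⟨0, 0, fun _ => -1, 0, 1⟩]
  refine ⟨pr ⁻¹' U, hU.preimage hpr.smooth_proj.continuous, hqU, k + 2,
    fun j => (d (finSumFinEquiv.symm j)).lift pr σ, fun j => SmoothExtOn.of_smoothAt fun q hq => ?_,
    fun q hq => ?_⟩
  · suffices hd : ∀ i, (d i).SmoothAt (pr q) from (hd _).lift hpr hσ
    intro i
    have hU' : U ∈ 𝓝 (pr q) := hU.mem_nhds hq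
    rcases i with i | i
    · have h1 := (he i).1.smoothAt hU'
      have h2 := (he i).2.smoothAt hU'
      exact ⟨h1, h2, ((hα _).apply h1).add (h2.apply (hA _))⟩
    · fin_cases i
      · exact ⟨ContMDiffAt.neg_section (hA _), ContMDiffAt.neg_section (hα _), contMDiffAt_const⟩
      · exact ⟨contMDiff_zeroSection (n := ∞) (IB := 𝓘(ℝ, E)) (F := E) ℝ
          (TangentSpace 𝓘(ℝ, E) : P → Type _) _,
          contMDiff_zeroSection (n := ∞) (IB := 𝓘(ℝ, E)) (F := E →L[ℝ] ℝ) ℝ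
          (fun x : P => TangentSpace 𝓘(ℝ, E) x →L[ℝ] ℝ) _, contMDiffAt_const⟩
  · obtain ⟨hli, hsp⟩ := hspan (pr q) hq
    have hmem (i : Fin k) : e i (pr q) ∈ L (pr q) := by
      rw [← hsp]
      exact Submodule.subset_span ⟨i, rfl⟩
    let v : Fin k → L (pr q) := fun i => ⟨e i (pr q), hmem i⟩
    have hv : LinearIndependent ℝ v := LinearIndependent.of_comp (L (pr q)).subtype hli
    have hvs : ⊤ ≤ Submodule.span ℝ (Set.range v) := by
      rintro ⟨x, hx⟩ -
      rw [← hsp, Submodule.mem_span_range_iff_exists_fun] at hx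
      obtain ⟨c, hc⟩ := hx
      rw [Submodule.mem_span_range_iff_exists_fun]
      refine ⟨c, Subtype.ext (Eq.trans ?_ hc)⟩
      simp [v]
    obtain ⟨b, hb⟩ : ∃ b : Module.Basis (Fin (k + 2)) ℝ (L (pr q) × ℝ × ℝ),
        (fun j => (d (finSumFinEquiv.symm j)).lift pr σ q) =
        fun j => quantMap pr σ β a q (b j) := by
      refine ⟨((Module.Basis.mk hv hvs).prod (Module.Basis.finTwoProd ℝ)).reindex finSumFinEquiv, ?_⟩
      funext j
      simp only [Module.Basis.reindex_apply]
      generalize finSumFinEquiv.symm j = i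
      rcases i with i | i
      · have : ((Module.Basis.mk hv hvs).prod (Module.Basis.finTwoProd ℝ)) (Sum.inl i) =
            (v i, 0, 0) := by
          simp [Module.Basis.prod_apply]
          rfl
        rw [this, quantMap_apply, ha.apply]
        simp [d, v, BasicDatum.lift]
      · fin_cases i
        · have : ((Module.Basis.mk hv hvs).prod (Module.Basis.finTwoProd ℝ)) (Sum.inr 0) =
            (0, 1, 0) := by simp [Module.Basis.prod_apply]
          simp only [Fin.zero_eta]
          rw [this, quantMap_apply]
          simp [d, BasicDatum.lift]
        · have : ((Module.Basis.mk hv hvs).prod (Module.Basis.finTwoProd ℝ)) (Sum.inr 1) =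
            (0, 0, 1) := by simp [Module.Basis.prod_apply]
          simp only [Fin.mk_one]
          rw [this, quantMap_apply]
          simp [d, BasicDatum.lift]
    rw [hb]
    rw [← range_quantMap]
    exact linearIndependent_and_span_of_injective (quantMap_injective hpr hσ q) b

lemma prequantDatum_smoothAt (ha : IsIsotropicExtension L β a) {l : (x : P) → GenTangent E x}
    (hl : IsSectionOf L l) (f g : ℝ) (p : P) :
    (prequantDatum β a (fun x => ⟨l x, hl.2 x⟩) f g).SmoothAt p where
  field := ContMDiffAt.sub_section (hl.field p)
    (ContMDiffAt.const_smul_section (a := f) (ha.smooth.1.smoothAt Filter.univ_mem))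
  form := ContMDiffAt.sub_section (hl.form p)
    (ContMDiffAt.const_smul_section (a := f) (ha.smooth.2.smoothAt Filter.univ_mem))
  vert := by
    simp only [prequantDatum, ha.apply]
    exact (((ha.smooth.2.smoothAt Filter.univ_mem).apply (hl.field p)).add
      ((hl.form p).apply (ha.smooth.1.smoothAt Filter.univ_mem))).sub contMDiffAt_const

/-- Every element of the prequantization subbundle extends to a section induced from the base. -/
lemma exists_prequantDatum [T2Space P] (hL : IsSmoothSubbundle SmoothGenOn L) {q : Q}
    {u : ExtTangent F q} (hu : u ∈ prequantSubbundle pr σ L β a q) :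
    ∃ (l : (x : P) → GenTangent E x) (hl : IsSectionOf L l) (f g : ℝ),
      (prequantDatum β a (fun x => ⟨l x, hl.2 x⟩) f g).lift pr σ q = u := by
  rw [← range_quantMap] at hu
  obtain ⟨⟨l, f, g⟩, rfl⟩ := hu
  -- Only the value at `q` is prescribed, so `f` and `g` may be taken constant and `l` extended by
  -- any section of `L`.
  obtain ⟨e, he, hel⟩ := exists_isSectionOf hL l.2
  refine ⟨e, he, f, g, ?_⟩
  have : l = ⟨e (pr q), he.2 _⟩ := Subtype.ext hel.symm
  rw [this]
  rfl

/-- By self-orthogonality it suffices that the bracket pairs to zero with every `v` in the fibre.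
The values at `q` of the two sections and `v` itself are interpolated by sections induced from the
base. -/
lemma extCourantBracket_mem_prequantSubbundle [T2Space P]
    (hpr : IsPrincipalCircleBundle (E := E) (F := F) pr)
    (hσ : IsConnectionForm σ) {hL : IsDirac L} {Ω : BilinField E P} (hΩ : ∀ x v, Ω x v v = 0)
    (hpreq : PrequantCondition hL Ω β) (hcurv : IsCurvature pr σ Ω)
    (ha : IsIsotropicExtension L β a) {e₁ e₂ : (x : Q) → ExtTangent F x}
    (h₁ : IsExtSectionOf (prequantSubbundle pr σ L β a) e₁)
    (h₂ : IsExtSectionOf (prequantSubbundle pr σ L β a) e₂) (q : Q) :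
    extCourantBracket e₁ e₂ q ∈ prequantSubbundle pr σ L β a q := by
  refine mem_prequantSubbundle_of_orthogonal hpr hσ hL.maximal_isotropic ha fun v hv => ?_
  obtain ⟨l₁, hl₁, f₁, g₁, e1⟩ := exists_prequantDatum hL.subbundle (h₁.2 q)
  obtain ⟨l₂, hl₂, f₂, g₂, e2⟩ := exists_prequantDatum hL.subbundle (h₂.2 q)
  obtain ⟨l₃, hl₃, f₃, g₃, e3⟩ := exists_prequantDatum hL.subbundle hv
  have mem {l : (x : P) → GenTangent E x} (hl : IsSectionOf L l) (f g : ℝ) (y : Q) :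
      (prequantDatum β a (fun x => ⟨l x, hl.2 x⟩) f g).lift pr σ y ∈
        prequantSubbundle pr σ L β a y := by
    rw [← range_quantMap]
    exact ⟨(⟨l (pr y), hl.2 _⟩, f, g), rfl⟩
  have iso := fun y => prequantSubbundle_isotropic hpr hσ (fun x => (hL.maximal_isotropic x).1) ha y
  have s₁ := h₁.1.smoothAt (x := q) Filter.univ_mem
  have s₂ := h₂.1.smoothAt (x := q) Filter.univ_mem
  have t₁ := (prequantDatum_smoothAt ha hl₁ f₁ g₁ (pr q))
  have t₂ := (prequantDatum_smoothAt ha hl₂ f₂ g₂ (pr q))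
  have t₃ := (prequantDatum_smoothAt ha hl₃ f₃ g₃ (pr q))
  have m₁ := mem hl₁ f₁ g₁
  have m₂ := mem hl₂ f₂ g₂
  have m₃ := mem hl₃ f₃ g₃
  have base := baseTerm_cyclic_sum hΩ hpreq ha hl₁ hl₂ hl₃ f₁ g₁ f₂ g₂ f₃ g₃ (pr q)
  set d₁ := prequantDatum β a (fun x => ⟨l₁ x, hl₁.2 x⟩) f₁ g₁ with hd₁
  set d₂ := prequantDatum β a (fun x => ⟨l₂ x, hl₂.2 x⟩) f₂ g₂ with hd₂
  set d₃ := prequantDatum β a (fun x => ⟨l₃ x, hl₃.2 x⟩) f₃ g₃ with hd₃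
  have r₁ := t₁.lift hpr hσ
  have r₂ := t₂.lift hpr hσ
  have r₃ := t₃.lift hpr hσ
  -- Each formula writes a pairing as the same kind of cyclic sum. `A` and `B` share one, and the
  -- bracket in `B` is paired only with the value of `e₁` at `q`, so `C` may use the lift of `d₁`
  -- instead. `C` and `D` share the next, and likewise `G` trades `e₂` for the lift of `d₂`. In `G`
  -- all three sections come from the base.
  have A := two_mul_extPairPlus_bracket s₁ s₂ r₃ (fun y => iso y _ (h₁.2 y) _ (h₂.2 y))
    (fun y => iso y _ (h₁.2 y) _ (m₃ y))
  have B := two_mul_extPairPlus_bracket s₂ r₃ s₁ (fun y => iso y _ (h₂.2 y) _ (m₃ y))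
    (fun y => iso y _ (h₂.2 y) _ (h₁.2 y))
  have C := two_mul_extPairPlus_bracket s₂ r₃ r₁ (fun y => iso y _ (h₂.2 y) _ (m₃ y))
    (fun y => iso y _ (h₂.2 y) _ (m₁ y))
  have D := two_mul_extPairPlus_bracket r₃ r₁ s₂ (fun y => iso y _ (m₃ y) _ (m₁ y))
    (fun y => iso y _ (m₃ y) _ (h₂.2 y))
  have G := two_mul_extPairPlus_bracket r₃ r₁ r₂ (fun y => iso y _ (m₃ y) _ (m₁ y))
    (fun y => iso y _ (m₃ y) _ (m₂ y))
  rw [← e3]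
  rw [← e1] at B
  rw [← e2] at D
  rw [jacobiTerm_lift hpr hσ hcurv t₃ t₁ t₂, jacobiTerm_lift hpr hσ hcurv t₁ t₂ t₃,
    jacobiTerm_lift hpr hσ hcurv t₂ t₃ t₁] at G
  simp only at base
  linear_combination (1 / 2 : ℝ) * (A - B + C - D + G + base)

lemma prequantSubbundle_isDiracJacobi [T2Space P]
    (hpr : IsPrincipalCircleBundle (E := E) (F := F) pr)
    (hσ : IsConnectionForm σ) {hL : IsDirac L} {Ω : BilinField E P} (hΩ : ∀ x v, Ω x v v = 0)
    (hpreq : PrequantCondition hL Ω β) (hcurv : IsCurvature pr σ Ω)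
    (ha : IsIsotropicExtension L β a) : IsDiracJacobi (prequantSubbundle pr σ L β a) where
  subbundle := prequantSubbundle_isSmoothSubbundle hpr hσ hL.subbundle ha
  maximal_isotropic := prequantSubbundle_maximal hpr hσ hL.maximal_isotropic ha
  integrable _ _ h₁ h₂ q :=
    extCourantBracket_mem_prequantSubbundle hpr hσ hΩ hpreq hcurv ha h₁ h₂ q

end Jacobi

/-! ### Existence of the isotropic section representing `β` -/

section Extension

open Filter Topology

set_option synthInstance.maxHeartbeats 200000

lemma exists_sharp {V : Type*} [NormedAddCommGroup V] [NormedSpace ℝ V] [FiniteDimensional ℝ V]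
    (g : V →L[ℝ] V →L[ℝ] ℝ) (hg : ∀ v, v ≠ 0 → 0 < g v v) :
    ∃ s : (V →L[ℝ] ℝ) →ₗ[ℝ] V, ∀ ξ, g (s ξ) = ξ := by
  have hinj : Function.Injective g.toLinearMap := by
    refine (injective_iff_map_eq_zero _).2 fun v hv => ?_
    by_contra h
    have h1 := hg v h
    rw [show g v = 0 from hv] at h1
    exact lt_irrefl _ h1
  have hrank : Module.finrank ℝ V = Module.finrank ℝ (V →L[ℝ] ℝ) := by
    rw [← LinearMap.toContinuousLinearMap.finrank_eq, Subspace.dual_finrank_eq]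
  let T := LinearEquiv.ofBijective g.toLinearMap
    ⟨hinj, (LinearMap.injective_iff_surjective_of_finrank_eq_finrank hrank).1 hinj⟩
  exact ⟨T.symm.toLinearMap, fun ξ => T.apply_symm_apply ξ⟩

lemma exists_represents_of_posDef {V : Type*} [AddCommGroup V] [Module ℝ V]
    [FiniteDimensional ℝ V] (S : Submodule ℝ V) (G : V →ₗ[ℝ] V →ₗ[ℝ] ℝ)
    (hG : ∀ v, v ≠ 0 → 0 < G v v) (β : S →ₗ[ℝ] ℝ) : ∃ l : S, ∀ m : S, β m = G l m := by
  let T : S →ₗ[ℝ] Module.Dual ℝ S := (G.domRestrict₁₂ S S)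
  have hinj : Function.Injective T := by
    refine (injective_iff_map_eq_zero _).2 fun v hv => ?_
    by_contra h
    have h1 := hG v (by simpa using h)
    have h2 : T v v = 0 := by rw [hv]; rfl
    exact h1.ne' h2
  obtain ⟨l, hl⟩ := (LinearMap.injective_iff_surjective_of_finrank_eq_finrank
    (Subspace.dual_finrank_eq (K := ℝ) (V := S)).symm).1 hinj β
  exact ⟨l, fun m => by rw [← hl]; rfl⟩

variable {E : Type*} [NormedAddCommGroup E] [NormedSpace ℝ E] [FiniteDimensional ℝ E]
  {P : Type*} [TopologicalSpace P] [ChartedSpace E P] [IsManifold 𝓘(ℝ, E) ∞ P]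

/-- A field of bilinear forms is a Riemannian metric. -/
structure IsRiemannian (g : BilinField E P) : Prop where
  smooth : ∀ {X Y : VField E P} {p : P}, SmoothVFieldAt X p → SmoothVFieldAt Y p →
    ContMDiffAt 𝓘(ℝ, E) 𝓘(ℝ, ℝ) ∞ (fun y => g y (X y) (Y y)) p
  symm : ∀ p v w, g p v w = g p w v
  pos : ∀ p v, v ≠ 0 → 0 < g p v v

/-- Symmetric positive definite forms are convex in each fibre, so the fixed form `J`, transported
by local trivializations, is glued by a partition of unity. -/
lemma exists_isRiemannian [T2Space P] [SigmaCompactSpace P] :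
    ∃ g : BilinField E P, IsRiemannian g := by
  obtain ⟨J, hJs, hJp⟩ := exists_posDef_dual E
  suffices h : ∃ s : ContMDiffSection 𝓘(ℝ, E) (E →L[ℝ] E →L[ℝ] ℝ) ∞
      (fun x : P => TangentSpace 𝓘(ℝ, E) x →L[ℝ] TangentSpace 𝓘(ℝ, E) x →L[ℝ] ℝ),
      ∀ x, s x ∈ {g : TangentSpace 𝓘(ℝ, E) x →L[ℝ] TangentSpace 𝓘(ℝ, E) x →L[ℝ] ℝ |
        (∀ v w, g v w = g w v) ∧ ∀ v, v ≠ 0 → 0 < g v v} by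
    obtain ⟨s, hs⟩ := h
    refine ⟨s, fun {X Y p} hX hY => ?_, fun p => (hs p).1, fun p => (hs p).2⟩
    have h1 := ContMDiffAt.clm_bundle_apply (F₂ := E →L[ℝ] ℝ)
      (E₂ := fun x : P => TangentSpace 𝓘(ℝ, E) x →L[ℝ] ℝ) (s.contMDiff p) hX
    exact SmoothOneFormAt.apply h1 hY
  refine exists_contMDiffSection_forall_mem_convex_of_local (n := (⊤ : ℕ∞)) 𝓘(ℝ, E) _ _ ?_ ?_
  · rintro x g ⟨hg, hg'⟩ h ⟨hh, hh'⟩ a b ha hb hab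
    refine ⟨fun v w => ?_, fun v hv => ?_⟩
    · change a * g v w + b * h v w = a * g w v + b * h w v
      rw [hg, hh]
    · change 0 < a * g v v + b * h v v
      rcases ha.eq_or_lt with rfl | ha
      · rw [zero_add] at hab
        rw [hab]
        linarith [hh' v hv]
      · exact add_pos_of_pos_of_nonneg (mul_pos ha (hg' v hv)) (mul_nonneg hb (hh' v hv).le)
  · intro x₀
    let t := trivializationAt E (TangentSpace 𝓘(ℝ, E) : P → Type _) x₀
    have ht : t.baseSet ∈ 𝓝 x₀ :=
      t.open_baseSet.mem_nhds (FiberBundle.mem_baseSet_trivializationAt' x₀)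
    let φ (y : P) : TangentSpace 𝓘(ℝ, E) y →L[ℝ] E := t.continuousLinearMapAt ℝ y
    have hφ {X : VField E P} {y : P} (hy : y ∈ t.baseSet) (hX : SmoothVFieldAt X y) :
        ContMDiffAt 𝓘(ℝ, E) 𝓘(ℝ, E) ∞ (fun z => φ z (X z)) y := by
      refine ((t.contMDiffAt_section_iff hy).1 hX).congr_of_eventuallyEq ?_
      filter_upwards [t.open_baseSet.mem_nhds hy] with z hz
      exact (t.linearMapAt_apply (R := ℝ) _).trans (if_pos hz)
    refine ⟨t.baseSet, ht, fun y => (ContinuousLinearMap.precomp ℝ (φ y)).comp (J.comp (φ y)),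
      fun y hy => ContMDiffAt.contMDiffWithinAt ?_, fun y hy => ⟨fun v w => hJs _ _, fun v hv => ?_⟩⟩
    · refine contMDiffAt_hom_of_apply (V := fun y : P => TangentSpace 𝓘(ℝ, E) y →L[ℝ] ℝ)
        fun X hX => smoothOneFormAt_of_apply fun Y hY => ?_
      exact (J.contMDiff.contMDiffAt.comp y (hφ hy hX)).clm_apply (hφ hy hY)
    · refine hJp _ fun h => hv ?_
      have := t.symmₗ_linearMapAt (R := ℝ) hy v
      rw [← this]
      exact (congrArg _ h).trans (map_zero _)

lemma IsRiemannian.smoothOneFormAt {g : BilinField E P} (hg : IsRiemannian g) {X : VField E P}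
    {p : P} (hX : SmoothVFieldAt X p) : SmoothOneFormAt (fun y => g y (X y)) p :=
  smoothOneFormAt_of_apply fun _ hY => hg.smooth hX hY

/-- Pairing with a local frame is an injective smooth bundle map to `ℝⁿ`, since a vector orthogonal
to the whole frame has length zero. The evaluation criterion then applies. -/
lemma IsRiemannian.smoothVFieldAt {g : BilinField E P} (hg : IsRiemannian g) {X : VField E P}
    {p : P} (hX : SmoothOneFormAt (fun y => g y (X y)) p) : SmoothVFieldAt X p := by
  let t := trivializationAt E (TangentSpace 𝓘(ℝ, E) : P → Type _) p
  have hp : p ∈ t.baseSet := FiberBundle.mem_baseSet_trivializationAt' p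
  have hf : IsLocalFrameOn 𝓘(ℝ, E) E ∞ (t.localFrame (Module.finBasis ℝ E)) t.baseSet :=
    t.isLocalFrameOn_localFrame_baseSet 𝓘(ℝ, E) ∞ _
  have hb (i) := hf.contMDiffAt t.open_baseSet hp i
  refine smoothVFieldAt_of_apply (K := Fin (Module.finrank ℝ E) → ℝ)
    (Λ := fun y =>
      { toFun := fun v i => g y v (t.localFrame (Module.finBasis ℝ E) i y)
        map_add' := fun v w => by ext i; simp
        map_smul' := fun c v => by ext i; simp })
    (fun Y hY => contMDiffAt_pi_space.2 fun i => hg.smooth hY (hb i)) ?_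
    (contMDiffAt_pi_space.2 fun i => hX.apply (hb i))
  refine (injective_iff_map_eq_zero _).2 fun v hv => ?_
  by_contra hne
  have h1 := hg.pos p v hne
  have h2 (w) : g p v w = 0 := by
    have hw : w ∈ Submodule.span ℝ (Set.range fun i => t.localFrame (Module.finBasis ℝ E) i p) :=
      hf.generating hp (Submodule.mem_top)
    induction hw using Submodule.span_induction with
    | mem x hx =>
      obtain ⟨i, rfl⟩ := hx
      exact congrFun hv i
    | zero => exact map_zero _
    | add x y _ _ hx hy => rw [map_add, hx, hy, add_zero]
    | smul c x _ hx => rw [map_smul, hx, smul_zero]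
  exact h1.ne' (h2 v)

variable {L : (x : P) → Submodule ℝ (GenTangent E x)} {β : (x : P) → (L x →ₗ[ℝ] ℝ)}

/-- Evaluation of a smooth section of `L^*` on a local section of `L`. -/
lemma IsSmoothDualSection.contMDiffOn (hβ : IsSmoothDualSection L β) {U : Set P} (hU : IsOpen U)
    {e : (x : P) → GenTangent E x} (he : SmoothGenOn e U) (heL : ∀ x ∈ U, e x ∈ L x) {b : P → ℝ}
    (hb : ∀ x (hx : x ∈ U), b x = β x ⟨e x, heL x hx⟩) :
    ContMDiffOn 𝓘(ℝ, E) 𝓘(ℝ, ℝ) ∞ b U := by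
  classical
  -- A local section must be given at all points with values in `L`; extension by zero is harmless
  -- because smoothness is tested on `U` only.
  let e' : (x : P) → L x := fun x => if hx : x ∈ U then ⟨e x, heL x hx⟩ else 0
  have he' : ∀ x ∈ U, (e' x : GenTangent E x) = e x := fun x hx => by simp [e', hx]
  have h := hβ U hU e' ⟨he.1.congr fun x hx => by simp only [he' x hx],
    he.2.congr fun x hx => by simp only [he' x hx]⟩
  refine h.congr fun x hx => ?_
  rw [hb x hx]
  congr 1
  exact Subtype.ext (he' x hx).symm

/-- Any smooth section of the dual of a Dirac structure is represented by an isotropic section of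
`TP ⊕ T^*P`. -/
lemma exists_isIsotropicExtension [T2Space P] [SigmaCompactSpace P] (hL : IsDirac L)
    (hβ : IsSmoothDualSection L β) : ∃ a, IsIsotropicExtension L β a := by
  obtain ⟨g, hg⟩ := exists_isRiemannian (E := E) (P := P)
  have hs (p : P) : ∃ s : (TangentSpace 𝓘(ℝ, E) p →L[ℝ] ℝ) →ₗ[ℝ] TangentSpace 𝓘(ℝ, E) p,
      ∀ ξ, g p (s ξ) = ξ := exists_sharp (V := E) (g p) (hg.pos p)
  choose s hs using hs
  have hs' (p : P) (ξ η : TangentSpace 𝓘(ℝ, E) p →L[ℝ] ℝ) : η (s p ξ) = g p (s p ξ) (s p η) := by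
    rw [hg.symm, hs]
  -- The sum of the metric and its dual: positive definite, and equal to twice the pairing with the
  -- swapped vector `ξ^♯ ⊕ X^♭`.
  let G (p : P) : GenTangent E p →ₗ[ℝ] GenTangent E p →ₗ[ℝ] ℝ :=
    LinearMap.mk₂ ℝ (fun u v => g p u.1 v.1 + v.2 (s p u.2))
      (fun u u' v => by simp; ring) (fun c u v => by simp; ring) (fun u v v' => by simp; ring)
      (fun c u v => by simp; ring)
  have hG (p : P) (u v : GenTangent E p) : G p u v = g p u.1 v.1 + v.2 (s p u.2) := rfl
  have hGpos (p : P) (u : GenTangent E p) (hu : u ≠ 0) : 0 < G p u u := by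
    rw [hG, hs']
    by_cases h1 : u.1 = 0
    · have h2 : s p u.2 ≠ 0 := by
        intro h
        refine hu (Prod.ext h1 ?_)
        rw [← hs p u.2, h, map_zero]
        rfl
      rw [h1, map_zero, zero_add]
      exact hg.pos p _ h2
    · refine add_pos_of_pos_of_nonneg (hg.pos p _ h1) ?_
      by_cases h2 : s p u.2 = 0
      · rw [h2, map_zero]
      · exact (hg.pos p _ h2).le
  have hl (p : P) : ∃ l : L p, ∀ m : L p, β p m = G p l m := by
    have : FiniteDimensional ℝ (GenTangent E p) :=
      inferInstanceAs (FiniteDimensional ℝ (E × (E →L[ℝ] ℝ)))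
    exact exists_represents_of_posDef (L p) (G p) (hGpos p) (β p)
  choose l hl using hl
  have hsmooth (p : P) : SmoothVFieldAt (fun x => (l x).1.1) p ∧
      SmoothOneFormAt (fun x => (l x).1.2) p := by
    obtain ⟨U, hU, hpU, k, e, he, hspan⟩ := hL.subbundle p
    have hUp : U ∈ 𝓝 p := hU.mem_nhds hpU
    have heL (i : Fin k) : ∀ x ∈ U, e i x ∈ L x := fun x hx => by
      rw [← (hspan x hx).2]
      exact Submodule.subset_span ⟨i, rfl⟩
    have hc (x : P) : ∃ c : Fin k → ℝ, x ∈ U → ∑ i, c i • e i x = l x := by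
      by_cases hx : x ∈ U
      · have : (l x : GenTangent E x) ∈ Submodule.span ℝ (Set.range fun i => e i x) := by
          rw [(hspan x hx).2]
          exact (l x).2
        rw [Submodule.mem_span_range_iff_exists_fun] at this
        obtain ⟨c, hc⟩ := this
        exact ⟨c, fun _ => hc⟩
      · exact ⟨0, fun h => absurd h hx⟩
    choose c hc using hc
    have h1 (i : Fin k) := (he i).1.smoothAt hUp
    have h2 (i : Fin k) := (he i).2.smoothAt hUp
    have h3 (i : Fin k) : SmoothVFieldAt (fun x => s x (e i x).2) p :=
      hg.smoothVFieldAt (by simpa only [hs] using h2 i)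
    -- The coefficients of `l` solve a linear system whose matrix is the Gram matrix of the frame
    -- for `G` and whose right side is `β(eⱼ)`. The Gram matrix is invertible because `G` is
    -- positive definite.
    have hcs (j : Fin k) : ContMDiffAt 𝓘(ℝ, E) 𝓘(ℝ, ℝ) ∞ (fun x => c x j) p := by
      refine contMDiffAt_coeff (K := Fin k → ℝ) (w := fun i x j => G x (e i x) (e j x))
        (k := fun x j => G x (l x) (e j x))
        (fun i => contMDiffAt_pi_space.2 fun j => (hg.smooth (h1 i) (h1 j)).add ((h2 j).apply (h3 i)))
        (contMDiffAt_pi_space.2 fun j => ?_) ?_ ?_ j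
      · exact (hβ.contMDiffOn hU (he j) (heL j)
          fun x hx => (hl x ⟨e j x, heL j x hx⟩).symm).contMDiffAt hUp
      · rw [Fintype.linearIndependent_iff]
        intro d hd
        have h0 : ∑ i, d i • e i p = 0 := by
          by_contra hne
          refine (hGpos p _ hne).ne' ?_
          conv_lhs => rw [map_sum (G p (∑ i, d i • e i p))]
          refine Finset.sum_eq_zero fun j _ => ?_
          have := congrFun hd j
          simp only [Finset.sum_apply, Pi.smul_apply, smul_eq_mul, Pi.zero_apply] at this
          rw [map_smul, map_sum, LinearMap.sum_apply]
          simp only [map_smul, LinearMap.smul_apply, smul_eq_mul]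
          rw [this, mul_zero]
        exact Fintype.linearIndependent_iff.1 (hspan p hpU).1 d h0
      · filter_upwards [hUp] with x hx
        funext j
        rw [← hc x hx, map_sum, LinearMap.sum_apply]
        simp
    constructor
    · have := ContMDiffAt.sum_section (s := Finset.univ) (t := fun i y => c y i • (e i y).1)
        fun i _ => ContMDiffAt.smul_section (hcs i) (h1 i)
      refine ContMDiffAt.congr_of_eventuallyEq this ?_
      filter_upwards [hUp] with x hx
      rw [← hc x hx]
      simp [Prod.fst_sum]
    · have := ContMDiffAt.sum_section (s := Finset.univ) (t := fun i y => c y i • (e i y).2)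
        fun i _ => ContMDiffAt.smul_section (hcs i) (h2 i)
      refine ContMDiffAt.congr_of_eventuallyEq this ?_
      filter_upwards [hUp] with x hx
      rw [← hc x hx]
      simp [Prod.snd_sum]
  -- The swap `X ⊕ ξ ↦ ξ^♯ ⊕ X^♭` preserves the pairing, so the image of `l` is null because `l`
  -- lies in the isotropic `L`.
  refine ⟨fun p => (s p (l p).1.2, g p (l p).1.1), ⟨fun p _ => ?_, fun p _ => ?_⟩, fun p => ?_,
    fun p m => ?_⟩
  · exact ContMDiffAt.contMDiffWithinAt
      (hg.smoothVFieldAt (by simpa only [hs] using (hsmooth p).2))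
  · exact ContMDiffAt.contMDiffWithinAt (hg.smoothOneFormAt (hsmooth p).1)
  · have h := (hL.maximal_isotropic p).1 _ (l p).2 _ (l p).2
    simp only [pairPlus] at h ⊢
    rw [hg.symm, hs]
    exact h
  · rw [hl, hG, pairPlus]
    ring

end Extension

end

end DiracGeometry

theorem theorem4p1
    {E : Type*} [NormedAddCommGroup E] [NormedSpace ℝ E] [FiniteDimensional ℝ E]
    {P : Type*} [TopologicalSpace P] [T2Space P] [SigmaCompactSpace P]
    [ChartedSpace E P] [IsManifold 𝓘(ℝ, E) ∞ P]
    {F : Type*} [NormedAddCommGroup F] [NormedSpace ℝ F] [FiniteDimensional ℝ F]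
    {Q : Type*} [TopologicalSpace Q] [T2Space Q] [SigmaCompactSpace Q]
    [ChartedSpace F Q] [IsManifold 𝓘(ℝ, F) ∞ Q] [MulAction Circle Q]
    (L : (x : P) → Submodule ℝ (DiracGeometry.GenTangent E x))
    (hL : DiracGeometry.IsDirac L)
    (Ω : DiracGeometry.BilinField E P) (hΩ : DiracGeometry.IsTwoForm Ω)
    (β : (x : P) → (L x →ₗ[ℝ] ℝ)) (hβ : DiracGeometry.IsSmoothDualSection L β)
    (hpreq : DiracGeometry.PrequantCondition hL Ω β)
    (pr : Q → P)
    (hpr : DiracGeometry.IsPrincipalCircleBundle (E := E) (F := F) pr)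
    (σ : DiracGeometry.OneForm F Q) (hσ : DiracGeometry.IsConnectionForm σ)
    (hcurv : DiracGeometry.IsCurvature pr σ Ω) :
    (∃ a : (x : P) → DiracGeometry.GenTangent E x,
      DiracGeometry.IsIsotropicExtension L β a) ∧
    (∀ a : (x : P) → DiracGeometry.GenTangent E x,
      DiracGeometry.IsIsotropicExtension L β a →
        (∀ q : Q, iSupIndep ![DiracGeometry.liftPart pr σ L β q,
          DiracGeometry.reebLine q, DiracGeometry.connLine pr σ a q]) ∧
        DiracGeometry.IsDiracJacobi (DiracGeometry.prequantSubbundle pr σ L β a)) ∧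
    (∀ a a' : (x : P) → DiracGeometry.GenTangent E x,
      DiracGeometry.IsIsotropicExtension L β a →
      DiracGeometry.IsIsotropicExtension L β a' →
        DiracGeometry.prequantSubbundle pr σ L β a =
          DiracGeometry.prequantSubbundle pr σ L β a') := by
  refine ⟨DiracGeometry.exists_isIsotropicExtension hL hβ, fun a ha =>
    ⟨DiracGeometry.iSupIndep_parts hpr hσ,
      DiracGeometry.prequantSubbundle_isDiracJacobi hpr hσ hΩ.alternating hpreq hcurv ha⟩,
    fun a a' ha ha' => funext fun q => le_antisymm
      (DiracGeometry.prequantSubbundle_le hL.maximal_isotropic ha ha' q)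
      (DiracGeometry.prequantSubbundle_le hL.maximal_isotropic ha' ha q)⟩
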